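/- **Setting.** Let $\underline\nu^\perp\cong\mathbb{Z}^{d}$ ($d=n-1$) be a lattice and let $R_0,\dots,R_p$ be lattice simplices in $\underline\nu^\perp_{\mathbb R}$, where $R_i$ has vertices $0,u^i_1,\dots,u^i_{k_i}$, $k_i\ge 1$, and is unimodular ($u^i_1,\dots,u^i_{k_i}$ are linearly independent and generate all lattice points of the real subspace they span). Let $\hat\sigma\subset(\underline\nu^\perp\oplus\mathbb{Z}^{p+1})_{\mathbb R}$ be the cone over $\bigcup_i R_i\times\{e_i\}$, let $\mathcal X=X_{\hat\sigma}$ be its affine toric variety, and let $t_i$ be the function on $\mathcal X$ given by the dual basis vector $\check e_i$. Let $c_0=0,c_1,\dots,c_p\in\mathbb{C}$ be constants and let $$\mathcal X_c=\{\,t_0-t_i=c_i,\ i=0,\dots,p\,\}\subset\mathcal X,\qquad t:=t_0 .$$ Let $\bar{\mathcal X}_c=\mathcal X_c\cup D_\infty$ be its closure in the toric variety of the fan consisting of the faces of $\hat\sigma$ and of the ray generated by $-e_0-\dots-e_p$; here $D_\infty=\{t=\infty\}$. Let $K>0$ be such that the numbers $|c_i-K|$ are non-zero and pairwise distinct. Let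 $X$ be $\mathcal X_c$ or $\bar{\mathcal X}_c$, with a Kähler form $\omega$ invariant under the compact torus $T=\underline\nu^\perp\otimes U(1)$ (which acts on $X$ preserving $t$) and with a $T$-moment map $\pi_0:X\to(\underline\nu^\perp_{\mathbb R})^*=M_{\mathbb R}/\mathbb{R}\langle\underline\nu\rangle$. Let $$\pi^K=(\pi_0,\ |t-K|^2-K^2)$$ be the Gross fibration on $X\setminus D_\infty$, assumed to have compact fibers $F_r$. Let $B$ be its image, let $\Gamma\subset B$ be its discriminant locus (the set of critical values, which includes those with $t=K$), and let $B_0=B\setminus\Gamma$. The *wall* is $$H=\{r\in B_0:\ F_r\text{ bounds a non-constant holomorphic disc in }X\text{ of Maslov index }0\},$$ and $H_i=\big(M_{\mathbb R}/\mathbb{R}\langle\underline\nu\rangle\big)\times\{|c_i-K|^2-K^2\}$. **Proposition.** Both for $X=\mathcal X_c$ and for $X=\bar{\mathcal X}_c$, the wall of the Gross fibration is the union of the hyperplanes $H_0,\dots,H_p$ in $B_0$: $$H=\Big(\bigcup_{i=0}^pH_i\Big)\cap B_0 .$$ Moreover the hyperplanes $H_0,\dots,H_p$ are pairwise disjoint.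 -/

import Mathlib

open scoped Topology

noncomputable section

namespace GrossFibration

/-! ### Lattices, cones and fans

`d` is the rank `n - 1` of the lattice `ν^⊥`, identified with `ℤ^d` by a basis. -/

/-- The lattice `N̂ = ν^⊥ ⊕ ℤ^(p+1)`. -/
abbrev NLattice (d p : ℕ) : Type := (Fin d → ℤ) × (Fin (p + 1) → ℤ)

/-- The dual lattice `M̂` of `N̂`. -/
abbrev MLattice (d p : ℕ) : Type := (Fin d → ℤ) × (Fin (p + 1) → ℤ)

/-- The target `M_ℝ / ℝν × ℝ` of the fibration, where `M_ℝ / ℝν` is the dual of `ν^⊥_ℝ`. -/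
abbrev Base (d : ℕ) : Type := (Fin d → ℝ) × ℝ

variable {d p : ℕ}

/-- The duality pairing of `M̂` and `N̂`. -/
def pairing (m : MLattice d p) (g : NLattice d p) : ℤ :=
  ∑ j, m.1 j * g.1 j + ∑ i, m.2 i * g.2 i

theorem pairing_zero (g : NLattice d p) : pairing (0 : MLattice d p) g = 0 := by
  simp [pairing]

theorem pairing_add (m m' : MLattice d p) (g : NLattice d p) :
    pairing (m + m') g = pairing m g + pairing m' g := by
  simp only [pairing, Prod.fst_add, Prod.snd_add, Pi.add_apply, add_mul, Finset.sum_add_distrib]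
  ring

/-- The simplex with vertices `0, u₁, …, u_k` is a unimodular `k`-simplex: its vertices are
independent and generate all the lattice points of the real subspace that they span. -/
def IsUnimodularSimplex {k : ℕ} (u : Fin k → Fin d → ℤ) : Prop :=
  LinearIndependent ℝ (fun j l => ((u j l : ℤ) : ℝ)) ∧
    ∀ v : Fin d → ℤ,
      (fun l => ((v l : ℤ) : ℝ)) ∈ Submodule.span ℝ (Set.range fun j l => ((u j l : ℤ) : ℝ)) →
        v ∈ Submodule.span ℤ (Set.range u)

/-- The generators `(v, e_i)`, with `v` a vertex of `R_i`, of the cone `σ̂` over the union of the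
`R_i × {e_i}`; the vertices of `R_i` are `0` and the `u i j`. -/
def coneGenerators {k : Fin (p + 1) → ℕ} (u : ∀ i, Fin (k i) → Fin d → ℤ) :
    Set (NLattice d p) :=
  {g | ∃ i, ∃ v ∈ insert 0 (Set.range (u i)), g = (v, Pi.single i 1)}

/-- The lattice points `τ^∨ ∩ M̂` of the dual of the cone `τ` generated by `G`. -/
def dualMonoid (G : Set (NLattice d p)) : Set (MLattice d p) :=
  {m | ∀ g ∈ G, 0 ≤ pairing m g}

/-- The fan of all faces of the cone generated by `G`.  A face is recorded by those elements of `G`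
that lie on it, and it is cut out by a lattice point of the dual cone. -/
def faceFan (G : Set (NLattice d p)) : Set (Set (NLattice d p)) :=
  {F | ∃ m ∈ dualMonoid G, F = {g ∈ G | pairing m g = 0}}

/-- The generator `-e_0 - … - e_p` of the ray at infinity. -/
def infinityRay (d p : ℕ) : NLattice d p := (0, fun _ => -1)

/-- The fan `σ̂`. -/
def affineFan {k : Fin (p + 1) → ℕ} (u : ∀ i, Fin (k i) → Fin d → ℤ) :
    Set (Set (NLattice d p)) :=
  faceFan (coneGenerators u)

/-- The fan `σ̂` with the ray generated by `-e_0 - … - e_p` added. -/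
def compactifiedFan {k : Fin (p + 1) → ℕ} (u : ∀ i, Fin (k i) → Fin d → ℤ) :
    Set (Set (NLattice d p)) :=
  insert {infinityRay d p} (affineFan u)

/-! ### The toric variety of a fan -/

/-- A (closed) point of the complex toric variety of a fan: a cone `τ` of the fan and a point of the
torus orbit `O(τ)`, that is a homomorphism of monoids `τ^∨ ∩ M̂ → (ℂ, ·)` whose non-zero values are
taken exactly on `τ^⊥ ∩ M̂`.  The value `val m` is that of the character `χ^m`, which is regular at the
point exactly when `m ∈ τ^∨`; outside `τ^∨` the field `val` has no meaning and is set to `0`. -/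
@[ext]
structure ToricPoint (fan : Set (Set (NLattice d p))) where
  cone : Set (NLattice d p)
  cone_mem : cone ∈ fan
  val : MLattice d p → ℂ
  val_outside : ∀ m, m ∉ dualMonoid cone → val m = 0
  val_zero : val 0 = 1
  val_add : ∀ m ∈ dualMonoid cone, ∀ m' ∈ dualMonoid cone, val (m + m') = val m * val m'
  val_ne_zero_iff : ∀ m ∈ dualMonoid cone, (val m ≠ 0 ↔ ∀ g ∈ cone, pairing m g = 0)

variable {fan : Set (Set (NLattice d p))}

/-- The exponents of the characters that are regular at the point. -/
def ToricPoint.dom (x : ToricPoint fan) : Set (MLattice d p) := dualMonoid x.cone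

/-- The classical (analytic) topology: the domains of the characters are open, and the characters
are continuous on them. -/
instance : TopologicalSpace (ToricPoint fan) :=
  TopologicalSpace.generateFrom
    {O | ∃ (m : MLattice d p) (V : Set ℂ), IsOpen V ∧
      O = {x : ToricPoint fan | m ∈ x.dom ∧ x.val m ∈ V}}

/-- The exponent of the function `t_i`, i.e. the dual basis vector `(0, ě_i)` of `M̂`. -/
def tExp (d : ℕ) (i : Fin (p + 1)) : MLattice d p := (0, Pi.single i 1)

/-! ### The smoothing -/

/-- The fibre of the family over `c`: the subvariety of the toric variety on which every regular
multiple `χ^m (t_0 - t_i - c_i)` of `t_0 - t_i - c_i` by a character vanishes.  On the affine toric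
variety of `σ̂` this says `t_i = t_0 - c_i`; near the divisor at infinity it says
`t_i / t_0 = 1 - c_i / t_0`. -/
def Smoothing (fan : Set (Set (NLattice d p))) (c : Fin (p + 1) → ℂ) : Type :=
  {x : ToricPoint fan // ∀ (i : Fin (p + 1)) (m : MLattice d p),
    m ∈ x.dom → m + tExp d i ∈ x.dom → m + tExp d 0 ∈ x.dom →
      x.val (m + tExp d i) = x.val (m + tExp d 0) - c i * x.val m}

variable {c : Fin (p + 1) → ℂ}

instance : TopologicalSpace (Smoothing fan c) := instTopologicalSpaceSubtype

/-- The characters that are regular at the point. -/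
def Smoothing.dom (x : Smoothing fan c) : Set (MLattice d p) := x.1.dom

/-- The value of the character `χ^m`. -/
def Smoothing.val (x : Smoothing fan c) (m : MLattice d p) : ℂ := x.1.val m

/-- The function `t = t_0`, which is regular where `tExp d 0 ∈ x.dom`. -/
def Smoothing.t (x : Smoothing fan c) : ℂ := x.val (tExp d 0)

/-- The complement of the divisor `D_∞ = {t = ∞}`. -/
def finitePart (fan : Set (Set (NLattice d p))) (c : Fin (p + 1) → ℂ) : Set (Smoothing fan c) :=
  {x | tExp d 0 ∈ x.dom}

/-- The tangent space at `x`: the derivations of the regular functions at `x` that are tangent to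
the smoothing, recorded by their values on characters. -/
def tangent (x : Smoothing fan c) : Submodule ℂ (MLattice d p → ℂ) where
  carrier := {v | (∀ m, m ∉ x.dom → v m = 0) ∧
    (∀ m ∈ x.dom, ∀ m' ∈ x.dom, v (m + m') = x.val m * v m' + x.val m' * v m) ∧
    (∀ (i : Fin (p + 1)) (m : MLattice d p),
      m ∈ x.dom → m + tExp d i ∈ x.dom → m + tExp d 0 ∈ x.dom →
        v (m + tExp d i) = v (m + tExp d 0) - c i * v m)}
  zero_mem' := by simp
  add_mem' := by
    rintro v w ⟨hv, hv', hv''⟩ ⟨hw, hw', hw''⟩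
    refine ⟨fun m hm => by simp [hv m hm, hw m hm], fun m hm m' hm' => ?_, fun i m h h' h'' => ?_⟩
    · simp only [Pi.add_apply, hv' m hm m' hm', hw' m hm m' hm']; ring
    · simp only [Pi.add_apply, hv'' i m h h' h'', hw'' i m h h' h'']; ring
  smul_mem' := by
    rintro a v ⟨hv, hv', hv''⟩
    refine ⟨fun m hm => by simp [hv m hm], fun m hm m' hm' => ?_, fun i m h h' h'' => ?_⟩
    · simp only [Pi.smul_apply, smul_eq_mul, hv' m hm m' hm']; ring
    · simp only [Pi.smul_apply, smul_eq_mul, hv'' i m h h' h'']; ring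

/-! ### The action of the torus `T^{⊥ν}` -/

/-- The weight of the character `χ^m` on the Lie algebra `ν^⊥_ℝ` of the torus. -/
def weight (m : MLattice d p) (ξ : Fin d → ℝ) : ℝ := ∑ j, (m.1 j : ℝ) * ξ j

theorem weight_zero (ξ : Fin d → ℝ) : weight (0 : MLattice d p) ξ = 0 := by simp [weight]

theorem weight_add (m m' : MLattice d p) (ξ : Fin d → ℝ) :
    weight (m + m') ξ = weight m ξ + weight m' ξ := by
  simp [weight, add_mul, Finset.sum_add_distrib]

theorem weight_add_tExp (m : MLattice d p) (i : Fin (p + 1)) (ξ : Fin d → ℝ) :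
    weight (m + tExp d i) ξ = weight m ξ := by
  simp [weight, tExp]

/-- The value at `m` of the element `exp ξ` of the compact torus. -/
def phase (ξ : Fin d → ℝ) (m : MLattice d p) : ℂ := Complex.exp (Complex.I * (weight m ξ : ℝ))

/-- The action of the element `exp ξ` of the compact torus `T^{⊥ν} = ν^⊥ ⊗ U(1)`. -/
def torusAct (ξ : Fin d → ℝ) (x : Smoothing fan c) : Smoothing fan c :=
  ⟨{  cone := x.1.cone
      cone_mem := x.1.cone_mem
      val := fun m => phase ξ m * x.1.val m
      val_outside := fun m hm => by simp [x.1.val_outside m hm]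
      val_zero := by simp [x.1.val_zero, phase, weight_zero]
      val_add := fun m hm m' hm' => by
        simp only [x.1.val_add m hm m' hm', phase, weight_add, Complex.ofReal_add, mul_add,
          Complex.exp_add]
        ring
      val_ne_zero_iff := fun m hm => by
        rw [← x.1.val_ne_zero_iff m hm]
        simp [phase, Complex.exp_ne_zero] },
    fun i m h h' h'' => by
      have := x.2 i m h h' h''
      simp only [phase, weight_add_tExp, this]
      ring⟩

/-- The vector field on the smoothing that is generated by the element `ξ` of the Lie algebra. -/
def generator (ξ : Fin d → ℝ) (x : Smoothing fan c) : tangent x :=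
  ⟨fun m => Complex.I * (weight m ξ : ℝ) * x.val m,
    fun m hm => by simp [Smoothing.val, x.1.val_outside m hm],
    fun m hm m' hm' => by
      have : x.val (m + m') = x.val m * x.val m' := x.1.val_add m hm m' hm'
      simp only [this, weight_add, Complex.ofReal_add]
      ring,
    fun i m h h' h'' => by
      have : x.val (m + tExp d i) = x.val (m + tExp d 0) - c i * x.val m := x.2 i m h h' h''
      simp only [weight_add_tExp, this]
      ring⟩

/-! ### Kähler forms and moment maps -/

/-- The values at `x` of finitely many characters. -/
def coords (A : Finset (MLattice d p)) (x : Smoothing fan c) : A → ℂ := fun m => x.val m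

/-- The components of a tangent vector with respect to finitely many characters. -/
def vcoords (A : Finset (MLattice d p)) {x : Smoothing fan c} (v : tangent x) : A → ℂ :=
  fun m => (v : MLattice d p → ℂ) m

/-- The real `(1,1)`-form `2i ∂∂̄φ` at a point of `ℂ^A`, for a real function `φ`. -/
def ddc {A : Type*} [Fintype A] (φ : (A → ℂ) → ℝ) (q : A → ℂ) (v w : A → ℂ) : ℝ :=
  fderiv ℝ (fderiv ℝ φ) q (Complex.I • v) w - fderiv ℝ (fderiv ℝ φ) q v (Complex.I • w)

/-- A field of real bilinear forms on the tangent spaces. -/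
abbrev BilinField (fan : Set (Set (NLattice d p))) (c : Fin (p + 1) → ℂ) : Type :=
  ∀ x : Smoothing fan c, tangent x →ₗ[ℝ] tangent x →ₗ[ℝ] ℝ

/-- `ω` is a Kähler form: locally it is `2i ∂∂̄` of a smooth function of finitely many of the regular
characters, and it is positive. -/
structure IsKahlerForm (ω : BilinField fan c) : Prop where
  local_potential : ∀ x : Smoothing fan c, ∃ A : Finset (MLattice d p), (∀ m ∈ A, m ∈ x.dom) ∧
    ∃ φ : (A → ℂ) → ℝ, ContDiff ℝ (⊤ : ℕ∞) φ ∧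
      ∀ᶠ y in 𝓝 x, ∀ v w : tangent y, ω y v w = ddc φ (coords A y) (vcoords A v) (vcoords A w)
  pos : ∀ (x : Smoothing fan c) (v : tangent x), v ≠ 0 → 0 < ω x v (Complex.I • v)

/-- `ω` is invariant under the torus. -/
def IsTorusInvariant (ω : BilinField fan c) : Prop :=
  ∀ (ξ : Fin d → ℝ) (x : Smoothing fan c) (v w : tangent x) (v' w' : tangent (torusAct ξ x)),
    (∀ m, (v' : MLattice d p → ℂ) m = phase ξ m * (v : MLattice d p → ℂ) m) →
    (∀ m, (w' : MLattice d p → ℂ) m = phase ξ m * (w : MLattice d p → ℂ) m) →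
      ω (torusAct ξ x) v' w' = ω x v w

/-- `μ` (the map `π_0`) is a moment map of the torus action: it is smooth, invariant, and
`d⟨μ, ξ⟩ = ω(ξ, ·)` for the vector field generated by `ξ`. -/
structure IsMomentMap (ω : BilinField fan c) (μ : Smoothing fan c → Fin d → ℝ) : Prop where
  invariant : ∀ (ξ : Fin d → ℝ) (x : Smoothing fan c), μ (torusAct ξ x) = μ x
  differential : ∀ x : Smoothing fan c, ∃ A : Finset (MLattice d p), (∀ m ∈ A, m ∈ x.dom) ∧
    ∃ F : (A → ℂ) → Fin d → ℝ, ContDiff ℝ (⊤ : ℕ∞) F ∧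
      ∀ᶠ y in 𝓝 x, μ y = F (coords A y) ∧
        ∀ (v : tangent y) (ξ : Fin d → ℝ),
          ∑ j, fderiv ℝ F (coords A y) (vcoords A v) j * ξ j = ω y (generator ξ y) v

/-! ### The Gross fibration -/

/-- The Gross fibration `(π_0, |t - K|² - K²)`, on the finite part. -/
def gross (μ : Smoothing fan c → Fin d → ℝ) (K : ℝ) (x : Smoothing fan c) : Base d :=
  (μ x, ‖x.t - K‖ ^ 2 - K ^ 2)

/-- The fibre `F_r`. -/
def fiber (μ : Smoothing fan c → Fin d → ℝ) (K : ℝ) (r : Base d) : Set (Smoothing fan c) :=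
  {x ∈ finitePart fan c | gross μ K x = r}

/-- The differential of the Gross fibration at a point of the finite part.  Its component along the
`j`-th basis vector of `ν^⊥` is `ω(ξ_j, ·)`, by the definition of a moment map; the last component is
`d|t - K|² = 2 Re (conj (t - K) dt)`. -/
def grossDifferential (ω : BilinField fan c) (K : ℝ) (x : Smoothing fan c) :
    tangent x →ₗ[ℝ] Base d where
  toFun v := (fun j => ω x (generator (Pi.single j 1) x) v,
    2 * ((starRingEnd ℂ) (x.t - K) * (v : MLattice d p → ℂ) (tExp d 0)).re)
  map_add' v w := by
    ext <;> simp [mul_add]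
  map_smul' a v := by
    ext <;> simp
    ring

/-- The base: the image of the fibration. -/
def base (μ : Smoothing fan c → Fin d → ℝ) (K : ℝ) : Set (Base d) := gross μ K '' finitePart fan c

/-- The discriminant locus `Γ`: the critical values of the fibration. -/
def discriminant (ω : BilinField fan c) (μ : Smoothing fan c → Fin d → ℝ) (K : ℝ) : Set (Base d) :=
  {r | ∃ x ∈ fiber μ K r, ¬ Function.Surjective (grossDifferential ω K x)}

/-- `B_0 = B - Γ`. -/
def regularBase (ω : BilinField fan c) (μ : Smoothing fan c → Fin d → ℝ) (K : ℝ) : Set (Base d) :=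
  base μ K \ discriminant ω μ K

/-- The hyperplane `H_i` at height `|c_i - K|² - K²`. -/
def hyperplane (d : ℕ) (c : Fin (p + 1) → ℂ) (K : ℝ) (i : Fin (p + 1)) : Set (Base d) :=
  {r | r.2 = ‖c i - K‖ ^ 2 - K ^ 2}

/-! ### Holomorphic discs, their Maslov index, and the wall -/

/-- The closed unit disc. -/
def disc : Set ℂ := Metric.closedBall 0 1

/-- `u` is a holomorphic disc with boundary in `L`: it is continuous on the closed unit disc,
holomorphic inside, and maps the unit circle to `L`.  Values outside the closed disc are irrelevant. -/
structure IsHolomorphicDisc (u : ℂ → Smoothing fan c) (L : Set (Smoothing fan c)) : Prop where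
  continuousOn : ContinuousOn u disc
  holomorphic : ∀ z ∈ Metric.ball (0 : ℂ) 1, ∀ m ∈ (u z).dom,
    DifferentiableAt ℂ (fun w => (u w).val m) z
  boundary : ∀ z ∈ Metric.sphere (0 : ℂ) 1, u z ∈ L

/-- The disc `u`, with boundary in a regular fibre of the Gross fibration, has Maslov index `k`.
Trivialise the pull-back of the tangent bundle by a continuous complex frame `e` over the closed disc.
At each boundary point let `f` be a real frame of the tangent space of the fibre (the kernel of the
differential of the fibration), and let `D` be the determinant of `f` with respect to `e`.
The phase `D² / |D|²` does not depend on `f`, and its winding number along the boundary is `k`. -/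
def HasMaslovIndex (ω : BilinField fan c) (K : ℝ) (u : ℂ → Smoothing fan c) (k : ℤ) : Prop :=
  ∃ (e : ∀ z : ℂ, Module.Basis (Fin (d + 1)) ℂ (tangent (u z)))
    (f : ∀ θ : ℝ, Module.Basis (Fin (d + 1)) ℝ
      (LinearMap.ker (grossDifferential ω K (u (Complex.exp (Complex.I * θ))))))
    (φ : ℝ → ℝ),
    (∀ z ∈ disc, ∀ m ∈ (u z).dom, ∀ j,
      ContinuousWithinAt (fun w => (e w j : MLattice d p → ℂ) m) disc z) ∧
    Continuous φ ∧
    (∀ θ : ℝ, Complex.exp (Complex.I * φ θ) =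
      (e (Complex.exp (Complex.I * θ))).det
          (fun j => (f θ j : tangent (u (Complex.exp (Complex.I * θ))))) ^ 2 /
        (‖(e (Complex.exp (Complex.I * θ))).det
          (fun j => (f θ j : tangent (u (Complex.exp (Complex.I * θ)))))‖ : ℂ) ^ 2) ∧
    φ (2 * Real.pi) - φ 0 = 2 * Real.pi * k

/-- The wall: the points `r` of `B_0` for which the fibre `F_r` bounds a non-constant holomorphic
disc of Maslov index zero. -/
def wall (ω : BilinField fan c) (μ : Smoothing fan c → Fin d → ℝ) (K : ℝ) : Set (Base d) :=
  {r ∈ regularBase ω μ K | ∃ u : ℂ → Smoothing fan c, IsHolomorphicDisc u (fiber μ K r) ∧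
    (∃ z ∈ disc, ∃ w ∈ disc, u z ≠ u w) ∧ HasMaslovIndex ω K u 0}

end GrossFibration

end

/-! Write z_1, …, z_d for the characters of the torus of ν^⊥ and Ω = dlog z_1 ∧ … ∧ dlog z_d ∧ dt.
Regular fibres have constant phase with respect to Ω / (t - K): their tangent spaces contain the d
torus generators, on which each dlog z_j is imaginary and dt vanishes, and in the one remaining
direction dt / (t - K) is imaginary (`vol_fiber_frame`). So, for a complex frame e along a disc with
boundary in the good part, the Maslov index is twice the number of zeros of (t - K) / Ω(e). Because
the simplices R_i are unimodular and placed at height one, Ω has neither zero nor pole along t = c_i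
(`exists_localForm_of_t_eq`); zeros occur only at t = K and at t = ∞, and they all count positively
(`orders_eq_zero`, an argument principle for functions that are merely continuous up to a local
factor).

The wall lies in the hyperplanes: take a disc of index zero with boundary over a regular value off
all H_i. It avoids t = K and t = ∞, so t - K is zero-free with constant modulus on the circle, hence
constant. Then t never equals a c_l, and the disc stays in the open torus. There the moment map is
strictly monotone in the non-compact directions, so for fixed t it determines all |z_j|
(`norm_val_eq_of_momentMap_eq`). The z_j are again zero-free of constant modulus on the circle,
hence constant, and so is the disc.

The hyperplanes lie in the wall: over a regular value on H_i, the values of t on the compact fibre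
form a closed subset of the circle |t - K| = |c_i - K|. If c_i were missing, the subset would also
be open, because (μ, t) is a submersion on the open torus; connectedness forbids this
(`exists_mem_fiber_t_eq`). At a point x of the fibre with t = c_i, regularity makes the cone a
single ray, given by a vertex of R_i. As k_i ≥ 1 there is a second vertex, and the two span a face.
The one-parameter subgroup of the second vertex moves x along a disc whose boundary is an orbit of a
circle in the compact torus. The weights of this circle on local coordinates add up to zero, so the
index is zero. -/

noncomputable section

open scoped Topology
open Filter

namespace GrossFibration

/-! ### Winding numbers -/

open Metric in
/-- A continuous non-vanishing function on the closed disc has a continuous logarithm. -/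
theorem exists_continuousOn_log {q : ℂ → ℂ} (hq : ContinuousOn q (closedBall 0 1))
    (h0 : ∀ z ∈ closedBall (0 : ℂ) 1, q z ≠ 0) :
    ∃ L : ℂ → ℂ, ContinuousOn L (closedBall 0 1) ∧
      ∀ z ∈ closedBall (0 : ℂ) 1, q z = Complex.exp (L z) := by
  have hcomp : IsCompact (closedBall (0 : ℂ) 1) := isCompact_closedBall 0 1
  obtain ⟨z₁, hz₁, hmin⟩ := hcomp.exists_isMinOn ⟨0, by simp⟩ hq.norm
  have hpos : 0 < ‖q z₁‖ := norm_pos_iff.2 (h0 z₁ hz₁)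
  obtain ⟨δ, hδ, huc⟩ := Metric.uniformContinuousOn_iff.1
    (hcomp.uniformContinuousOn_of_continuous hq) _ hpos
  -- Each radius is cut into `N + 1` steps shorter than `δ`. Consecutive values of `q` then have
  -- ratio within distance 1 of 1, where the principal logarithm is continuous, and the ratios
  -- telescope.
  obtain ⟨N, hN⟩ := exists_nat_one_div_lt hδ
  set s : ℕ → ℂ := fun j => (j : ℂ) / ((N : ℂ) + 1) with hs
  have hN0 : ((N : ℂ) + 1) ≠ 0 := by exact_mod_cast N.succ_ne_zero
  have hsn : ∀ j, ‖s j‖ = (j : ℝ) / ((N : ℝ) + 1) := fun j => by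
    rw [hs, norm_div, Complex.norm_natCast, ← Nat.cast_succ, Complex.norm_natCast, Nat.cast_succ]
  have hmem : ∀ j ≤ N + 1, ∀ z ∈ closedBall (0 : ℂ) 1, s j * z ∈ closedBall (0 : ℂ) 1 := by
    intro j hj z hz
    rw [mem_closedBall_zero_iff] at hz ⊢
    rw [norm_mul, hsn]
    refine mul_le_one₀ ?_ (norm_nonneg _) hz
    rw [div_le_one (by positivity)]
    exact_mod_cast hj
  have hratio : ∀ j < N + 1, ∀ z ∈ closedBall (0 : ℂ) 1,
      q (s (j + 1) * z) / q (s j * z) ∈ Complex.slitPlane := by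
    intro j hj z hz
    have h1 := hmem j hj.le z hz
    have h2 := hmem (j + 1) hj z hz
    have hdist : dist (s (j + 1) * z) (s j * z) < δ := by
      rw [dist_eq_norm, ← sub_mul, norm_mul]
      have : s (j + 1) - s j = 1 / ((N : ℂ) + 1) := by
        rw [hs]; push_cast; ring
      rw [this, norm_div, norm_one, ← Nat.cast_succ, Complex.norm_natCast, Nat.cast_succ]
      rw [mem_closedBall_zero_iff] at hz
      calc 1 / ((N : ℝ) + 1) * ‖z‖ ≤ 1 / ((N : ℝ) + 1) * 1 := by gcongr
        _ < δ := by rwa [mul_one]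
    have h3 := huc _ h2 _ h1 hdist
    apply Complex.ball_one_subset_slitPlane
    have hq0 := h0 _ h1
    rw [mem_ball, dist_eq_norm, div_sub_one hq0, norm_div, div_lt_one (norm_pos_iff.2 hq0),
      ← dist_eq_norm]
    exact h3.trans_le (hmin h1)
  refine ⟨fun z => Complex.log (q 0) +
    ∑ j ∈ Finset.range (N + 1), Complex.log (q (s (j + 1) * z) / q (s j * z)), ?_, ?_⟩
  · refine continuousOn_const.add (continuousOn_finsetSum _ fun j hj => ?_)
    have hj := Finset.mem_range.1 hj
    refine ContinuousOn.clog ?_ (hratio j hj)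
    exact (hq.comp (by fun_prop) (hmem (j + 1) hj)).div (hq.comp (by fun_prop) (hmem j hj.le))
      fun z hz => h0 _ (hmem j hj.le z hz)
  · intro z hz
    rw [Complex.exp_add, Complex.exp_log (h0 0 (by simp)), Complex.exp_sum]
    rw [Finset.prod_congr rfl fun j hj => Complex.exp_log
      (Complex.slitPlane_ne_zero (hratio j (Finset.mem_range.1 hj) z hz))]
    have htel : ∀ n ≤ N + 1, q 0 * ∏ j ∈ Finset.range n, q (s (j + 1) * z) / q (s j * z)
        = q (s n * z) := by
      intro n
      induction n with
      | zero => intro _; simp [hs]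
      | succ n ih =>
        intro hn
        rw [Finset.prod_range_succ, ← mul_assoc, ih (by omega),
          mul_div_cancel₀ _ (h0 _ (hmem n (by omega) z hz))]
    rw [htel (N + 1) le_rfl]
    simp [hs, hN0]

/-- The disc has no isolated points. This allows a function controlled only off finitely many points
to be extended by its limits. -/
theorem closedBall_subset_closure_diff {S : Set ℂ} (hS : S.Finite) :
    Metric.closedBall (0 : ℂ) 1 ⊆ closure (Metric.closedBall (0 : ℂ) 1 \ S) := by
  intro z hz
  have hpre : Preperfect (Metric.closedBall (0 : ℂ) 1) :=
    (convex_closedBall (0 : ℂ) 1).isPreconnected.preperfect_of_nontrivial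
      ⟨0, by simp, 1, by simp, zero_ne_one⟩
  have hacc := hpre z hz
  rw [accPt_iff_frequently] at hacc
  rw [mem_closure_iff_frequently]
  have hev : ∀ᶠ w in 𝓝 z, w ∉ S \ {z} :=
    (hS.subset Set.sdiff_subset).isClosed.isOpen_compl.mem_nhds fun h => h.2 rfl
  refine (hacc.and_eventually hev).mono fun w hw => ⟨hw.1.2, fun hwS => hw.2 ⟨hwS, hw.1.1⟩⟩

/-- The differences of values of `ψ` lie in the discrete group 2πℤ, and the line is connected. -/
theorem eq_of_exp_const {ψ : ℝ → ℝ} (hψ : Continuous ψ) {C : ℂ}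
    (h : ∀ θ, Complex.exp (Complex.I * ψ θ) = C) (a b : ℝ) : ψ a = ψ b := by
  have hmaps : Set.MapsTo (fun θ => ψ θ - ψ b) Set.univ
      (AddSubgroup.zmultiples (2 * Real.pi) : Set ℝ) := by
    intro θ _
    obtain ⟨n, hn⟩ := Complex.exp_eq_exp_iff_exists_int.1 ((h θ).trans (h b).symm)
    refine ⟨n, ?_⟩
    have h1 : Complex.I * ((ψ θ : ℂ) - ψ b - n * (2 * Real.pi)) = 0 := by rw [mul_sub, mul_sub, hn]; ring
    rw [mul_eq_zero, or_iff_right Complex.I_ne_zero] at h1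
    have h2 : ((ψ θ - ψ b - n * (2 * Real.pi) : ℝ) : ℂ) = 0 := by push_cast; exact h1
    have h3 := Complex.ofReal_eq_zero.1 h2
    simp only [zsmul_eq_mul]
    linarith
  have := isPreconnected_univ.constant_of_mapsTo ⟨inferInstanceAs (DiscreteTopology (AddSubgroup.zmultiples (2 * Real.pi)))⟩
    (by fun_prop) hmaps (Set.mem_univ a)
    (Set.mem_univ b)
  simp only [sub_self] at this
  linarith

theorem exp_mul_I_mem_sphere (θ : ℝ) :
    Complex.exp (Complex.I * θ) ∈ Metric.sphere (0 : ℂ) 1 := by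
  rw [mem_sphere_zero_iff_norm, mul_comm, Complex.norm_exp_ofReal_mul_I]

open Metric in
/-- A function on the closed disc that behaves like `(z - z₀) ^ n` near every `z₀`, and whose square
has winding number zero along the boundary, has no zeros. -/
theorem orders_eq_zero {G : ℂ → ℂ} {n : ℂ → ℕ} {q : ℂ → ℂ → ℂ}
    (hq : ∀ z₀ ∈ closedBall (0 : ℂ) 1, ContinuousWithinAt (q z₀) (closedBall 0 1) z₀)
    (hq0 : ∀ z₀ ∈ closedBall (0 : ℂ) 1, q z₀ z₀ ≠ 0)
    (hG : ∀ z₀ ∈ closedBall (0 : ℂ) 1, ∀ᶠ z in 𝓝[closedBall 0 1] z₀, z ≠ z₀ →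
      G z = (z - z₀) ^ n z₀ * q z₀ z ∧ n z = 0 ∧ G z = q z z)
    (hb : ∀ z₀ ∈ sphere (0 : ℂ) 1, n z₀ = 0 ∧ G z₀ = q z₀ z₀)
    {φ : ℝ → ℝ} (hφ : Continuous φ) (C : ℂ)
    (hφG : ∀ θ : ℝ, Complex.exp (Complex.I * φ θ) =
      C * (G (Complex.exp (Complex.I * θ)) ^ 2 / (‖G (Complex.exp (Complex.I * θ))‖ : ℂ) ^ 2))
    (hper : φ (2 * Real.pi) - φ 0 = 0) :
    ∀ z₀ ∈ closedBall (0 : ℂ) 1, n z₀ = 0 := by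
  classical
  set D : Set ℂ := closedBall (0 : ℂ) 1 with hD
  have hDc : IsCompact D := isCompact_closedBall 0 1
  -- Exceptional points are the zeros of positive order, but also points with `n = 0` where `G`
  -- merely has a meaningless value. Both kinds are isolated, so compactness leaves finitely many.
  set S : Set ℂ := {z ∈ D | ¬(n z = 0 ∧ G z = q z z)} with hS
  have hSfin : S.Finite := by
    obtain ⟨t, -, ht⟩ := hDc.elim_nhdsWithin_subcover
      (fun z₀ => {z | z ≠ z₀ → G z = (z - z₀) ^ n z₀ * q z₀ z ∧ n z = 0 ∧ G z = q z z}) hG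
    refine t.finite_toSet.subset fun z hz => ?_
    obtain ⟨w, hw, hzw⟩ := Set.mem_iUnion₂.1 (ht hz.1)
    by_cases h : z = w
    · rwa [h]
    · exact absurd (hzw h).2 hz.2
  have hSsub : ∀ s ∈ S, ‖s‖ < 1 := by
    intro s hs
    refine lt_of_le_of_ne (mem_closedBall_zero_iff.1 hs.1) fun h => ?_
    exact hs.2 (hb s (mem_sphere_zero_iff_norm.2 h))
  set T : Finset ℂ := hSfin.toFinset with hT
  have hTS : ∀ z, z ∈ T ↔ z ∈ S := fun z => hSfin.mem_toFinset
  have hn0 : ∀ z ∈ D, z ∉ T → n z = 0 ∧ G z = q z z := by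
    intro z hz hzT
    by_contra h
    exact hzT ((hTS z).2 ⟨hz, h⟩)
  set P : ℂ → ℂ := fun z => ∏ s ∈ T, (z - s) ^ n s with hP
  set E : ℂ → ℂ → ℂ := fun z₀ z => ∏ s ∈ T.erase z₀, (z - s) ^ n s with hE
  have hPE : ∀ z₀ ∈ D, ∀ z, P z = (z - z₀) ^ n z₀ * E z₀ z := by
    intro z₀ hz₀ z
    by_cases h : z₀ ∈ T
    · exact (Finset.mul_prod_erase T (fun s => (z - s) ^ n s) h).symm
    · rw [(hn0 z₀ hz₀ h).1, pow_zero, one_mul, hE]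
      simp only [Finset.erase_eq_of_notMem h, hP]
  have hE0 : ∀ z₀, E z₀ z₀ ≠ 0 := fun z₀ =>
    Finset.prod_ne_zero_iff.2 fun s hs =>
      pow_ne_zero _ (sub_ne_zero.2 (Finset.ne_of_mem_erase hs).symm)
  have hEc : ∀ z₀, Continuous (E z₀) := fun z₀ => by
    rw [hE]; fun_prop
  have hlim : ∀ z₀ ∈ D, Tendsto (fun z => G z / P z) (𝓝[D \ S] z₀) (𝓝 (q z₀ z₀ / E z₀ z₀)) := by
    intro z₀ hz₀
    have h1 : Tendsto (fun z => q z₀ z / E z₀ z) (𝓝[D \ S] z₀) (𝓝 (q z₀ z₀ / E z₀ z₀)) :=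
      ((hq z₀ hz₀).mono Set.sdiff_subset).tendsto.div
        ((hEc z₀).continuousWithinAt.tendsto) (hE0 z₀)
    refine h1.congr' ?_
    filter_upwards [nhdsWithin_mono _ Set.sdiff_subset (hG z₀ hz₀), self_mem_nhdsWithin] with z hz hzA
    by_cases h : z = z₀
    · subst h
      have h2 := hn0 z hz₀ fun h => hzA.2 ((hTS z).1 h)
      rw [hPE z hz₀, h2.1, h2.2, pow_zero, one_mul]
    · rw [hPE z₀ hz₀, (hz h).1, mul_div_mul_left _ _ (pow_ne_zero _ (sub_ne_zero.2 h))]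
  -- `G / P` is known only off `S`, but it has a non-zero limit everywhere; the extension by limits
  -- is continuous and zero-free, hence an exponential.
  set Q : ℂ → ℂ := extendFrom (D \ S) fun z => G z / P z with hQ
  have hcl := closedBall_subset_closure_diff hSfin
  have hQc : ContinuousOn Q D := continuousOn_extendFrom hcl fun z hz => ⟨_, hlim z hz⟩
  have hQv : ∀ z ∈ D, Q z = q z z / E z z := fun z hz => extendFrom_eq (hcl hz) (hlim z hz)
  obtain ⟨L, hLc, hL⟩ := exists_continuousOn_log hQc fun z hz => by
    rw [hQv z hz]; exact div_ne_zero (hq0 z hz) (hE0 z)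
  have hGP : ∀ z ∈ sphere (0 : ℂ) 1, G z = P z * Complex.exp (L z) := by
    intro z hz
    have hzD : z ∈ D := sphere_subset_closedBall hz
    rw [← hL z hzD, hQv z hzD, hPE z hzD, (hb z hz).1, (hb z hz).2, pow_zero, one_mul,
      mul_div_cancel₀ _ (hE0 z)]
  set ex : ℝ → ℂ := fun θ => Complex.exp (Complex.I * θ) with hex
  have hexc : Continuous ex := by rw [hex]; fun_prop
  have hexn : ∀ θ, ‖ex θ‖ = 1 := fun θ => mem_sphere_zero_iff_norm.1 (exp_mul_I_mem_sphere θ)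
  -- On the circle z - s = z (1 - s / z) with |s| < 1. The first factor makes one turn, the second
  -- has a continuous logarithm, periodic in θ.
  have hslit : ∀ s ∈ T, ∀ θ, 1 - s / ex θ ∈ Complex.slitPlane := by
    intro s hs θ
    apply Complex.ball_one_subset_slitPlane
    rw [mem_ball, dist_eq_norm, sub_sub_cancel_left, norm_neg, norm_div, hexn, div_one]
    exact hSsub s ((hTS s).1 hs)
  set pf : ℝ → ℂ := fun θ => L (ex θ) + ∑ s ∈ T, n s * Complex.log (1 - s / ex θ) with hpf
  have hpfc : Continuous pf := by
    refine Continuous.add ?_ (continuous_finsetSum _ fun s hs => ?_)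
    · exact hLc.comp_continuous hexc fun θ => sphere_subset_closedBall (exp_mul_I_mem_sphere θ)
    · refine continuous_const.mul (Continuous.clog ?_ (hslit s hs))
      exact continuous_const.sub (continuous_const.div hexc fun θ => Complex.exp_ne_zero _)
  set N : ℕ := ∑ s ∈ T, n s with hN
  have hGexp : ∀ θ : ℝ, G (ex θ) = Complex.exp (Complex.I * (N * θ) + pf θ) := by
    intro θ
    rw [hGP _ (exp_mul_I_mem_sphere θ), hpf, Complex.exp_add, Complex.exp_add, Complex.exp_sum,
      mul_comm (Complex.exp (L _)), ← mul_assoc]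
    congr 1
    have : Complex.I * (N * θ) = ∑ s ∈ T, n s * (Complex.I * θ) := by
      rw [← Finset.sum_mul, hN]; push_cast; ring
    rw [this, Complex.exp_sum, ← Finset.prod_mul_distrib, hP]
    refine Finset.prod_congr rfl fun s hs => ?_
    rw [Complex.exp_nat_mul, Complex.exp_nat_mul,
      Complex.exp_log (Complex.slitPlane_ne_zero (hslit s hs θ)), ← mul_pow]
    congr 1
    change ex θ - s = ex θ * (1 - s / ex θ)
    rw [mul_sub, mul_one, mul_div_cancel₀ _ (Complex.exp_ne_zero _)]
  have hconst : ∀ θ : ℝ, Complex.exp (Complex.I * (φ θ - 2 * (N * θ) - 2 * (pf θ).im : ℝ)) = C := by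
    intro θ
    have h1 := hφG θ
    change _ = C * (G (ex θ) ^ 2 / (‖G (ex θ)‖ : ℂ) ^ 2) at h1
    rw [hGexp, Complex.norm_exp, ← Complex.exp_nat_mul, Complex.ofReal_exp, ← Complex.exp_nat_mul,
      ← Complex.exp_sub] at h1
    have h2 : (((Complex.I * (N * θ) + pf θ).re : ℝ) : ℂ) = ((pf θ).re : ℂ) := by simp
    rw [h2] at h1
    have h3 : Complex.I * (φ θ - 2 * (N * θ) - 2 * (pf θ).im : ℝ) = Complex.I * φ θ -
        (((2 : ℕ) : ℂ) * (Complex.I * (N * θ) + pf θ) - ((2 : ℕ) : ℂ) * (pf θ).re) := by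
      conv_rhs => rw [← Complex.re_add_im (pf θ)]
      push_cast
      simp only [Complex.add_re, Complex.ofReal_re, Complex.mul_re, Complex.ofReal_im,
        Complex.I_re, Complex.I_im, mul_zero, mul_one, sub_self, add_zero]
      ring
    rw [h3, Complex.exp_sub, h1, mul_div_cancel_right₀ _ (Complex.exp_ne_zero _)]
  -- Up to a constant, `φ` is 2Nθ plus a 2π-periodic function, so its increment over a turn is 4πN.
  have hψ := eq_of_exp_const (ψ := fun θ => φ θ - 2 * (N * θ) - 2 * (pf θ).im) (by fun_prop) hconst
    (2 * Real.pi) 0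
  have hpp : pf (2 * Real.pi) = pf 0 := by
    have : ex (2 * Real.pi) = ex 0 := by
      rw [hex]
      simp [mul_comm Complex.I, Complex.exp_two_pi_mul_I]
    rw [hpf]
    simp only [this]
  have hN0 : N = 0 := by
    rw [hpp] at hψ
    have h1 : (N : ℝ) * Real.pi = 0 := by linarith
    exact_mod_cast (mul_eq_zero.1 h1).resolve_right Real.pi_ne_zero
  intro z₀ hz₀
  by_cases h : z₀ ∈ T
  · exact Finset.sum_eq_zero_iff.1 hN0 z₀ h
  · exact (hn0 z₀ hz₀ h).1

variable {d p : ℕ} {fan : Set (Set (NLattice d p))} {c : Fin (p + 1) → ℂ}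
  {k : Fin (p + 1) → ℕ} {u : ∀ i, Fin (k i) → Fin d → ℤ}

/-! ### The pairing -/

theorem pairing_tExp (i : Fin (p + 1)) (g : NLattice d p) : pairing (tExp d i) g = g.2 i := by
  simp [pairing, tExp, Pi.single_apply]

theorem pairing_neg (m : MLattice d p) (g : NLattice d p) : pairing (-m) g = -pairing m g := by
  simp [pairing]; ring

theorem pairing_sub (m m' : MLattice d p) (g : NLattice d p) :
    pairing (m - m') g = pairing m g - pairing m' g := by
  rw [sub_eq_add_neg, pairing_add, pairing_neg, sub_eq_add_neg]

theorem pairing_smul (a : ℤ) (m : MLattice d p) (g : NLattice d p) :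
    pairing (a • m) g = a * pairing m g := by
  simp [pairing, Finset.mul_sum, mul_add, mul_assoc]

theorem pairing_sum {ι : Type*} (s : Finset ι) (m : ι → MLattice d p) (g : NLattice d p) :
    pairing (∑ a ∈ s, m a) g = ∑ a ∈ s, pairing (m a) g := by
  classical
  induction s using Finset.induction_on with
  | empty => simp [pairing_zero]
  | insert a s ha ih => rw [Finset.sum_insert ha, Finset.sum_insert ha, pairing_add, ih]

theorem pairing_infinityRay (m : MLattice d p) : pairing m (infinityRay d p) = -∑ i, m.2 i := by
  simp [pairing, infinityRay]

theorem zero_mem_dualMonoid (G : Set (NLattice d p)) : (0 : MLattice d p) ∈ dualMonoid G :=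
  fun g _ => by rw [pairing_zero]

theorem add_mem_dualMonoid {G : Set (NLattice d p)} {m m' : MLattice d p}
    (h : m ∈ dualMonoid G) (h' : m' ∈ dualMonoid G) : m + m' ∈ dualMonoid G :=
  fun g hg => by rw [pairing_add]; exact add_nonneg (h g hg) (h' g hg)

/-! ### Values of characters -/

namespace Smoothing

theorem zero_mem_dom (x : Smoothing fan c) : 0 ∈ x.dom := zero_mem_dualMonoid _

theorem add_mem_dom {x : Smoothing fan c} {m m' : MLattice d p} (h : m ∈ x.dom) (h' : m' ∈ x.dom) :
    m + m' ∈ x.dom := add_mem_dualMonoid h h'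

theorem val_zero (x : Smoothing fan c) : x.val 0 = 1 := x.1.val_zero

theorem val_add (x : Smoothing fan c) {m m' : MLattice d p} (h : m ∈ x.dom) (h' : m' ∈ x.dom) :
    x.val (m + m') = x.val m * x.val m' := x.1.val_add m h m' h'

theorem val_ne_zero_iff (x : Smoothing fan c) {m : MLattice d p} (h : m ∈ x.dom) :
    x.val m ≠ 0 ↔ ∀ g ∈ x.1.cone, pairing m g = 0 := x.1.val_ne_zero_iff m h

theorem val_outside (x : Smoothing fan c) {m : MLattice d p} (h : m ∉ x.dom) : x.val m = 0 :=
  x.1.val_outside m h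

/-- Values off the domain are 0 by convention, so a non-zero value certifies regularity. -/
theorem mem_dom_of_val_ne_zero {x : Smoothing fan c} {m : MLattice d p} (h : x.val m ≠ 0) :
    m ∈ x.dom := by
  by_contra h'
  exact h (x.val_outside h')

/-- The characters that are invertible at the point. -/
theorem val_ne_zero_of_pairing {x : Smoothing fan c} {m : MLattice d p}
    (h : ∀ g ∈ x.1.cone, pairing m g = 0) : x.val m ≠ 0 :=
  (x.val_ne_zero_iff fun g hg => (h g hg).ge).2 h

theorem pairing_eq_zero {x : Smoothing fan c} {m : MLattice d p} (h : x.val m ≠ 0) :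
    ∀ g ∈ x.1.cone, pairing m g = 0 := (x.val_ne_zero_iff (mem_dom_of_val_ne_zero h)).1 h

theorem neg_mem_dom {x : Smoothing fan c} {m : MLattice d p} (h : x.val m ≠ 0) : -m ∈ x.dom :=
  fun g hg => by rw [pairing_neg, pairing_eq_zero h g hg, neg_zero]

theorem val_neg (x : Smoothing fan c) {m : MLattice d p} (h : x.val m ≠ 0) :
    x.val (-m) = (x.val m)⁻¹ := by
  have := x.val_add (mem_dom_of_val_ne_zero h) (neg_mem_dom h)
  rw [add_neg_cancel, val_zero] at this
  exact eq_inv_of_mul_eq_one_right this.symm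

theorem val_neg_ne_zero {x : Smoothing fan c} {m : MLattice d p} (h : x.val m ≠ 0) :
    x.val (-m) ≠ 0 := by rw [x.val_neg h]; exact inv_ne_zero h

theorem relation (x : Smoothing fan c) {i : Fin (p + 1)} {m : MLattice d p} (h : m ∈ x.dom)
    (h' : m + tExp d i ∈ x.dom) (h'' : m + tExp d 0 ∈ x.dom) :
    x.val (m + tExp d i) = x.val (m + tExp d 0) - c i * x.val m := x.2 i m h h' h''

theorem ext_iff' {x y : Smoothing fan c} : x = y ↔ x.1.cone = y.1.cone ∧ x.val = y.val :=
  Subtype.ext_iff.trans ToricPoint.ext_iff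

/-- Only characters regular at the limit impose a condition, because the subbasic open sets
containing `x` come from these alone. -/
theorem tendsto_nhds_iff {α : Type*} {l : Filter α} {f : α → Smoothing fan c}
    {x : Smoothing fan c} : Tendsto f l (𝓝 x) ↔ ∀ m ∈ x.dom,
      (∀ᶠ a in l, m ∈ (f a).dom) ∧ Tendsto (fun a => (f a).val m) l (𝓝 (x.val m)) := by
  refine (tendsto_subtype_rng.trans TopologicalSpace.tendsto_nhds_generateFrom_iff).trans ?_
  constructor
  · intro h m hm
    refine ⟨?_, ?_⟩
    · filter_upwards [h {y | m ∈ y.dom ∧ y.val m ∈ Set.univ} ⟨m, Set.univ, isOpen_univ, rfl⟩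
        ⟨hm, trivial⟩] with a ha using ha.1
    · rw [tendsto_nhds]
      intro V hV hxV
      filter_upwards [h {y | m ∈ y.dom ∧ y.val m ∈ V} ⟨m, V, hV, rfl⟩ ⟨hm, hxV⟩] with a ha using ha.2
  · rintro h _ ⟨m, V, hV, rfl⟩ ⟨hm, hxV⟩
    obtain ⟨h₁, h₂⟩ := h m hm
    filter_upwards [h₁, h₂ (hV.mem_nhds hxV)] with a ha ha' using ⟨ha, ha'⟩

theorem continuousAt_val {x : Smoothing fan c} {m : MLattice d p} (h : m ∈ x.dom) :
    ContinuousAt (fun y : Smoothing fan c => y.val m) x :=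
  (tendsto_nhds_iff.1 (tendsto_id (x := 𝓝 x)) m h).2

end Smoothing

/-! ### The strata of the smoothing -/

theorem coneGenerators_nonneg {g : NLattice d p} (hg : g ∈ coneGenerators u) (l : Fin (p + 1)) :
    0 ≤ g.2 l := by
  obtain ⟨i, v, -, rfl⟩ := hg
  by_cases h : l = i
  · subst h; simp
  · simp [h]

/-- The ray at infinity pairs to -1 with the exponent of `t`, so it cannot occur where `t` is
regular. -/
theorem cone_mem_affineFan (hfan : fan ⊆ compactifiedFan u) {x : Smoothing fan c}
    (hx : x ∈ finitePart fan c) : x.1.cone ∈ affineFan u := by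
  rcases hfan x.1.cone_mem with h | h
  · have := hx (infinityRay d p) (by rw [h]; rfl)
    rw [pairing_tExp] at this
    simp [infinityRay] at this
  · exact h

theorem cone_subset (hfan : fan ⊆ compactifiedFan u) {x : Smoothing fan c}
    (hx : x ∈ finitePart fan c) : x.1.cone ⊆ coneGenerators u := by
  obtain ⟨m, -, h⟩ := cone_mem_affineFan hfan hx
  rw [h]
  exact fun g hg => hg.1

theorem tExp_mem_dom (hfan : fan ⊆ compactifiedFan u) {x : Smoothing fan c}
    (hx : x ∈ finitePart fan c) (l : Fin (p + 1)) : tExp d l ∈ x.dom := fun g hg => by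
  rw [pairing_tExp]
  exact coneGenerators_nonneg (cone_subset hfan hx hg) l

theorem cone_eq_infinity (hfan : fan ⊆ compactifiedFan u) {x : Smoothing fan c}
    (hx : x ∉ finitePart fan c) : x.1.cone = {infinityRay d p} := by
  rcases hfan x.1.cone_mem with h | ⟨m, -, h⟩
  · exact h
  · refine absurd (fun g hg => ?_) hx
    rw [pairing_tExp]
    have : g ∈ x.1.cone := hg
    rw [h] at this
    exact coneGenerators_nonneg this.1 0

theorem val_tExp (hfan : fan ⊆ compactifiedFan u) {x : Smoothing fan c}
    (hx : x ∈ finitePart fan c) (l : Fin (p + 1)) : x.val (tExp d l) = x.t - c l := by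
  have := x.relation (i := l) x.zero_mem_dom (by rw [zero_add]; exact tExp_mem_dom hfan hx l)
    (by rw [zero_add]; exact hx)
  simpa [x.val_zero, Smoothing.t] using this

/-- The open torus orbit. -/
def openTorus (fan : Set (Set (NLattice d p))) (c : Fin (p + 1) → ℂ) : Set (Smoothing fan c) :=
  {x | x.1.cone = ∅}

theorem mem_dom_of_openTorus {x : Smoothing fan c} (hx : x ∈ openTorus fan c) (m : MLattice d p) :
    m ∈ x.dom := fun g hg => by
  rw [show x.1.cone = ∅ from hx] at hg
  exact absurd hg (Set.notMem_empty g)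

theorem val_ne_zero_of_openTorus {x : Smoothing fan c} (hx : x ∈ openTorus fan c)
    (m : MLattice d p) : x.val m ≠ 0 :=
  Smoothing.val_ne_zero_of_pairing fun g hg => by
    rw [show x.1.cone = ∅ from hx] at hg
    exact absurd hg (Set.notMem_empty g)

theorem openTorus_subset_finitePart : openTorus fan c ⊆ finitePart fan c :=
  fun _ hx => mem_dom_of_openTorus hx _

/-- A generator over `e_i` in the cone forces `t_i = t - c i` to vanish, because it pairs to 1 with
the exponent of `t_i`. -/
theorem mem_openTorus (hfan : fan ⊆ compactifiedFan u) {x : Smoothing fan c}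
    (hx : x ∈ finitePart fan c) (h : ∀ l, x.t ≠ c l) : x ∈ openTorus fan c := by
  by_contra h'
  obtain ⟨g, hg⟩ := Set.nonempty_iff_ne_empty.2 h'
  obtain ⟨i, v, -, rfl⟩ := cone_subset hfan hx hg
  have h0 : x.val (tExp d i) ≠ 0 := by rw [val_tExp hfan hx, sub_ne_zero]; exact h i
  have := Smoothing.pairing_eq_zero h0 _ hg
  rw [pairing_tExp] at this
  simp at this

theorem t_ne_of_openTorus (hfan : fan ⊆ compactifiedFan u) {x : Smoothing fan c}
    (hx : x ∈ openTorus fan c) (l : Fin (p + 1)) : x.t ≠ c l := by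
  have := val_ne_zero_of_openTorus hx (tExp d l)
  rwa [val_tExp hfan (openTorus_subset_finitePart hx), sub_ne_zero] at this

/-- Over `t = c_i` the cone is a face of the cone over `R_i × {e_i}`. -/
theorem eq_of_mem_cone (hfan : fan ⊆ compactifiedFan u) (hc : Function.Injective c)
    {x : Smoothing fan c} (hx : x ∈ finitePart fan c) {i : Fin (p + 1)} (h : x.t = c i)
    {g : NLattice d p} (hg : g ∈ x.1.cone) :
    ∃ v ∈ insert 0 (Set.range (u i)), g = (v, Pi.single i 1) := by
  obtain ⟨l, v, hv, rfl⟩ := cone_subset hfan hx hg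
  have : x.val (tExp d l) = 0 := by
    by_contra h0
    have := Smoothing.pairing_eq_zero h0 _ hg
    rw [pairing_tExp] at this
    simp at this
  rw [val_tExp hfan hx, sub_eq_zero, h] at this
  obtain rfl := hc this
  exact ⟨v, hv, rfl⟩

theorem cone_nonempty (hfan : fan ⊆ compactifiedFan u)
    {x : Smoothing fan c} {i : Fin (p + 1)} (h : x.t = c i) :
    x.1.cone.Nonempty := by
  by_contra h'
  exact t_ne_of_openTorus hfan (Set.not_nonempty_iff_eq_empty.1 h') i h

variable {ω : BilinField fan c} {μ : Smoothing fan c → Fin d → ℝ} {K : ℝ}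

/-! ### Points of the open torus -/

/-- The exponent of the `j`-th coordinate of the torus of `ν^⊥`. -/
def zExp (p : ℕ) (j : Fin d) : MLattice d p := (Pi.single j 1, 0)

theorem eq_sum_exp (m : MLattice d p) :
    m = ∑ j, m.1 j • zExp p j + ∑ l, m.2 l • tExp d l := by
  ext a <;> simp [zExp, tExp, Prod.fst_sum, Prod.snd_sum, Pi.single_apply]

namespace Smoothing

theorem sum_mem_dom {ι : Type*} {s : Finset ι} {x : Smoothing fan c} {m : ι → MLattice d p}
    (h : ∀ a ∈ s, m a ∈ x.dom) : ∑ a ∈ s, m a ∈ x.dom := fun g hg => by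
  rw [pairing_sum]
  exact Finset.sum_nonneg fun a ha => h a ha g hg

theorem val_sum {ι : Type*} (s : Finset ι) (x : Smoothing fan c) {m : ι → MLattice d p}
    (h : ∀ a ∈ s, m a ∈ x.dom) : x.val (∑ a ∈ s, m a) = ∏ a ∈ s, x.val (m a) := by
  classical
  induction s using Finset.induction_on with
  | empty => simp [val_zero]
  | insert a s ha ih =>
    rw [Finset.sum_insert ha, Finset.prod_insert ha,
      val_add x (h a (Finset.mem_insert_self a s))
        (sum_mem_dom fun b hb => h b (Finset.mem_insert_of_mem hb)),
      ih fun b hb => h b (Finset.mem_insert_of_mem hb)]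

theorem val_nsmul (x : Smoothing fan c) {m : MLattice d p} (h : m ∈ x.dom) (n : ℕ) :
    x.val (n • m) = x.val m ^ n := by
  have := x.val_sum (Finset.range n) (m := fun _ => m) fun _ _ => h
  simpa using this

theorem val_zsmul (x : Smoothing fan c) {m : MLattice d p} (h : x.val m ≠ 0) (n : ℤ) :
    x.val (n • m) = x.val m ^ n := by
  obtain ⟨n, rfl | rfl⟩ := n.eq_nat_or_neg
  · rw [natCast_zsmul, zpow_natCast, x.val_nsmul (mem_dom_of_val_ne_zero h)]
  · rw [neg_smul, natCast_zsmul, ← smul_neg, zpow_neg, zpow_natCast,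
      x.val_nsmul (neg_mem_dom h), x.val_neg h, inv_pow]

end Smoothing

theorem val_eq_prod {x : Smoothing fan c} (hx : x ∈ openTorus fan c) (m : MLattice d p) :
    x.val m = (∏ j, x.val (zExp p j) ^ m.1 j) * ∏ l, x.val (tExp d l) ^ m.2 l := by
  conv_lhs => rw [eq_sum_exp m]
  rw [x.val_add (mem_dom_of_openTorus hx _) (mem_dom_of_openTorus hx _),
    x.val_sum _ fun _ _ => mem_dom_of_openTorus hx _,
    x.val_sum _ fun _ _ => mem_dom_of_openTorus hx _]
  congr 1 <;> exact Finset.prod_congr rfl fun a _ => x.val_zsmul (val_ne_zero_of_openTorus hx _) _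

/-- Every character is a Laurent monomial in the z_j and the t_l, and t_l = t - c_l. -/
theorem openTorus_ext (hfan : fan ⊆ compactifiedFan u) {x y : Smoothing fan c}
    (hx : x ∈ openTorus fan c) (hy : y ∈ openTorus fan c) (ht : x.t = y.t)
    (h : ∀ j, x.val (zExp p j) = y.val (zExp p j)) : x = y := by
  refine Smoothing.ext_iff'.2 ⟨?_, funext fun m => ?_⟩
  · rw [show x.1.cone = ∅ from hx, show y.1.cone = ∅ from hy]
  · rw [val_eq_prod hx, val_eq_prod hy]
    simp only [h, val_tExp hfan (openTorus_subset_finitePart hx),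
      val_tExp hfan (openTorus_subset_finitePart hy), ht]

/-! ### The action of the complex torus -/

/-- The weight of the character `χ^m` on the complexified Lie algebra. -/
def cweight (m : MLattice d p) (ζ : Fin d → ℂ) : ℂ := ∑ j, (m.1 j : ℂ) * ζ j

theorem cweight_zero (ζ : Fin d → ℂ) : cweight (0 : MLattice d p) ζ = 0 := by simp [cweight]

theorem cweight_add (m m' : MLattice d p) (ζ : Fin d → ℂ) :
    cweight (m + m') ζ = cweight m ζ + cweight m' ζ := by
  simp [cweight, add_mul, Finset.sum_add_distrib]

theorem cweight_tExp (i : Fin (p + 1)) (ζ : Fin d → ℂ) : cweight (tExp d i) ζ = 0 := by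
  simp [cweight, tExp]

theorem cweight_zExp (j : Fin d) (ζ : Fin d → ℂ) : cweight (zExp p j) ζ = ζ j := by
  simp [cweight, zExp, Pi.single_apply]

theorem cweight_smul (m : MLattice d p) (s : ℂ) (ζ : Fin d → ℂ) :
    cweight m (s • ζ) = s * cweight m ζ := by
  simp [cweight, Finset.mul_sum, mul_left_comm]

theorem cweight_ofReal (m : MLattice d p) (ξ : Fin d → ℝ) :
    cweight m (fun j => (ξ j : ℂ)) = (weight m ξ : ℝ) := by
  simp [cweight, weight]

/-- The action of the element `exp ζ` of the complex torus. -/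
def complexAct (ζ : Fin d → ℂ) (x : Smoothing fan c) : Smoothing fan c :=
  ⟨{  cone := x.1.cone
      cone_mem := x.1.cone_mem
      val := fun m => Complex.exp (cweight m ζ) * x.1.val m
      val_outside := fun m hm => by simp [x.1.val_outside m hm]
      val_zero := by simp [x.1.val_zero, cweight_zero]
      val_add := fun m hm m' hm' => by
        simp only [x.1.val_add m hm m' hm', cweight_add, Complex.exp_add]
        ring
      val_ne_zero_iff := fun m hm => by
        rw [← x.1.val_ne_zero_iff m hm]
        simp [Complex.exp_ne_zero] },
    fun i m h h' h'' => by
      have := x.2 i m h h' h''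
      simp only [cweight_add, cweight_tExp, add_zero, this]
      ring⟩

theorem complexAct_val (ζ : Fin d → ℂ) (x : Smoothing fan c) (m : MLattice d p) :
    (complexAct ζ x).val m = Complex.exp (cweight m ζ) * x.val m := rfl

theorem torusAct_val (ξ : Fin d → ℝ) (x : Smoothing fan c) (m : MLattice d p) :
    (torusAct ξ x).val m = phase ξ m * x.val m := rfl

theorem torusAct_dom (ξ : Fin d → ℝ) (x : Smoothing fan c) : (torusAct ξ x).dom = x.dom := rfl

theorem torusAct_t (ξ : Fin d → ℝ) (x : Smoothing fan c) : (torusAct ξ x).t = x.t := by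
  rw [Smoothing.t, torusAct_val, Smoothing.t, phase]
  simp [weight, tExp]

theorem complexAct_t (ζ : Fin d → ℂ) (x : Smoothing fan c) : (complexAct ζ x).t = x.t := by
  rw [Smoothing.t, complexAct_val, Smoothing.t, cweight_tExp, Complex.exp_zero, one_mul]

theorem torusAct_eq (ξ : Fin d → ℝ) (x : Smoothing fan c) :
    torusAct ξ x = complexAct (Complex.I • fun j => (ξ j : ℂ)) x := by
  refine Smoothing.ext_iff'.2 ⟨rfl, funext fun m => ?_⟩
  rw [torusAct_val, complexAct_val, cweight_smul, cweight_ofReal, phase]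

theorem tendsto_complexAct {α : Type*} {l : Filter α} {f : α → Fin d → ℂ} {ζ : Fin d → ℂ}
    (hf : Tendsto f l (𝓝 ζ)) (x : Smoothing fan c) :
    Tendsto (fun a => complexAct (f a) x) l (𝓝 (complexAct ζ x)) := by
  refine Smoothing.tendsto_nhds_iff.2 fun m hm => ⟨Eventually.of_forall fun _ => hm, ?_⟩
  simp only [complexAct_val]
  have : Continuous fun ζ : Fin d → ℂ => Complex.exp (cweight m ζ) * x.val m := by
    unfold cweight; fun_prop
  exact (this.tendsto ζ).comp hf

/-! ### Differentiating the moment map -/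

/-- The moment map is locally a smooth function of finitely many characters, so the chain rule needs
differentiability of the characters along `ψ` only. -/
theorem momentMap_comp {E : Type*} [NormedAddCommGroup E] [NormedSpace ℝ E]
    (hμ : IsMomentMap ω μ) {ψ : E → Smoothing fan c} {q : E} (hψ : ContinuousAt ψ q)
    (hd : ∀ m ∈ (ψ q).dom, ContDiffAt ℝ 1 (fun e => (ψ e).val m) q) :
    ContDiffAt ℝ 1 (μ ∘ ψ) q ∧ ∀ (a : E) (v : tangent (ψ q)),
      (∀ m ∈ (ψ q).dom, (v : MLattice d p → ℂ) m = fderiv ℝ (fun e => (ψ e).val m) q a) →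
        ∀ ξ : Fin d → ℝ, ∑ j, fderiv ℝ (μ ∘ ψ) q a j * ξ j = ω (ψ q) (generator ξ (ψ q)) v := by
  obtain ⟨A, hA, F, hF, hev⟩ := hμ.differential (ψ q)
  have hco : ContDiffAt ℝ 1 (fun e => coords A (ψ e)) q :=
    contDiffAt_pi.2 fun m => hd m (hA m m.2)
  have hF1 : ContDiff ℝ 1 F := hF.of_le (by exact_mod_cast le_top)
  have heq : μ ∘ ψ =ᶠ[𝓝 q] fun e => F (coords A (ψ e)) :=
    (hψ.eventually hev).mono fun e he => he.1
  refine ⟨(hF1.contDiffAt.comp q hco).congr_of_eventuallyEq heq, fun a v hv ξ => ?_⟩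
  have hcd := hco.differentiableAt one_ne_zero
  have h2 : fderiv ℝ (fun e => coords A (ψ e)) q a = vcoords A v := by
    funext m
    have := fderiv_apply (x := q) hcd m
    rw [vcoords, hv m (hA m m.2)]
    exact (DFunLike.congr_fun this a).symm
  rw [heq.fderiv_eq, fderiv_fun_comp q (hF1.differentiable one_ne_zero _) hcd]
  rw [← hev.self_of_nhds.2 v ξ, ContinuousLinearMap.comp_apply, h2]

theorem hasDerivAt_momentMap (hμ : IsMomentMap ω μ) {γ : ℝ → Smoothing fan c} {s : ℝ}
    (hγ : ContinuousAt γ s) (hd : ∀ m ∈ (γ s).dom, ContDiffAt ℝ 1 (fun e => (γ e).val m) s)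
    (v : tangent (γ s))
    (hv : ∀ m ∈ (γ s).dom, HasDerivAt (fun e => (γ e).val m) ((v : MLattice d p → ℂ) m) s)
    (ξ : Fin d → ℝ) :
    HasDerivAt (fun e => ∑ j, μ (γ e) j * ξ j) (ω (γ s) (generator ξ (γ s)) v) s := by
  obtain ⟨h1, h2⟩ := momentMap_comp hμ hγ hd
  rw [← h2 1 v (fun m hm => by rw [fderiv_eq_smul_deriv, one_smul, (hv m hm).deriv]) ξ]
  have h3 := (h1.differentiableAt one_ne_zero).hasFDerivAt.hasDerivAt
  exact HasDerivAt.fun_sum fun j _ => (hasDerivAt_pi.1 h3 j).mul_const (ξ j)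

theorem generator_val (ξ : Fin d → ℝ) (x : Smoothing fan c) (m : MLattice d p) :
    (generator ξ x : MLattice d p → ℂ) m = Complex.I * (weight m ξ : ℝ) * x.val m := rfl

theorem hasDerivAt_complexAct (ζ : Fin d → ℂ) (x : Smoothing fan c) (m : MLattice d p) (s : ℝ) :
    HasDerivAt (fun e : ℝ => (complexAct ((e : ℂ) • ζ) x).val m)
      (cweight m ζ * (complexAct ((s : ℂ) • ζ) x).val m) s := by
  simp only [complexAct_val, cweight_smul]
  have h : HasDerivAt (fun e : ℝ => (e : ℂ) * cweight m ζ) (1 * cweight m ζ) s :=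
    Complex.ofRealCLM.hasDerivAt.mul_const _
  exact ((h.cexp).mul_const (x.val m)).congr_deriv (by ring)

theorem contDiff_complexAct (ζ : Fin d → ℂ) (x : Smoothing fan c) (m : MLattice d p) :
    ContDiff ℝ 1 (fun e : ℝ => (complexAct ((e : ℂ) • ζ) x).val m) := by
  simp only [complexAct_val, cweight_smul]
  have : ContDiff ℝ 1 (fun e : ℝ => (e : ℂ)) := Complex.ofRealCLM.contDiff
  fun_prop

theorem continuousAt_complexAct (ζ : Fin d → ℂ) (x : Smoothing fan c) (s : ℝ) :
    ContinuousAt (fun e : ℝ => complexAct ((e : ℂ) • ζ) x) s :=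
  tendsto_complexAct (f := fun e : ℝ => (e : ℂ) • ζ) (Continuous.tendsto (by fun_prop) s) x

theorem hasDerivAt_momentMap_complexAct (hμ : IsMomentMap ω μ) (ζ : Fin d → ℂ)
    (x : Smoothing fan c) (s : ℝ) (v : tangent (complexAct ((s : ℂ) • ζ) x))
    (hv : ∀ m, (v : MLattice d p → ℂ) m = cweight m ζ * (complexAct ((s : ℂ) • ζ) x).val m)
    (ξ : Fin d → ℝ) :
    HasDerivAt (fun e : ℝ => ∑ j, μ (complexAct ((e : ℂ) • ζ) x) j * ξ j)
      (ω (complexAct ((s : ℂ) • ζ) x) (generator ξ _) v) s :=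
  hasDerivAt_momentMap hμ (γ := fun e : ℝ => complexAct ((e : ℂ) • ζ) x)
    (continuousAt_complexAct ζ x s) (fun m _ => (contDiff_complexAct ζ x m).contDiffAt) v
    (fun m _ => by rw [hv m]; exact hasDerivAt_complexAct ζ x m s) ξ

/-- The orbits of the compact torus are isotropic. -/
theorem generator_isotropic (hμ : IsMomentMap ω μ) (ξ η : Fin d → ℝ) (x : Smoothing fan c) :
    ω x (generator ξ x) (generator η x) = 0 := by
  have h0 : complexAct (((0 : ℝ) : ℂ) • (Complex.I • fun j => (η j : ℂ))) x = x := by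
    refine Smoothing.ext_iff'.2 ⟨rfl, funext fun m => ?_⟩
    rw [complexAct_val, cweight_smul]; simp
  -- The derivative of ⟨μ, ξ⟩ along the orbit of `η` is ω(ξ, η), while invariance makes `μ` constant
  -- there.
  have h := hasDerivAt_momentMap_complexAct hμ (Complex.I • fun j => (η j : ℂ)) x 0
    (generator η _) (fun m => by rw [generator_val, cweight_smul, cweight_ofReal]) ξ
  rw [h0] at h
  refine h.unique ?_
  have : ∀ e : ℝ, μ (complexAct ((e : ℂ) • (Complex.I • fun j => (η j : ℂ))) x) = μ x := fun e => by
    rw [← hμ.invariant (e • η) x, torusAct_eq, smul_comm]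
    congr 2
    ext j; simp
  simp only [this]
  exact hasDerivAt_const _ _

theorem generator_ne_zero {x : Smoothing fan c} (hx : x ∈ openTorus fan c) {ξ : Fin d → ℝ}
    (hξ : ξ ≠ 0) : generator ξ x ≠ 0 := by
  intro h
  refine hξ (funext fun j => ?_)
  have h1 : (generator ξ x : MLattice d p → ℂ) (zExp p j) = 0 := by rw [h]; rfl
  rw [generator_val] at h1
  simpa [weight, zExp, Pi.single_apply, val_ne_zero_of_openTorus hx] using h1

/-- The moment map is strictly monotone along the imaginary directions of the complex torus. -/
theorem momentMap_complexAct_ne (hω : IsKahlerForm ω) (hμ : IsMomentMap ω μ) {x : Smoothing fan c}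
    (hx : x ∈ openTorus fan c) {a : Fin d → ℝ} (ha : a ≠ 0) :
    μ (complexAct (fun j => (a j : ℂ)) x) ≠ μ x := by
  intro h
  set ζ : Fin d → ℂ := fun j => (a j : ℂ)
  -- The flow of the real direction `a` has velocity -i times the generator of `a`, so ⟨μ, a⟩
  -- decreases at the rate ω(ξ_a, iξ_a) > 0.
  have hder : ∀ s : ℝ, HasDerivAt (fun e : ℝ => ∑ j, μ (complexAct ((e : ℂ) • ζ) x) j * a j)
      (ω (complexAct ((s : ℂ) • ζ) x) (generator a _) ((-Complex.I) • generator a _)) s :=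
    fun s => hasDerivAt_momentMap_complexAct hμ ζ x s _ (fun m => by
      rw [cweight_ofReal, Submodule.coe_smul, Pi.smul_apply, generator_val, smul_eq_mul,
        ← mul_assoc, ← mul_assoc, neg_mul, Complex.I_mul_I, neg_neg, one_mul]) a
  have hneg : StrictAnti fun e : ℝ => ∑ j, μ (complexAct ((e : ℂ) • ζ) x) j * a j := by
    refine strictAnti_of_hasDerivAt_neg hder fun s => ?_
    have hI : (-Complex.I) • generator a (complexAct ((s : ℂ) • ζ) x)
        = -(Complex.I • generator a (complexAct ((s : ℂ) • ζ) x)) := by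
      ext m
      simp
    rw [hI, map_neg, neg_lt_zero]
    exact hω.pos _ _ (generator_ne_zero (x := complexAct ((s : ℂ) • ζ) x) hx ha)
  have h01 := hneg zero_lt_one
  have h0 : complexAct (((0 : ℝ) : ℂ) • ζ) x = x := by
    refine Smoothing.ext_iff'.2 ⟨rfl, funext fun m => ?_⟩
    rw [complexAct_val, cweight_smul]; simp
  simp only [h0, Complex.ofReal_one, one_smul, h, lt_self_iff_false] at h01

/-- Points of the open torus with equal `t` differ by some exp ζ. Its compact part preserves both
`μ` and the norms; its real part must be trivial by monotonicity. -/
theorem norm_val_eq_of_momentMap_eq (hfan : fan ⊆ compactifiedFan u) (hω : IsKahlerForm ω)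
    (hμ : IsMomentMap ω μ) {x y : Smoothing fan c} (hx : x ∈ openTorus fan c)
    (hy : y ∈ openTorus fan c) (ht : x.t = y.t) (h : μ x = μ y) (j : Fin d) :
    ‖x.val (zExp p j)‖ = ‖y.val (zExp p j)‖ := by
  set ζ : Fin d → ℂ := fun j => Complex.log (y.val (zExp p j) / x.val (zExp p j)) with hζ
  set a : Fin d → ℝ := fun j => (ζ j).re with ha
  have hxy : y = torusAct (fun j => (ζ j).im) (complexAct (fun j => (a j : ℂ)) x) := by
    refine openTorus_ext hfan hy hx ?_ fun j => ?_
    · rw [torusAct_t, complexAct_t, ht]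
    · rw [torusAct_eq, complexAct_val, complexAct_val, ← mul_assoc, ← Complex.exp_add,
        cweight_smul, cweight_zExp, cweight_zExp, add_comm, mul_comm Complex.I,
        Complex.re_add_im, hζ, Complex.exp_log (div_ne_zero (val_ne_zero_of_openTorus hy _)
          (val_ne_zero_of_openTorus hx _)), div_mul_cancel₀ _ (val_ne_zero_of_openTorus hx _)]
  have ha0 : a = 0 := by
    by_contra h0
    refine momentMap_complexAct_ne hω hμ hx h0 ?_
    rw [h, hxy, hμ.invariant]
  have := congrFun ha0 j
  simp only [ha, hζ, Complex.log_re, Pi.zero_apply] at this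
  have hpos : 0 < ‖y.val (zExp p j) / x.val (zExp p j)‖ :=
    norm_pos_iff.2 (div_ne_zero (val_ne_zero_of_openTorus hy _) (val_ne_zero_of_openTorus hx _))
  have h1 := Real.eq_one_of_pos_of_log_eq_zero hpos this
  rw [norm_div, div_eq_one_iff_eq (norm_ne_zero_iff.2 (val_ne_zero_of_openTorus hx _))] at h1
  exact h1.symm

/-! ### Adapted bases of the lattices -/

/-- Dual bases of `ℤ^d ⊕ ℤ e_i` and of its dual. -/
structure AdaptedBasis (d p : ℕ) (i : Fin (p + 1)) where
  gen : Fin (d + 1) → NLattice d p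
  exp : Fin (d + 1) → MLattice d p
  gen_snd : ∀ a l, l ≠ i → (gen a).2 l = 0
  exp_snd : ∀ a l, l ≠ i → (exp a).2 l = 0
  pairing_exp : ∀ a b, pairing (exp a) (gen b) = if a = b then 1 else 0
  expand : ∀ m : MLattice d p,
    m = ∑ a, pairing m (gen a) • exp a + ∑ l ∈ Finset.univ.erase i, m.2 l • tExp d l

/-- A unimodular simplex extends to a basis of the lattice. -/
theorem exists_basis_of_unimodular {n : ℕ} {w : Fin n → Fin d → ℤ} (hw : IsUnimodularSimplex w) :
    ∃ (r : ℕ) (b : Module.Basis (Fin n ⊕ Fin r) ℤ (Fin d → ℤ)), ∀ j, b (Sum.inl j) = w j := by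
  obtain ⟨hli, hsat⟩ := hw
  have hcast : ∀ (s : Fin n → ℤ), ∑ j, (s j : ℝ) • (fun l => ((w j l : ℤ) : ℝ)) =
      fun l => (((∑ j, s j • w j) l : ℤ) : ℝ) := by
    intro s; ext l; simp [Finset.sum_apply]
  have hliZ : LinearIndependent ℤ w := by
    rw [Fintype.linearIndependent_iff] at hli ⊢
    intro s hs j
    have := hli (fun j => (s j : ℝ)) (by rw [hcast, hs]; ext l; simp) j
    exact_mod_cast this
  set S := Submodule.span ℤ (Set.range w) with hS
  -- Unimodularity says that the span is saturated, so the quotient is torsion-free, hence free, and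
  -- the sequence splits.
  have htf : Module.IsTorsionFree ℤ ((Fin d → ℤ) ⧸ S) := by
    refine Module.IsTorsionFree.of_smul_eq_zero fun n v hnv => ?_
    obtain ⟨v, rfl⟩ := Submodule.Quotient.mk_surjective S v
    rw [or_iff_not_imp_left]
    intro hn
    rw [← Submodule.Quotient.mk_smul, Submodule.Quotient.mk_eq_zero] at hnv
    rw [Submodule.Quotient.mk_eq_zero]
    refine hsat v ?_
    obtain ⟨s, hs⟩ := (Submodule.mem_span_range_iff_exists_fun ℤ).1 hnv
    refine (Submodule.mem_span_range_iff_exists_fun ℝ).2 ⟨fun j => (s j : ℝ) / n, ?_⟩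
    have hn' : (n : ℝ) ≠ 0 := by exact_mod_cast hn
    have h1 := hcast s
    rw [hs] at h1
    have h2 : ∑ j, ((s j : ℝ) / n) • (fun l => ((w j l : ℤ) : ℝ)) =
        (n : ℝ)⁻¹ • ∑ j, (s j : ℝ) • (fun l => ((w j l : ℤ) : ℝ)) := by
      rw [Finset.smul_sum]
      refine Finset.sum_congr rfl fun j _ => ?_
      rw [smul_smul, div_eq_inv_mul]
    rw [h2, h1]
    ext l
    simp [hn']
  have : Module.Free ℤ ((Fin d → ℤ) ⧸ S) := Module.free_of_finite_type_torsion_free'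
  set bS : Module.Basis (Fin n) ℤ S := Module.Basis.span hliZ
  set bQ := Module.finBasis ℤ ((Fin d → ℤ) ⧸ S)
  refine ⟨_, bS.sumQuot bQ, fun j => ?_⟩
  rw [Module.Basis.sumQuot_inl]
  exact congrArg Subtype.val (Module.Basis.span_apply hliZ j)

/-- A basis of ℤ^d extending the vertices of the simplex is lifted to ℤ^d ⊕ ℤe_i, together with its
dual basis. -/
theorem exists_adaptedBasis (i : Fin (p + 1)) {n : ℕ} {w : Fin n → Fin d → ℤ}
    (hw : IsUnimodularSimplex w) :
    ∃ B : AdaptedBasis d p i, ∀ v ∈ insert 0 (Set.range w),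
      ∃ a, B.gen a = (v, Pi.single i 1) := by
  classical
  obtain ⟨r, b, hb⟩ := exists_basis_of_unimodular hw
  have hcard : Fintype.card (Option (Fin n ⊕ Fin r)) = d + 1 := by
    rw [Fintype.card_option, ← Module.finrank_eq_card_basis b]; simp
  set e : Fin (d + 1) ≃ Option (Fin n ⊕ Fin r) := (Fintype.equivFinOfCardEq hcard).symm
  set α : Fin n ⊕ Fin r → Fin d → ℤ := fun a j => b.coord a (Pi.single j 1) with hα
  have hdot : ∀ a (v : Fin d → ℤ), ∑ j, α a j * v j = b.coord a v := by
    intro a v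
    conv_rhs => rw [pi_eq_sum_univ' v]
    simp only [map_sum, map_smul, hα, smul_eq_mul]
    exact Finset.sum_congr rfl fun j _ => mul_comm _ _
  have hexp : ∀ (m : Fin d → ℤ), ∑ a, (∑ j, m j * b a j) • α a = m := by
    intro m
    ext j
    simp only [Finset.sum_apply, Pi.smul_apply, smul_eq_mul, Finset.sum_mul]
    rw [Finset.sum_comm]
    have h1 := b.sum_repr (Pi.single j 1)
    have h2 : ∀ l, ∑ a, m l * b a l * α a j = m l * (Pi.single j 1 : Fin d → ℤ) l := by
      intro l
      conv_rhs => rw [← h1]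
      rw [Finset.sum_apply, Finset.mul_sum]
      refine Finset.sum_congr rfl fun a _ => ?_
      simp only [hα, Module.Basis.coord_apply, Pi.smul_apply, smul_eq_mul]
      ring
    simp [h2, Pi.single_apply]
  -- `ε` is the height of the lift: 1 for the vertices, 0 for the complementary vectors. The vertex
  -- 0 lifts to `e_i`, whose dual exponent must be corrected by the heights of the others.
  set ε : Fin n ⊕ Fin r → ℤ := Sum.elim (fun _ => 1) (fun _ => 0) with hε
  set gen : Option (Fin n ⊕ Fin r) → NLattice d p :=
    fun o => o.elim (0, Pi.single i 1) fun a => (b a, Pi.single i (ε a)) with hgen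
  set ex : Option (Fin n ⊕ Fin r) → MLattice d p :=
    fun o => o.elim (-∑ a, ε a • α a, Pi.single i 1) fun a => (α a, 0) with hex
  have hpn : ∀ m : MLattice d p, pairing m (gen none) = m.2 i := fun m => by
    simp [hgen, pairing, Pi.single_apply]
  have hps : ∀ (m : MLattice d p) a, pairing m (gen (some a)) =
      ∑ j, m.1 j * b a j + m.2 i * ε a := fun m a => by
    simp [hgen, pairing, Pi.single_apply]
  refine ⟨⟨fun a => gen (e a), fun a => ex (e a), fun a l hl => ?_, fun a l hl => ?_,
    fun a a' => ?_, fun m => ?_⟩, ?_⟩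
  · rcases e a with _ | a <;> simp [hgen, hl]
  · rcases e a with _ | a <;> simp [hex, hl]
  · have : (a = a') ↔ e a = e a' := e.injective.eq_iff.symm
    rw [if_congr this rfl rfl]
    rcases e a with _ | a <;> rcases e a' with _ | a'
    · rw [hpn]; simp [hex]
    · rw [hps]
      have h1 : ∑ j, (-∑ a, ε a • α a) j * b a' j = -ε a' := by
        have : ∑ j, (-∑ a, ε a • α a) j * b a' j = -∑ a, ε a * ∑ j, α a j * b a' j := by
          simp only [Pi.neg_apply, Finset.sum_apply, Pi.smul_apply, smul_eq_mul, neg_mul,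
            Finset.sum_neg_distrib, Finset.sum_mul, Finset.mul_sum]
          rw [Finset.sum_comm]
          simp only [mul_assoc]
        rw [this]
        simp [hdot, Finsupp.single_apply]
      have h2 : ex none = (-∑ a, ε a • α a, Pi.single i 1) := rfl
      rw [h2, h1]
      simp
    · rw [hpn]; simp [hex]
    · rw [hps]; simp [hex, hdot, Finsupp.single_apply, eq_comm]
  · rw [e.sum_comp fun o => pairing m (gen o) • ex o, Fintype.sum_option]
    refine Prod.ext ?_ ?_
    · have h3 : ∑ a, pairing m (gen (some a)) • α a = m.1 + m.2 i • ∑ a, ε a • α a := by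
        simp only [hps, add_smul, Finset.sum_add_distrib, hexp, Finset.smul_sum, smul_smul]
      have h4 : (∑ a, pairing m (gen (some a)) • ex (some a)).1 =
          ∑ a, pairing m (gen (some a)) • α a := by
        rw [Prod.fst_sum]; rfl
      rw [Prod.fst_add, Prod.fst_add, h4, h3, hpn, Prod.fst_sum]
      have h5 : (m.2 i • ex none).1 = -(m.2 i • ∑ a, ε a • α a) := by
        rw [← smul_neg, Prod.smul_fst]; rfl
      have h6 : ∑ l ∈ Finset.univ.erase i, (m.2 l • tExp d l).1 = 0 :=
        Finset.sum_eq_zero fun l _ => by simp [tExp]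
      rw [h5, h6]
      abel
    · ext l
      rw [Prod.snd_add, Prod.snd_add, Prod.snd_sum, Prod.snd_sum, hpn]
      by_cases hl : l = i
      · subst hl
        simp [hex, tExp, Finset.sum_apply, Pi.single_apply]
      · simp [hex, tExp, Finset.sum_apply, Pi.single_apply, hl]
  · rintro v (rfl | ⟨j, rfl⟩)
    · exact ⟨e.symm none, by simp [hgen]⟩
    · exact ⟨e.symm (some (Sum.inl j)), by simp [hgen, hb, hε]⟩

/-! ### Tangent vectors -/

theorem tangent_add {x : Smoothing fan c} (v : tangent x) {m m' : MLattice d p} (h : m ∈ x.dom)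
    (h' : m' ∈ x.dom) : (v : MLattice d p → ℂ) (m + m') =
      x.val m * (v : MLattice d p → ℂ) m' + x.val m' * (v : MLattice d p → ℂ) m :=
  v.2.2.1 m h m' h'

theorem tangent_zero {x : Smoothing fan c} (v : tangent x) : (v : MLattice d p → ℂ) 0 = 0 := by
  have := tangent_add v x.zero_mem_dom x.zero_mem_dom
  rw [add_zero, x.val_zero, one_mul] at this
  simpa using this

theorem tangent_relation {x : Smoothing fan c} (v : tangent x) {i : Fin (p + 1)}
    {m : MLattice d p} (h : m ∈ x.dom) (h' : m + tExp d i ∈ x.dom) (h'' : m + tExp d 0 ∈ x.dom) :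
    (v : MLattice d p → ℂ) (m + tExp d i) =
      (v : MLattice d p → ℂ) (m + tExp d 0) - c i * (v : MLattice d p → ℂ) m :=
  v.2.2.2 i m h h' h''

theorem tangent_tExp (hfan : fan ⊆ compactifiedFan u) {x : Smoothing fan c}
    (hx : x ∈ finitePart fan c) (v : tangent x) (l : Fin (p + 1)) :
    (v : MLattice d p → ℂ) (tExp d l) = (v : MLattice d p → ℂ) (tExp d 0) := by
  have := tangent_relation v (i := l) x.zero_mem_dom (by rw [zero_add]; exact tExp_mem_dom hfan hx l)
    (by rw [zero_add]; exact hx)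
  simpa [tangent_zero] using this

/-- The exponents of the characters that are regular at `x` and killed by `v`. -/
def annihilator {x : Smoothing fan c} (v : tangent x) : AddSubmonoid (MLattice d p) where
  carrier := {m | m ∈ x.dom ∧ (v : MLattice d p → ℂ) m = 0}
  zero_mem' := ⟨x.zero_mem_dom, tangent_zero v⟩
  add_mem' := fun ⟨h, h₀⟩ ⟨h', h₀'⟩ =>
    ⟨Smoothing.add_mem_dom h h', by rw [tangent_add v h h', h₀, h₀', mul_zero, mul_zero, add_zero]⟩

theorem neg_mem_annihilator {x : Smoothing fan c} {v : tangent x} {m : MLattice d p}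
    (h : m ∈ annihilator v) (hm : x.val m ≠ 0) : -m ∈ annihilator v := by
  refine ⟨Smoothing.neg_mem_dom hm, ?_⟩
  have := tangent_add v h.1 (Smoothing.neg_mem_dom hm)
  rw [add_neg_cancel, tangent_zero, h.2, mul_zero, add_zero, eq_comm, mul_eq_zero] at this
  exact this.resolve_left hm

/-- Negative multiples make sense only for characters that are invertible at the point. -/
theorem zsmul_mem_annihilator {x : Smoothing fan c} {v : tangent x} {m : MLattice d p}
    (h : m ∈ annihilator v) {n : ℤ} (hn : 0 ≤ n ∨ x.val m ≠ 0) : n • m ∈ annihilator v := by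
  obtain ⟨n, rfl | rfl⟩ := n.eq_nat_or_neg
  · rw [natCast_zsmul]; exact nsmul_mem h n
  · rcases hn with hn | hn
    · have : n = 0 := by omega
      subst this
      simp [zero_mem]
    · rw [neg_smul, natCast_zsmul, ← smul_neg]
      exact nsmul_mem (neg_mem_annihilator h hn) n

theorem tangent_eq_zero {x : Smoothing fan c} {v : tangent x}
    (h : ∀ m ∈ x.dom, m ∈ annihilator v) : v = 0 := by
  refine Subtype.ext (funext fun m => ?_)
  by_cases hm : m ∈ x.dom
  · exact (h m hm).2
  · exact v.2.1 m hm

/-- The characters with exponents `m` are local coordinates at `x`. -/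
structure IsCoordinateSystem (x : Smoothing fan c) (m : Fin (d + 1) → MLattice d p) : Prop where
  mem_dom : ∀ a, m a ∈ x.dom
  eq_zero : ∀ v : tangent x, (∀ a, (v : MLattice d p → ℂ) (m a) = 0) → v = 0

namespace AdaptedBasis

variable {i : Fin (p + 1)} (B : AdaptedBasis d p i)

theorem exp_mem_dom {x : Smoothing fan c} (hx : x.1.cone ⊆ Set.range B.gen) (a : Fin (d + 1)) :
    B.exp a ∈ x.dom := by
  intro g hg
  obtain ⟨b, rfl⟩ := hx hg
  rw [B.pairing_exp]
  split_ifs <;> simp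

theorem val_exp_ne_zero {x : Smoothing fan c} (hx : x.1.cone ⊆ Set.range B.gen) {a : Fin (d + 1)}
    (ha : B.gen a ∉ x.1.cone) : x.val (B.exp a) ≠ 0 := by
  refine Smoothing.val_ne_zero_of_pairing fun g hg => ?_
  obtain ⟨b, rfl⟩ := hx hg
  rw [B.pairing_exp, if_neg]
  rintro rfl
  exact ha hg

theorem val_tExp_ne_zero {x : Smoothing fan c} (hx : x.1.cone ⊆ Set.range B.gen) {l : Fin (p + 1)}
    (hl : l ≠ i) : x.val (tExp d l) ≠ 0 := by
  refine Smoothing.val_ne_zero_of_pairing fun g hg => ?_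
  obtain ⟨b, rfl⟩ := hx hg
  rw [pairing_tExp, B.gen_snd b l hl]

/-- If `exp a` is not invertible at `x`, then `gen a` is in the cone and pairs non-negatively with
regular exponents. So negative powers occur for invertible coordinates only. -/
theorem expand_mem_annihilator {x : Smoothing fan c} (hx : x.1.cone ⊆ Set.range B.gen)
    {v : tangent x} (hv : ∀ a, (v : MLattice d p → ℂ) (B.exp a) = 0) {m : MLattice d p}
    (hm : m ∈ x.dom) : ∑ a, pairing m (B.gen a) • B.exp a ∈ annihilator v := by
  refine sum_mem fun a _ => zsmul_mem_annihilator ⟨B.exp_mem_dom hx a, hv a⟩ ?_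
  by_cases ha : B.gen a ∈ x.1.cone
  · exact Or.inl (hm _ ha)
  · exact Or.inr (B.val_exp_ne_zero hx ha)

/-- Regular characters are monomials in the `exp a` and in the units t_l, l ≠ i. Since dt_l = dt_i
and t_i is itself a monomial in the `exp a`, no further coordinate is needed. -/
theorem isCoordinateSystem (hfan : fan ⊆ compactifiedFan u) {x : Smoothing fan c}
    (hx : x ∈ finitePart fan c) (hxB : x.1.cone ⊆ Set.range B.gen) :
    IsCoordinateSystem x B.exp := by
  refine ⟨B.exp_mem_dom hxB, fun v hv => tangent_eq_zero fun m hm => ?_⟩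
  have hi : (v : MLattice d p → ℂ) (tExp d i) = 0 := by
    have h1 := B.expand (tExp d i)
    rw [Finset.sum_eq_zero (s := Finset.univ.erase i) fun l hl => by
      simp [tExp, Finset.ne_of_mem_erase hl], add_zero] at h1
    rw [h1]
    exact (B.expand_mem_annihilator hxB hv (tExp_mem_dom hfan hx i)).2
  rw [B.expand m]
  refine add_mem (B.expand_mem_annihilator hxB hv hm) (sum_mem fun l hl => ?_)
  refine zsmul_mem_annihilator ⟨tExp_mem_dom hfan hx l, ?_⟩
    (Or.inr (B.val_tExp_ne_zero hxB (Finset.ne_of_mem_erase hl)))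
  rw [tangent_tExp hfan hx, ← tangent_tExp hfan hx v i, hi]

/-! ### The coordinate frame of an adapted basis -/

theorem sub_exp_mem_dom {x : Smoothing fan c} (hx : x.1.cone ⊆ Set.range B.gen) {a : Fin (d + 1)}
    {m : MLattice d p} (hm : m ∈ x.dom) (h : pairing m (B.gen a) ≠ 0) : m - B.exp a ∈ x.dom := by
  intro g hg
  obtain ⟨b, rfl⟩ := hx hg
  have h1 := hm _ hg
  rw [pairing_sub, B.pairing_exp]
  split_ifs with hab
  · subst hab; omega
  · rwa [sub_zero]

theorem sub_tExp_mem_dom {x : Smoothing fan c} (hx : x.1.cone ⊆ Set.range B.gen) {l : Fin (p + 1)}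
    (hl : l ≠ i) {m : MLattice d p} (hm : m ∈ x.dom) : m - tExp d l ∈ x.dom := by
  rw [sub_eq_add_neg]
  exact Smoothing.add_mem_dom hm (Smoothing.neg_mem_dom (B.val_tExp_ne_zero hx hl))

/-- The derivative of `χ^m` along the `a`-th coordinate, where `t_l` for `l ≠ i` is a function of
`t_i`. -/
def partialVal (a : Fin (d + 1)) (x : Smoothing fan c) (m : MLattice d p) : ℂ :=
  (pairing m (B.gen a) : ℂ) * x.val (m - B.exp a) +
    ((B.gen a).2 i : ℂ) * x.val (tExp d i - B.exp a) *
      ∑ l ∈ Finset.univ.erase i, (m.2 l : ℂ) * x.val (m - tExp d l)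

/-- The Leibniz rule holds on the boundary strata too: where `m - B.exp a` is not regular, its
coefficient `pairing m (B.gen a)` is zero. -/
theorem partialVal_add {x : Smoothing fan c} (hx : x.1.cone ⊆ Set.range B.gen) (a : Fin (d + 1))
    {m m' : MLattice d p} (hm : m ∈ x.dom) (hm' : m' ∈ x.dom) :
    B.partialVal a x (m + m') = x.val m * B.partialVal a x m' + x.val m' * B.partialVal a x m := by
  have h1 : ∀ m ∈ x.dom, ∀ m' ∈ x.dom, (pairing m (B.gen a) : ℂ) * x.val (m + m' - B.exp a) =
      (pairing m (B.gen a) : ℂ) * (x.val (m - B.exp a) * x.val m') := by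
    intro m hm m' hm'
    by_cases h : pairing m (B.gen a) = 0
    · simp [h]
    · rw [add_sub_right_comm, x.val_add (B.sub_exp_mem_dom hx hm h) hm']
  have h2 : ∀ m ∈ x.dom, ∀ m' ∈ x.dom, ∀ l ∈ Finset.univ.erase i, x.val (m + m' - tExp d l) =
      x.val (m - tExp d l) * x.val m' := by
    intro m hm m' hm' l hl
    rw [add_sub_right_comm, x.val_add (B.sub_tExp_mem_dom hx (Finset.ne_of_mem_erase hl) hm) hm']
  have h3 : ∑ l ∈ Finset.univ.erase i, ((m + m').2 l : ℂ) * x.val (m + m' - tExp d l) =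
      x.val m' * (∑ l ∈ Finset.univ.erase i, (m.2 l : ℂ) * x.val (m - tExp d l)) +
      x.val m * ∑ l ∈ Finset.univ.erase i, (m'.2 l : ℂ) * x.val (m' - tExp d l) := by
    rw [Finset.mul_sum, Finset.mul_sum, ← Finset.sum_add_distrib]
    refine Finset.sum_congr rfl fun l hl => ?_
    have h4 := h2 m' hm' m hm l hl
    rw [add_comm m' m] at h4
    rw [Prod.snd_add, Pi.add_apply, Int.cast_add]
    linear_combination (m.2 l : ℂ) * h2 m hm m' hm' l hl + (m'.2 l : ℂ) * h4
  have h4 := h1 m' hm' m hm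
  rw [add_comm m' m] at h4
  simp only [partialVal]
  rw [h3, pairing_add, Int.cast_add, add_mul, h1 m hm m' hm', h4]
  ring

/-- The right-hand side does not depend on `l`; this is the tangency of the coordinate fields to the
smoothing. -/
theorem partialVal_tExp (a : Fin (d + 1)) (x : Smoothing fan c) (l : Fin (p + 1)) :
    B.partialVal a x (tExp d l) = ((B.gen a).2 i : ℂ) * x.val (tExp d i - B.exp a) := by
  rw [partialVal, pairing_tExp]
  by_cases hl : l = i
  · subst hl
    rw [Finset.sum_eq_zero fun j hj => by simp [tExp, Finset.ne_of_mem_erase hj]]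
    simp
  · rw [B.gen_snd a l hl, Finset.sum_eq_single_of_mem l (by simp [hl])
      fun j _ hj => by simp [tExp, hj]]
    simp [tExp, x.val_zero]

open Classical in
/-- The coordinate vector fields. -/
def partialVector (hfan : fan ⊆ compactifiedFan u) {x : Smoothing fan c}
    (hx : x ∈ finitePart fan c) (hxB : x.1.cone ⊆ Set.range B.gen) (a : Fin (d + 1)) : tangent x :=
  ⟨fun m => if m ∈ x.dom then B.partialVal a x m else 0,
    fun m hm => if_neg hm,
    fun m hm m' hm' => by
      dsimp only
      rw [if_pos hm, if_pos hm', if_pos (Smoothing.add_mem_dom hm hm'),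
        B.partialVal_add hxB a hm hm'],
    fun l m h h' h'' => by
      dsimp only
      rw [if_pos h, if_pos h', if_pos h'', B.partialVal_add hxB a h (tExp_mem_dom hfan hx l),
        B.partialVal_add hxB a h hx, B.partialVal_tExp, B.partialVal_tExp, val_tExp hfan hx l]
      change _ = _ + x.t * _ - _
      ring⟩

theorem partialVector_apply (hfan : fan ⊆ compactifiedFan u) {x : Smoothing fan c}
    (hx : x ∈ finitePart fan c) (hxB : x.1.cone ⊆ Set.range B.gen) (a : Fin (d + 1))
    {m : MLattice d p} (hm : m ∈ x.dom) :
    (B.partialVector hfan hx hxB a : MLattice d p → ℂ) m = B.partialVal a x m := if_pos hm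

theorem partialVal_exp (x : Smoothing fan c) (a b : Fin (d + 1)) :
    B.partialVal a x (B.exp b) = if b = a then 1 else 0 := by
  rw [partialVal, B.pairing_exp, Finset.sum_eq_zero fun l hl => by
    simp [B.exp_snd b l (Finset.ne_of_mem_erase hl)]]
  split_ifs with h
  · subst h; simp [x.val_zero]
  · simp

/-- The linear coordinates on the tangent space. -/
def tangentCoord (x : Smoothing fan c) : tangent x →ₗ[ℂ] (Fin (d + 1) → ℂ) where
  toFun v a := (v : MLattice d p → ℂ) (B.exp a)
  map_add' _ _ := rfl
  map_smul' _ _ := rfl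

theorem tangentCoord_bijective (hfan : fan ⊆ compactifiedFan u) {x : Smoothing fan c}
    (hx : x ∈ finitePart fan c) (hxB : x.1.cone ⊆ Set.range B.gen) :
    Function.Bijective (B.tangentCoord x) := by
  refine ⟨?_, fun s => ⟨∑ a, s a • B.partialVector hfan hx hxB a, ?_⟩⟩
  · rw [← LinearMap.ker_eq_bot, LinearMap.ker_eq_bot']
    exact fun v hv => (B.isCoordinateSystem hfan hx hxB).eq_zero v fun a => congrFun hv a
  · ext b
    simp [tangentCoord, Finset.sum_apply,
      B.partialVector_apply hfan hx hxB _ (B.exp_mem_dom hxB b), partialVal_exp]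

/-- The linear coordinates as an equivalence. -/
def tangentEquiv (hfan : fan ⊆ compactifiedFan u) {x : Smoothing fan c}
    (hx : x ∈ finitePart fan c) (hxB : x.1.cone ⊆ Set.range B.gen) :
    tangent x ≃ₗ[ℂ] (Fin (d + 1) → ℂ) :=
  LinearEquiv.ofBijective (B.tangentCoord x) (B.tangentCoord_bijective hfan hx hxB)

/-- The coordinate frame. -/
def frame (hfan : fan ⊆ compactifiedFan u) {x : Smoothing fan c}
    (hx : x ∈ finitePart fan c) (hxB : x.1.cone ⊆ Set.range B.gen) :
    Module.Basis (Fin (d + 1)) ℂ (tangent x) :=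
  Module.Basis.ofEquivFun (B.tangentEquiv hfan hx hxB)

theorem frame_apply (hfan : fan ⊆ compactifiedFan u) {x : Smoothing fan c}
    (hx : x ∈ finitePart fan c) (hxB : x.1.cone ⊆ Set.range B.gen) (a : Fin (d + 1))
    {m : MLattice d p} (hm : m ∈ x.dom) :
    (B.frame hfan hx hxB a : MLattice d p → ℂ) m = B.partialVal a x m := by
  have : B.frame hfan hx hxB a = B.partialVector hfan hx hxB a := by
    rw [frame, Module.Basis.coe_ofEquivFun, LinearEquiv.symm_apply_eq]
    ext b
    change _ = (B.partialVector hfan hx hxB a : MLattice d p → ℂ) (B.exp b)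
    rw [B.partialVector_apply hfan hx hxB _ (B.exp_mem_dom hxB b), partialVal_exp]
    simp [Pi.single_apply]
  rw [this, B.partialVector_apply hfan hx hxB a hm]

end AdaptedBasis

/-! ### The holomorphic volume form -/

/-- The logarithmic derivatives along a tangent vector at a point of the open torus. -/
def logDeriv {x : Smoothing fan c} (hx : x ∈ openTorus fan c) (v : tangent x) :
    MLattice d p →+ ℂ where
  toFun m := (v : MLattice d p → ℂ) m / x.val m
  map_zero' := by rw [tangent_zero, zero_div]
  map_add' m m' := by
    have h := mem_dom_of_openTorus hx
    have h0 := val_ne_zero_of_openTorus hx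
    rw [tangent_add v (h m) (h m'), x.val_add (h m) (h m')]
    have h1 := h0 m
    have h2 := h0 m'
    field_simp
    ring

theorem logDeriv_apply {x : Smoothing fan c} (hx : x ∈ openTorus fan c) (v : tangent x)
    (m : MLattice d p) : logDeriv hx v m = (v : MLattice d p → ℂ) m / x.val m := rfl

/-- The components `dlog z_1, …, dlog z_d, dt` of a tangent vector. -/
def logRow (x : Smoothing fan c) (v : tangent x) : Fin (d + 1) → ℂ :=
  Fin.snoc (fun j => (v : MLattice d p → ℂ) (zExp p j) / x.val (zExp p j))
    ((v : MLattice d p → ℂ) (tExp d 0))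

theorem logRow_add (x : Smoothing fan c) (v w : tangent x) :
    logRow x (v + w) = logRow x v + logRow x w := by
  ext a
  refine Fin.lastCases ?_ (fun j => ?_) a <;> simp [logRow, add_div]

theorem logRow_smul (x : Smoothing fan c) (s : ℂ) (v : tangent x) :
    logRow x (s • v) = s • logRow x v := by
  ext a
  refine Fin.lastCases ?_ (fun j => ?_) a <;> simp [logRow, mul_div_assoc]

/-- `logRow` as a linear map. -/
def logRowLinear (x : Smoothing fan c) : tangent x →ₗ[ℂ] (Fin (d + 1) → ℂ) where
  toFun := logRow x
  map_add' := logRow_add x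
  map_smul' := logRow_smul x

/-- The matrix of components of a family of tangent vectors. -/
def volMatrix (x : Smoothing fan c) (V : Fin (d + 1) → tangent x) :
    Matrix (Fin (d + 1)) (Fin (d + 1)) ℂ :=
  Matrix.of fun a b => logRow x (V b) a

/-- The holomorphic volume form `dlog z_1 ∧ … ∧ dlog z_d ∧ dt`. -/
def vol (x : Smoothing fan c) (V : Fin (d + 1) → tangent x) : ℂ := (volMatrix x V).det

theorem volMatrix_mul (x : Smoothing fan c) {V W : Fin (d + 1) → tangent x}
    {P : Matrix (Fin (d + 1)) (Fin (d + 1)) ℂ} (h : ∀ b, W b = ∑ a, P a b • V a) :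
    volMatrix x W = volMatrix x V * P := by
  ext a b
  have h1 : logRow x (W b) = ∑ l, P l b • logRow x (V l) := by
    rw [h b]
    exact (map_sum (logRowLinear x) _ _).trans
      (Finset.sum_congr rfl fun l _ => (logRowLinear x).map_smul _ _)
  simp only [volMatrix, Matrix.of_apply, Matrix.mul_apply, h1, Finset.sum_apply, Pi.smul_apply,
    smul_eq_mul]
  exact Finset.sum_congr rfl fun l _ => mul_comm _ _

theorem vol_eq_det_mul (x : Smoothing fan c) (e : Module.Basis (Fin (d + 1)) ℂ (tangent x))
    (V : Fin (d + 1) → tangent x) : vol x V = vol x e * e.det V := by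
  rw [vol, volMatrix_mul x (V := e) (P := e.toMatrix V) fun b => (e.sum_toMatrix_smul_self V b).symm,
    Matrix.det_mul, vol, Module.Basis.det_apply]

/-- The matrix of the exponents `m` in `ℤ^d ⊕ ℤ ě_l`. -/
def expMatrix (m : Fin (d + 1) → MLattice d p) (l : Fin (p + 1)) :
    Matrix (Fin (d + 1)) (Fin (d + 1)) ℂ :=
  Matrix.of fun a => Fin.snoc (fun j => ((m a).1 j : ℂ)) ((m a).2 l : ℂ)

/-- The dual family `g` provides a right inverse. -/
theorem expMatrix_det_ne_zero {m : Fin (d + 1) → MLattice d p} {g : Fin (d + 1) → NLattice d p}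
    {l : Fin (p + 1)} (hm : ∀ a i, i ≠ l → (m a).2 i = 0)
    (h : ∀ a b, pairing (m a) (g b) = if a = b then 1 else 0) : (expMatrix m l).det ≠ 0 := by
  set G : Matrix (Fin (d + 1)) (Fin (d + 1)) ℂ :=
    Matrix.of fun a b => (Fin.snoc (fun j => ((g b).1 j : ℂ)) ((g b).2 l : ℂ) :
      Fin (d + 1) → ℂ) a with hG
  have h1 : expMatrix m l * G = 1 := by
    ext a b
    have h2 := congrArg (Int.cast : ℤ → ℂ) (h a b)
    rw [pairing, Finset.sum_eq_single l (fun i _ hi => by rw [hm a i hi, zero_mul])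
      (fun hl => absurd (Finset.mem_univ l) hl)] at h2
    rw [Matrix.mul_apply, Fin.sum_univ_castSucc, Matrix.one_apply]
    push_cast at h2
    simpa [expMatrix, hG] using h2
  intro h0
  have := congrArg Matrix.det h1
  rw [Matrix.det_mul, h0, zero_mul, Matrix.det_one] at this
  exact zero_ne_one this

/-- This is dlog χ^m = ∑ m_j dlog z_j + m_l dt_l / t_l, where dt_l = dt on the smoothing. -/
theorem tangent_val_eq (hfan : fan ⊆ compactifiedFan u) {x : Smoothing fan c}
    (hx : x ∈ openTorus fan c) (v : tangent x) {m : MLattice d p} {l : Fin (p + 1)}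
    (hm : ∀ i, i ≠ l → m.2 i = 0) :
    (v : MLattice d p → ℂ) m = x.val m *
      (∑ j, (m.1 j : ℂ) * ((v : MLattice d p → ℂ) (zExp p j) / x.val (zExp p j)) +
        m.2 l * ((x.val (tExp d l))⁻¹ * (v : MLattice d p → ℂ) (tExp d 0))) := by
  have h1 : logDeriv hx v m = ∑ j, (m.1 j : ℂ) * logDeriv hx v (zExp p j) +
      m.2 l * logDeriv hx v (tExp d l) := by
    conv_lhs => rw [eq_sum_exp m]
    rw [map_add, map_sum, map_sum, Finset.sum_eq_single l (fun i _ hi => by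
      rw [hm i hi, zero_smul, map_zero]) (fun hl => absurd (Finset.mem_univ l) hl)]
    simp only [map_zsmul]
    simp only [zsmul_eq_mul]
  simp only [logDeriv_apply, tangent_tExp hfan (openTorus_subset_finitePart hx) v l] at h1
  rw [div_eq_iff (val_ne_zero_of_openTorus hx m)] at h1
  rw [h1, div_eq_inv_mul _ (x.val (tExp d l))]
  ring

/-- The change of variables from `dlog z_1, …, dlog z_d, dt` to the differentials of characters. -/
theorem jacobian_eq (hfan : fan ⊆ compactifiedFan u) {x : Smoothing fan c}
    (hx : x ∈ openTorus fan c) (V : Fin (d + 1) → tangent x) {m : Fin (d + 1) → MLattice d p}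
    {l : Fin (p + 1)} (hm : ∀ a i, i ≠ l → (m a).2 i = 0) :
    (Matrix.of fun a b => (V b : MLattice d p → ℂ) (m a)).det =
      (∏ a, x.val (m a)) * (expMatrix m l).det * (x.val (tExp d l))⁻¹ * vol x V := by
  have h1 : (Matrix.of fun a b => (V b : MLattice d p → ℂ) (m a)) =
      Matrix.diagonal (fun a => x.val (m a)) * expMatrix m l *
        Matrix.diagonal (Fin.snoc (fun _ => 1) (x.val (tExp d l))⁻¹ : Fin (d + 1) → ℂ) *
          volMatrix x V := by
    rw [Matrix.mul_assoc, Matrix.mul_assoc]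
    ext a b
    rw [Matrix.diagonal_mul, Matrix.mul_apply, Fin.sum_univ_castSucc]
    simp only [Matrix.diagonal_mul]
    simp [expMatrix, volMatrix, logRow, tangent_val_eq hfan hx (V b) (hm a)]
  rw [h1, Matrix.det_mul, Matrix.det_mul, Matrix.det_mul, Matrix.det_diagonal, Matrix.det_diagonal,
    Fin.prod_univ_castSucc (n := d) (f := (Fin.snoc (fun _ => 1) _ : Fin (d + 1) → ℂ))]
  simp [vol]

/-- A vector in the kernel of the matrix is a combination of frame vectors killed by all
coordinates. -/
theorem det_frame_ne_zero {x : Smoothing fan c} {m : Fin (d + 1) → MLattice d p}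
    (h : IsCoordinateSystem x m) (e : Module.Basis (Fin (d + 1)) ℂ (tangent x)) :
    (Matrix.of fun a b => (e b : MLattice d p → ℂ) (m a)).det ≠ 0 := by
  intro h0
  obtain ⟨s, hs, hs0⟩ := Matrix.exists_mulVec_eq_zero_iff.2 h0
  refine hs ?_
  have h1 : ∑ b, s b • e b = 0 := by
    refine h.eq_zero _ fun a => ?_
    have := congrFun hs0 a
    simp only [Matrix.mulVec, dotProduct, Matrix.of_apply, Pi.zero_apply] at this
    simp only [Submodule.coe_sum, Submodule.coe_smul, Finset.sum_apply, Pi.smul_apply, smul_eq_mul]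
    rw [← this]
    exact Finset.sum_congr rfl fun b _ => mul_comm _ _
  exact funext fun b => Fintype.linearIndependent_iff.1 e.linearIndependent s h1 b

theorem vol_frame_ne_zero (hu : ∀ i, IsUnimodularSimplex (u i))
    (hfan : fan ⊆ compactifiedFan u) {x : Smoothing fan c}
    (hx : x ∈ openTorus fan c) (e : Module.Basis (Fin (d + 1)) ℂ (tangent x)) : vol x e ≠ 0 := by
  obtain ⟨B, -⟩ := exists_adaptedBasis 0 (hu 0)
  have h1 := det_frame_ne_zero (B.isCoordinateSystem hfan (openTorus_subset_finitePart hx)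
    (by rw [show x.1.cone = ∅ from hx]; exact Set.empty_subset _)) e
  rw [jacobian_eq hfan hx e (l := 0) B.exp_snd] at h1
  exact right_ne_zero_of_mul h1

/-! ### The phase of the fibres -/

theorem mem_ker_grossDifferential {x : Smoothing fan c} {v : tangent x} :
    v ∈ LinearMap.ker (grossDifferential ω K x) ↔
      (∀ j, ω x (generator (Pi.single j 1) x) v = 0) ∧
        ((starRingEnd ℂ) (x.t - K) * (v : MLattice d p → ℂ) (tExp d 0)).re = 0 := by
  rw [LinearMap.mem_ker, Prod.ext_iff, funext_iff]
  simp [grossDifferential]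

theorem generator_tExp (ξ : Fin d → ℝ) (x : Smoothing fan c) (l : Fin (p + 1)) :
    (generator ξ x : MLattice d p → ℂ) (tExp d l) = 0 := by
  rw [generator_val]; simp [weight, tExp]

theorem generator_mem_ker (hμ : IsMomentMap ω μ) (ξ : Fin d → ℝ) (x : Smoothing fan c) :
    generator ξ x ∈ LinearMap.ker (grossDifferential ω K x) := by
  rw [mem_ker_grossDifferential]
  exact ⟨fun j => generator_isotropic hμ _ _ x, by rw [generator_tExp]; simp⟩

theorem weight_zExp (j : Fin d) (ξ : Fin d → ℝ) : weight (zExp p j) ξ = ξ j := by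
  simp [weight, zExp, Pi.single_apply]

theorem logRow_generator {x : Smoothing fan c} (hx : x ∈ openTorus fan c) (ξ : Fin d → ℝ)
    (j : Fin d) : logRow x (generator ξ x) j.castSucc = Complex.I * ξ j := by
  rw [logRow, Fin.snoc_castSucc, generator_val, weight_zExp,
    mul_div_cancel_right₀ _ (val_ne_zero_of_openTorus hx _)]

/-- The fibres have constant phase with respect to `dlog z_1 ∧ … ∧ dlog z_d ∧ dt / (t - K)`. -/
theorem vol_fiber_frame (hμ : IsMomentMap ω μ) {x : Smoothing fan c} (hx : x ∈ openTorus fan c)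
    (hxK : x.t ≠ K)
    (f : Module.Basis (Fin (d + 1)) ℝ (LinearMap.ker (grossDifferential ω K x)))
    (hf : vol x (fun j => (f j : tangent x)) ≠ 0) :
    ∃ r : ℝ, r ≠ 0 ∧ vol x (fun j => (f j : tangent x)) = Complex.I ^ (d + 1) * r * (x.t - K) := by
  -- If `dt` killed the whole frame, the last row of the matrix would vanish.
  obtain ⟨b, hb⟩ : ∃ b, ((f b : tangent x) : MLattice d p → ℂ) (tExp d 0) ≠ 0 := by
    by_contra! h
    refine hf (Matrix.det_eq_zero_of_row_eq_zero (Fin.last d) fun b => ?_)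
    simp [volMatrix, logRow, h b]
  set v : tangent x := (f b).1 with hv
  -- Comparison family: the torus generators and one vector with dt ≠ 0. Its matrix is upper
  -- triangular with diagonal i, …, i, dt(v), and it is related to `f` by a real matrix.
  set f' : Fin (d + 1) → LinearMap.ker (grossDifferential ω K x) :=
    Fin.snoc (fun j => ⟨generator (Pi.single j 1) x, generator_mem_ker hμ _ x⟩) (f b) with hf'
  have h1 : vol x (fun j => (f' j : tangent x)) =
      Complex.I ^ d * (v : MLattice d p → ℂ) (tExp d 0) := by
    rw [vol, Matrix.det_of_isUpperTriangular, Fin.prod_univ_castSucc]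
    · have h0 : ∀ j : Fin d, logRow x (f' j.castSucc) j.castSucc = Complex.I := fun j => by
        simp [hf', logRow_generator hx]
      simp only [volMatrix, Matrix.of_apply, h0, Finset.prod_const, Finset.card_univ,
        Fintype.card_fin]
      simp [logRow, hf', hv]
    · intro a
      refine Fin.lastCases ?_ (fun j => ?_) a
      · intro b'
        refine Fin.lastCases (fun h => absurd h (lt_irrefl _)) (fun j' _ => ?_) b'
        simp [volMatrix, logRow, hf', generator_tExp]
      · intro b'
        refine Fin.lastCases (fun h => ?_) (fun j' h => ?_) b'
        · exact absurd h (not_lt.2 (Fin.le_last _))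
        · have : j' ≠ j := by rintro rfl; exact lt_irrefl _ h
          simp [volMatrix, hf', logRow_generator hx, this.symm]
  have h2 : vol x (fun j => (f' j : tangent x)) =
      vol x (fun j => (f j : tangent x)) * ((f.toMatrix f').det : ℝ) := by
    rw [vol, volMatrix_mul x (V := fun j => (f j : tangent x))
      (P := (f.toMatrix f').map Complex.ofReal) fun b => ?_, Matrix.det_mul, vol]
    · congr 1
      exact (RingHom.map_det Complex.ofRealHom (f.toMatrix f')).symm
    · have := congrArg (Subtype.val) (f.sum_toMatrix_smul_self f' b)
      rw [← this, Submodule.coe_sum]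
      refine Finset.sum_congr rfl fun a _ => ?_
      ext m
      simp
  rw [h1] at h2
  have hker := (mem_ker_grossDifferential.1 (f b).2).2
  set s : ℝ := ((starRingEnd ℂ) (x.t - K) * (v : MLattice d p → ℂ) (tExp d 0)).im with hs
  -- Tangency to |t - K| = const makes conj(t - K) dt(v) imaginary, so dt(v) is i(t - K) up to a
  -- real factor.
  have h3 : (starRingEnd ℂ) (x.t - K) * (v : MLattice d p → ℂ) (tExp d 0) = Complex.I * s := by
    rw [← Complex.re_add_im ((starRingEnd ℂ) (x.t - K) * (v : MLattice d p → ℂ) (tExp d 0)),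
      ← hs, hv, hker]
    simp [mul_comm]
  have hK0 : x.t - K ≠ 0 := sub_ne_zero.2 hxK
  have hn : ((Complex.normSq (x.t - K) : ℝ) : ℂ) ≠ 0 := by
    exact_mod_cast (Complex.normSq_pos.2 hK0).ne'
  have h4 : (v : MLattice d p → ℂ) (tExp d 0) * (Complex.normSq (x.t - K) : ℝ) =
      Complex.I * s * (x.t - K) := by
    rw [← h3, Complex.normSq_eq_conj_mul_self]; ring
  have hs0 : s ≠ 0 := by
    intro h0
    rw [h0] at h4
    rw [Complex.ofReal_zero, mul_zero, zero_mul] at h4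
    exact mul_ne_zero hb hn h4
  have hP : (((f.toMatrix f').det : ℝ) : ℂ) ≠ 0 := by
    intro h0
    rw [h0, mul_zero] at h2
    exact mul_ne_zero (pow_ne_zero _ Complex.I_ne_zero) hb h2
  have hP' : (f.toMatrix f').det ≠ 0 := by exact_mod_cast hP
  refine ⟨s / (Complex.normSq (x.t - K) * (f.toMatrix f').det),
    div_ne_zero hs0 (mul_ne_zero (Complex.normSq_pos.2 hK0).ne' hP'), ?_⟩
  push_cast
  rw [pow_succ]
  field_simp
  linear_combination (-(Complex.normSq (x.t - K) : ℂ)) * h2 + Complex.I ^ d * h4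

/-! ### Holomorphic discs -/

-- The maximum principle applies to both f and 1 / f, so |f| attains its maximum at the centre.
open Metric in
theorem eqOn_closedBall_of_norm_const {f : ℂ → ℂ} (hf : DiffContOnCl ℂ f (ball 0 1))
    (h0 : ∀ z ∈ closedBall (0 : ℂ) 1, f z ≠ 0) {ρ : ℝ} (hρ : ∀ z ∈ sphere (0 : ℂ) 1, ‖f z‖ = ρ) :
    ∀ z ∈ closedBall (0 : ℂ) 1, f z = f 0 := by
  have hcl : closure (ball (0 : ℂ) 1) = closedBall 0 1 := closure_ball 0 one_ne_zero
  have hfr : frontier (ball (0 : ℂ) 1) = sphere 0 1 := frontier_ball 0 one_ne_zero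
  have h1 : ∀ z ∈ closedBall (0 : ℂ) 1, ‖f z‖ ≤ ρ := fun z hz =>
    Complex.norm_le_of_forall_mem_frontier_norm_le isBounded_ball hf
      (fun w hw => (hρ w (hfr ▸ hw)).le) (hcl ▸ hz)
  have hinv : DiffContOnCl ℂ (fun z => (f z)⁻¹) (ball 0 1) := hf.inv fun z hz => h0 z (hcl ▸ hz)
  have h2 : ∀ z ∈ closedBall (0 : ℂ) 1, ‖(f z)⁻¹‖ ≤ ρ⁻¹ := fun z hz =>
    Complex.norm_le_of_forall_mem_frontier_norm_le isBounded_ball hinv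
      (fun w hw => by rw [norm_inv, hρ w (hfr ▸ hw)]) (hcl ▸ hz)
  have hmax : IsMaxOn (norm ∘ f) (ball 0 1) 0 := by
    intro z hz
    have h3 := h2 0 (mem_closedBall_self zero_le_one)
    rw [norm_inv] at h3
    have hpos : 0 < ‖f 0‖ := norm_pos_iff.2 (h0 0 (mem_closedBall_self zero_le_one))
    have hρ0 : 0 < ρ := hpos.trans_le (h1 0 (mem_closedBall_self zero_le_one))
    exact (h1 z (ball_subset_closedBall hz)).trans ((inv_le_inv₀ hpos hρ0).1 h3)
  exact fun z hz => Complex.eqOn_closedBall_of_isMaxOn_norm hf hmax hz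

namespace IsHolomorphicDisc

variable {s : ℂ → Smoothing fan c} {L : Set (Smoothing fan c)}

theorem eventually_mem_dom (h : IsHolomorphicDisc s L) {z : ℂ} (hz : z ∈ disc)
    {m : MLattice d p} (hm : m ∈ (s z).dom) : ∀ᶠ w in 𝓝[disc] z, m ∈ (s w).dom :=
  (Smoothing.tendsto_nhds_iff.1 (h.continuousOn z hz) m hm).1

theorem continuousWithinAt_val (h : IsHolomorphicDisc s L) {z : ℂ} (hz : z ∈ disc)
    {m : MLattice d p} (hm : m ∈ (s z).dom) :
    ContinuousWithinAt (fun w => (s w).val m) disc z :=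
  (Smoothing.tendsto_nhds_iff.1 (h.continuousOn z hz) m hm).2

theorem disc_mem_nhds {z : ℂ} (hz : z ∈ Metric.ball (0 : ℂ) 1) : disc ∈ 𝓝 z :=
  mem_of_superset (Metric.isOpen_ball.mem_nhds hz) Metric.ball_subset_closedBall

theorem analyticAt_val (h : IsHolomorphicDisc s L) {z : ℂ} (hz : z ∈ Metric.ball (0 : ℂ) 1)
    {m : MLattice d p} (hm : m ∈ (s z).dom) : AnalyticAt ℂ (fun w => (s w).val m) z := by
  rw [Complex.analyticAt_iff_eventually_differentiableAt]
  have h1 := h.eventually_mem_dom (Metric.ball_subset_closedBall hz) hm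
  rw [nhdsWithin_eq_nhds.2 (disc_mem_nhds hz)] at h1
  filter_upwards [h1, Metric.isOpen_ball.mem_nhds hz] with w hw hwb using h.holomorphic w hwb m hw

/-- The default value 0 agrees with the inverse of 0, so the identity needs no regularity
hypothesis. It describes `t` as the inverse of a regular function near infinity. -/
theorem _root_.GrossFibration.Smoothing.val_eq_inv (x : Smoothing fan c)
    (m : MLattice d p) : x.val m = (x.val (-m))⁻¹ := by
  by_cases h0 : x.val (-m) = 0
  · rw [h0, inv_zero]
    by_contra h1
    exact Smoothing.val_neg_ne_zero h1 h0
  · have := x.val_neg h0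
    rwa [neg_neg] at this

theorem neg_tExp_mem_dom (hfan : fan ⊆ compactifiedFan u) {x : Smoothing fan c}
    (hx : x ∉ finitePart fan c) : -tExp d 0 ∈ x.dom := by
  intro g hg
  rw [cone_eq_infinity hfan hx] at hg
  rw [Set.mem_singleton_iff.1 hg, pairing_neg, pairing_tExp]
  simp [infinityRay]

theorem val_neg_tExp_eq_zero (hfan : fan ⊆ compactifiedFan u) {x : Smoothing fan c}
    (hx : x ∉ finitePart fan c) : x.val (-tExp d 0) = 0 := by
  by_contra h
  have := Smoothing.pairing_eq_zero h (infinityRay d p) (by rw [cone_eq_infinity hfan hx]; rfl)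
  rw [pairing_neg, pairing_tExp] at this
  simp [infinityRay] at this

theorem meromorphicOn_t (hfan : fan ⊆ compactifiedFan u) (h : IsHolomorphicDisc s L) :
    MeromorphicOn (fun z => (s z).t) (Metric.ball 0 1) := by
  intro z hz
  by_cases hf : s z ∈ finitePart fan c
  · exact (h.analyticAt_val hz hf).meromorphicAt
  · have h1 := neg_tExp_mem_dom hfan hf
    refine (h.analyticAt_val hz h1).meromorphicAt.inv.congr ?_
    exact Eventually.of_forall fun w => ((s w).val_eq_inv _).symm

/-- By continuity `t ≠ τ` at interior points close to the boundary point 1, and a meromorphic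
function on the connected ball is not locally constant at one place only. -/
theorem order_t_ne_top (hfan : fan ⊆ compactifiedFan u) (h : IsHolomorphicDisc s L) {τ : ℂ}
    (h1 : s 1 ∈ finitePart fan c) (hτ : (s 1).t ≠ τ) {z : ℂ} (hz : z ∈ Metric.ball (0 : ℂ) 1) :
    meromorphicOrderAt (fun z => (s z).t - τ) z ≠ ⊤ := by
  have hmer : MeromorphicOn (fun z => (s z).t - τ) (Metric.ball 0 1) :=
    (meromorphicOn_t hfan h).sub (MeromorphicOn.const τ)
  have h1d : (1 : ℂ) ∈ disc := by simp [disc]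
  have hne : ∀ᶠ w in 𝓝[disc] (1 : ℂ), (s w).t ≠ τ :=
    (h.continuousWithinAt_val h1d h1).eventually_ne hτ
  obtain ⟨ε, hε, hball⟩ := Metric.mem_nhdsWithin_iff.1 hne
  have hcl : (1 : ℂ) ∈ closure (Metric.ball (0 : ℂ) 1) := by
    rw [closure_ball 0 one_ne_zero]; exact h1d
  obtain ⟨w, hw, hwd⟩ := Metric.mem_closure_iff.1 hcl ε hε
  rw [dist_comm] at hwd
  refine hmer.meromorphicOrderAt_ne_top_of_isPreconnected (convex_ball 0 1).isPreconnected hw hz ?_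
  intro htop
  rw [meromorphicOrderAt_eq_top_iff] at htop
  have h2 : ∀ᶠ y in 𝓝 w, (s y).t ≠ τ := by
    filter_upwards [Metric.isOpen_ball.mem_nhds hw, Metric.isOpen_ball.mem_nhds hwd] with y hy hy'
    exact hball ⟨hy', Metric.ball_subset_closedBall hy⟩
  obtain ⟨y, hy, hy'⟩ := (htop.and (nhdsWithin_le_nhds h2)).exists
  exact hy' (sub_eq_zero.1 hy)

theorem eventually_t_ne (hfan : fan ⊆ compactifiedFan u) (h : IsHolomorphicDisc s L) {τ : ℂ}
    (h1 : s 1 ∈ finitePart fan c) (hτ : (s 1).t ≠ τ) {z : ℂ} (hz : z ∈ Metric.ball (0 : ℂ) 1) :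
    ∀ᶠ w in 𝓝[≠] z, (s w).t ≠ τ := by
  have hmer : MeromorphicAt (fun z => (s z).t - τ) z :=
    (meromorphicOn_t hfan h z hz).sub (MeromorphicAt.const τ z)
  filter_upwards [(meromorphicOrderAt_ne_top_iff_eventually_ne_zero hmer).1
    (h.order_t_ne_top hfan h1 hτ hz)] with w hw using sub_ne_zero.1 hw

end IsHolomorphicDisc

/-- The points of the open torus at which `t ≠ K`. -/
def goodPart (fan : Set (Set (NLattice d p))) (c : Fin (p + 1) → ℂ) (K : ℝ) :
    Set (Smoothing fan c) := {x | x ∈ openTorus fan c ∧ x.t ≠ K}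

theorem mem_goodPart (hfan : fan ⊆ compactifiedFan u) (hc0 : c 0 = 0) {x : Smoothing fan c}
    (h : ∀ l, x.t ≠ c l) (hK : x.t ≠ K) : x ∈ goodPart fan c K := by
  refine ⟨mem_openTorus hfan ?_ h, hK⟩
  -- At infinity `t` has the default value 0 = `c 0`, which `h 0` excludes.
  exact Smoothing.mem_dom_of_val_ne_zero (hc0 ▸ h 0)

section

variable {s : ℂ → Smoothing fan c} {L : Set (Smoothing fan c)}

/-- In the interior the bad values of `t` are taken at isolated points; at the boundary continuity
suffices. -/
theorem eventually_goodPart (hfan : fan ⊆ compactifiedFan u) (hc0 : c 0 = 0)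
    (h : IsHolomorphicDisc s L) (hb : ∀ z ∈ Metric.sphere (0 : ℂ) 1, s z ∈ goodPart fan c K)
    {z : ℂ} (hz : z ∈ disc) : ∀ᶠ w in 𝓝[disc] z, w ≠ z → s w ∈ goodPart fan c K := by
  by_cases hzb : z ∈ Metric.ball (0 : ℂ) 1
  · have h1 := hb 1 (by simp)
    have h1f := openTorus_subset_finitePart h1.1
    rw [nhdsWithin_eq_nhds.2 (IsHolomorphicDisc.disc_mem_nhds hzb)]
    suffices hg : ∀ᶠ w in 𝓝[≠] z, s w ∈ goodPart fan c K from eventually_nhdsWithin_iff.1 hg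
    have h2 : ∀ᶠ w in 𝓝[≠] z, ∀ l, (s w).t ≠ c l := eventually_all.2 fun l =>
      h.eventually_t_ne hfan h1f (t_ne_of_openTorus hfan h1.1 l) hzb
    filter_upwards [h2, h.eventually_t_ne hfan h1f h1.2 hzb] with w hw hw'
    exact mem_goodPart hfan hc0 hw hw'
  · have hzs : z ∈ Metric.sphere (0 : ℂ) 1 := by
      rw [mem_sphere_zero_iff_norm]
      exact le_antisymm (mem_closedBall_zero_iff.1 hz) (not_lt.1 fun hlt =>
        hzb (mem_ball_zero_iff.2 hlt))
    have h1 := hb z hzs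
    have hcont := h.continuousWithinAt_val hz (openTorus_subset_finitePart h1.1)
    have h2 : ∀ᶠ w in 𝓝[disc] z, ∀ l, (s w).t ≠ c l := eventually_all.2 fun l =>
      hcont.eventually_ne (t_ne_of_openTorus hfan h1.1 l)
    filter_upwards [h2, hcont.eventually_ne h1.2] with w hw hw' _
    exact mem_goodPart hfan hc0 hw hw'

theorem continuousWithinAt_det {A : Set ℂ} {z : ℂ} {n : ℕ} {M : ℂ → Matrix (Fin n) (Fin n) ℂ}
    (h : ∀ a b, ContinuousWithinAt (fun w => M w a b) A z) :
    ContinuousWithinAt (fun w => (M w).det) A z :=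
  (continuous_id.matrix_det).continuousAt.comp_continuousWithinAt
    (continuousWithinAt_pi.2 fun a => continuousWithinAt_pi.2 fun b => h a b)

/-- A frame along the disc is continuous. -/
def IsContinuousFrame (s : ℂ → Smoothing fan c)
    (e : ∀ z, Module.Basis (Fin (d + 1)) ℂ (tangent (s z))) : Prop :=
  ∀ z ∈ disc, ∀ m ∈ (s z).dom, ∀ j,
    ContinuousWithinAt (fun w => (e w j : MLattice d p → ℂ) m) disc z

variable {e : ∀ z, Module.Basis (Fin (d + 1)) ℂ (tangent (s z))}

theorem continuousWithinAt_jacobian (he : IsContinuousFrame s e) {z : ℂ} (hz : z ∈ disc)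
    {m : Fin (d + 1) → MLattice d p} (hm : ∀ a, m a ∈ (s z).dom) :
    ContinuousWithinAt (fun w => (Matrix.of fun a b => (e w b : MLattice d p → ℂ) (m a)).det)
      disc z :=
  continuousWithinAt_det fun a b => he z hz (m a) (hm a) b

theorem continuousWithinAt_vol (h : IsHolomorphicDisc s L) (he : IsContinuousFrame s e) {z : ℂ}
    (hz : z ∈ disc) (hzt : s z ∈ openTorus fan c) :
    ContinuousWithinAt (fun w => vol (s w) (e w)) disc z := by
  refine continuousWithinAt_det fun a b => ?_
  refine Fin.lastCases ?_ (fun j => ?_) a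
  · simp only [volMatrix, Matrix.of_apply, logRow, Fin.snoc_last]
    exact he z hz _ (mem_dom_of_openTorus hzt _) b
  · simp only [volMatrix, Matrix.of_apply, logRow, Fin.snoc_castSucc]
    exact (he z hz _ (mem_dom_of_openTorus hzt _) b).div
      (h.continuousWithinAt_val hz (mem_dom_of_openTorus hzt _)) (val_ne_zero_of_openTorus hzt _)

/-- The function `(t - K) / vol(e)` along the disc. -/
def volRatio (K : ℝ) (s : ℂ → Smoothing fan c)
    (e : ∀ z, Module.Basis (Fin (d + 1)) ℂ (tangent (s z))) (z : ℂ) : ℂ :=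
  ((s z).t - K) / vol (s z) (e z)

/-- The exponents of local coordinates near the divisor at infinity. -/
def infinityExp (d p : ℕ) : Fin (d + 1) → MLattice d p :=
  Fin.snoc (zExp p) (-tExp d 0)

theorem infinityExp_mem_dom (hfan : fan ⊆ compactifiedFan u) {x : Smoothing fan c}
    (hx : x ∉ finitePart fan c) (a : Fin (d + 1)) : infinityExp d p a ∈ x.dom := by
  intro g hg
  rw [cone_eq_infinity hfan hx] at hg
  rw [Set.mem_singleton_iff.1 hg, pairing_infinityRay]
  refine Fin.lastCases ?_ (fun j => ?_) a <;> simp [infinityExp, zExp, tExp]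

/-- Near infinity t_l / t_0 = 1 - c_l / t_0 is a unit whose differential is a multiple of d(1 /
t_0). So the z_j and 1 / t_0 generate all differentials. -/
theorem infinityExp_isCoordinateSystem (hfan : fan ⊆ compactifiedFan u)
    {x : Smoothing fan c} (hx : x ∉ finitePart fan c) :
    IsCoordinateSystem x (infinityExp d p) := by
  refine ⟨infinityExp_mem_dom hfan hx, fun v hv => tangent_eq_zero fun m hm => ?_⟩
  have hcone := cone_eq_infinity hfan hx
  have hz : ∀ j, zExp p j ∈ annihilator v := fun j => by
    have h1 := infinityExp_mem_dom hfan hx j.castSucc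
    have h2 := hv j.castSucc
    simp only [infinityExp, Fin.snoc_castSucc] at h1 h2
    exact ⟨h1, h2⟩
  have ht : -tExp d 0 ∈ annihilator v := by
    have h1 := infinityExp_mem_dom hfan hx (Fin.last d)
    have h2 := hv (Fin.last d)
    simp only [infinityExp, Fin.snoc_last] at h1 h2
    exact ⟨h1, h2⟩
  have hunit : ∀ m : MLattice d p, ∑ i, m.2 i = 0 → x.val m ≠ 0 := fun m h0 =>
    Smoothing.val_ne_zero_of_pairing fun g hg => by
      rw [hcone] at hg
      rw [Set.mem_singleton_iff.1 hg, pairing_infinityRay, h0, neg_zero]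
  have htl : ∀ l, x.val (tExp d l - tExp d 0) ≠ 0 := fun l => hunit _ (by
    simp [tExp, Finset.sum_sub_distrib])
  have hl : ∀ l, tExp d l - tExp d 0 ∈ annihilator v := fun l => by
    have hdom := Smoothing.mem_dom_of_val_ne_zero (htl l)
    refine ⟨hdom, ?_⟩
    have h3 := tangent_relation v (i := l) ht.1 (by rwa [neg_add_eq_sub])
      (by rw [neg_add_cancel]; exact x.zero_mem_dom)
    rwa [neg_add_eq_sub, neg_add_cancel, tangent_zero, ht.2, mul_zero, sub_zero] at h3
  have hm' : m = ∑ j, m.1 j • zExp p j + ∑ l, m.2 l • (tExp d l - tExp d 0) +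
      (-∑ l, m.2 l) • (-tExp d 0) := by
    conv_lhs => rw [eq_sum_exp m]
    simp only [smul_sub, Finset.sum_sub_distrib, ← Finset.sum_smul, neg_smul_neg]
    abel
  rw [hm']
  refine add_mem (add_mem (sum_mem fun j _ => zsmul_mem_annihilator (hz j) (Or.inr (hunit _ ?_)))
    (sum_mem fun l _ => zsmul_mem_annihilator (hl l) (Or.inr (htl l))))
    (zsmul_mem_annihilator ht (Or.inl ?_))
  · simp [zExp]
  · have := hm (infinityRay d p) (by rw [show x.1.cone = _ from hcone]; rfl)
    rwa [pairing_infinityRay] at this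

theorem infinityExp_det_ne_zero : (expMatrix (infinityExp d p) 0).det ≠ 0 := by
  refine expMatrix_det_ne_zero (g := Fin.snoc (fun j => (Pi.single j 1, 0)) (0, Pi.single 0 (-1)))
    (fun a i hi => ?_) fun a b => ?_
  · refine Fin.lastCases ?_ (fun j => ?_) a <;> simp [infinityExp, zExp, tExp, hi]
  · refine Fin.lastCases ?_ (fun j => ?_) a <;> refine Fin.lastCases ?_ (fun j' => ?_) b
    · simp [infinityExp, tExp, pairing, Pi.single_apply]
    · simp [infinityExp, tExp, pairing, (Fin.castSucc_lt_last j').ne']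
    · simp [infinityExp, zExp, pairing, (Fin.castSucc_lt_last j).ne]
    · simp [infinityExp, zExp, pairing, Pi.single_apply, eq_comm]

/-! ### The local behaviour of the volume form along a disc -/

theorem cone_subset_range_gen {i : Fin (p + 1)} (hfan : fan ⊆ compactifiedFan u)
    (hc : Function.Injective c) {B : AdaptedBasis d p i}
    (hB : ∀ v ∈ insert 0 (Set.range (u i)), ∃ a, B.gen a = (v, Pi.single i 1))
    {x : Smoothing fan c} (hx : x ∈ finitePart fan c) (h : x.t = c i) :
    x.1.cone ⊆ Set.range B.gen := by
  intro g hg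
  obtain ⟨v, hv, rfl⟩ := eq_of_mem_cone hfan hc hx h hg
  exact hB v hv

/-- `q` describes `volRatio` near `z₀` up to the factor `(z - z₀) ^ n`. -/
structure IsLocalForm (K : ℝ) (s : ℂ → Smoothing fan c)
    (e : ∀ z, Module.Basis (Fin (d + 1)) ℂ (tangent (s z))) (z₀ : ℂ) (n : ℕ) (q : ℂ → ℂ) :
    Prop where
  continuousWithinAt : ContinuousWithinAt q disc z₀
  ne_zero : q z₀ ≠ 0
  eventually_eq : ∀ᶠ z in 𝓝[disc] z₀, z ≠ z₀ → s z ∈ goodPart fan c K →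
    volRatio K s e z = (z - z₀) ^ n * q z
  of_good : s z₀ ∈ goodPart fan c K → n = 0 ∧ q z₀ = volRatio K s e z₀
  of_bad : (s z₀ ∉ finitePart fan c ∨ (s z₀).t = K) → n ≠ 0

theorem exists_localForm_good (hu : ∀ i, IsUnimodularSimplex (u i))
    (hfan : fan ⊆ compactifiedFan u) (h : IsHolomorphicDisc s L) (he : IsContinuousFrame s e)
    {z₀ : ℂ} (hz₀ : z₀ ∈ disc) (hg : s z₀ ∈ goodPart fan c K) :
    ∃ n q, IsLocalForm K s e z₀ n q := by
  have hv := vol_frame_ne_zero hu hfan hg.1 (e z₀)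
  refine ⟨0, volRatio K s e, ?_, ?_, ?_, fun _ => ⟨rfl, rfl⟩, ?_⟩
  · exact ((h.continuousWithinAt_val hz₀ (mem_dom_of_openTorus hg.1 _)).sub
      continuousWithinAt_const).div (continuousWithinAt_vol h he hz₀ hg.1) hv
  · exact div_ne_zero (sub_ne_zero.2 hg.2) hv
  · exact Eventually.of_forall fun z _ _ => by rw [pow_zero, one_mul]
  · rintro (h1 | h1)
    · exact absurd (openTorus_subset_finitePart hg.1) h1
    · exact absurd h1 hg.2

/-- The point lies in the open torus, where the volume of the frame is continuous and non-zero, so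
`n` is the order of t - K. It is finite because t ≠ K at the boundary point 1. -/
theorem exists_localForm_of_t_eq_K (hu : ∀ i, IsUnimodularSimplex (u i))
    (hfan : fan ⊆ compactifiedFan u) (hcK : ∀ i, c i ≠ K) (h : IsHolomorphicDisc s L)
    (he : IsContinuousFrame s e) (hb : s 1 ∈ goodPart fan c K)
    {z₀ : ℂ} (hz₀ : z₀ ∈ Metric.ball (0 : ℂ) 1) (hf : s z₀ ∈ finitePart fan c)
    (hK : (s z₀).t = K) : ∃ n q, IsLocalForm K s e z₀ n q := by
  have hd : z₀ ∈ disc := Metric.ball_subset_closedBall hz₀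
  have ht : s z₀ ∈ openTorus fan c := mem_openTorus hfan hf fun l hl => hcK l (hl.symm.trans hK)
  have hv := vol_frame_ne_zero hu hfan ht (e z₀)
  have han : AnalyticAt ℂ (fun z => (s z).t - K) z₀ :=
    (h.analyticAt_val hz₀ hf).sub analyticAt_const
  have hnz : ¬ ∀ᶠ z in 𝓝 z₀, (s z).t - (K : ℂ) = 0 := fun h0 => by
    obtain ⟨y, hy, hy'⟩ := ((h.eventually_t_ne hfan (openTorus_subset_finitePart hb.1) hb.2
      hz₀).and (nhdsWithin_le_nhds h0)).exists
    exact hy (sub_eq_zero.1 hy')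
  obtain ⟨n, g, hgan, hg0, hev⟩ := han.exists_eventuallyEq_pow_smul_nonzero_iff.2 hnz
  refine ⟨n, fun z => g z / vol (s z) (e z), ?_, div_ne_zero hg0 hv, ?_, ?_, fun _ hn => ?_⟩
  · exact hgan.continuousAt.continuousWithinAt.div (continuousWithinAt_vol h he hd ht) hv
  · filter_upwards [nhdsWithin_le_nhds hev] with z hz _ _
    rw [volRatio, hz, smul_eq_mul, mul_div_assoc]
  · exact fun hg => absurd hK hg.2
  · have := hev.self_of_nhds
    rw [hn, pow_zero, one_smul, hK, sub_self] at this
    exact hg0 this.symm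

/-- In the coordinates `B.exp a` the Jacobian of the frame is Ω(e) times a constant times ∏ χ^{exp
a} / t_i. The last factor is a unit, so Ω(e) has a non-zero limit and the crossing contributes
nothing. -/
theorem exists_localForm_of_t_eq (hu : ∀ i, IsUnimodularSimplex (u i))
    (hfan : fan ⊆ compactifiedFan u) (hc : Function.Injective c) (hcK : ∀ i, c i ≠ K)
    (h : IsHolomorphicDisc s L) (he : IsContinuousFrame s e)
    {z₀ : ℂ} (hd : z₀ ∈ disc) (hf : s z₀ ∈ finitePart fan c)
    {i : Fin (p + 1)} (hi : (s z₀).t = c i) : ∃ n q, IsLocalForm K s e z₀ n q := by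
  obtain ⟨B, hB⟩ := exists_adaptedBasis i (hu i)
  have hxB := cone_subset_range_gen hfan hc hB hf hi
  have hA := expMatrix_det_ne_zero (l := i) B.exp_snd B.pairing_exp
  have hco := B.isCoordinateSystem hfan hf hxB
  have hJ := det_frame_ne_zero hco (e z₀)
  -- Every ray of the cone is some `gen b` of height one, so it pairs to 1 with both ∑ `exp a` and
  -- the exponent of t_i.
  have hM : (s z₀).val (∑ a, B.exp a - tExp d i) ≠ 0 := by
    refine Smoothing.val_ne_zero_of_pairing fun g hg => ?_
    obtain ⟨v, -, rfl⟩ := eq_of_mem_cone hfan hc hf hi hg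
    obtain ⟨b, hb⟩ := hxB hg
    rw [← hb, pairing_sub, pairing_sum, pairing_tExp]
    simp only [B.pairing_exp]
    simp [hb]
  refine ⟨0, fun z => ((s z).t - K) * (s z).val (∑ a, B.exp a - tExp d i) *
    (expMatrix B.exp i).det / (Matrix.of fun a b => (e z b : MLattice d p → ℂ) (B.exp a)).det,
    ?_, ?_, ?_, ?_, ?_⟩
  · exact ((((h.continuousWithinAt_val hd hf).sub continuousWithinAt_const).mul
      (h.continuousWithinAt_val hd (Smoothing.mem_dom_of_val_ne_zero hM))).mul
        continuousWithinAt_const).div (continuousWithinAt_jacobian he hd hco.mem_dom) hJ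
  · refine div_ne_zero (mul_ne_zero (mul_ne_zero ?_ hM) hA) hJ
    rw [hi]
    exact sub_ne_zero.2 (hcK i)
  · refine Eventually.of_forall fun z _ hz => ?_
    have hval : (s z).val (∑ a, B.exp a - tExp d i) =
        (∏ a, (s z).val (B.exp a)) * ((s z).val (tExp d i))⁻¹ := by
      rw [sub_eq_add_neg, (s z).val_add (mem_dom_of_openTorus hz.1 _) (mem_dom_of_openTorus hz.1 _),
        (s z).val_sum _ fun a _ => mem_dom_of_openTorus hz.1 _,
        (s z).val_neg (val_ne_zero_of_openTorus hz.1 _)]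
    have hprod : ∏ a, (s z).val (B.exp a) ≠ 0 :=
      Finset.prod_ne_zero_iff.2 fun a _ => val_ne_zero_of_openTorus hz.1 _
    have hti := val_ne_zero_of_openTorus hz.1 (tExp d i)
    have hv := vol_frame_ne_zero hu hfan hz.1 (e z)
    rw [jacobian_eq hfan hz.1 (e z) (l := i) B.exp_snd, hval, volRatio, pow_zero, one_mul]
    field_simp
  · exact fun hg => absurd hi (t_ne_of_openTorus hfan hg.1 i)
  · rintro (h1 | h1)
    · exact absurd hf h1
    · exact absurd (hi.symm.trans h1) (hcK i)

/-- In the coordinate w = 1 / t, the form dt has a double pole and t - K a simple one. The ratio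
vanishes to first order in w, so `n` is the order of w along the disc. -/
theorem exists_localForm_infinity (hu : ∀ i, IsUnimodularSimplex (u i))
    (hfan : fan ⊆ compactifiedFan u) (hc0 : c 0 = 0) (h : IsHolomorphicDisc s L)
    (he : IsContinuousFrame s e) (hb : s 1 ∈ goodPart fan c K)
    {z₀ : ℂ} (hz₀ : z₀ ∈ Metric.ball (0 : ℂ) 1) (hf : s z₀ ∉ finitePart fan c) :
    ∃ n q, IsLocalForm K s e z₀ n q := by
  have hd : z₀ ∈ disc := Metric.ball_subset_closedBall hz₀
  have hdom := IsHolomorphicDisc.neg_tExp_mem_dom hfan hf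
  have han : AnalyticAt ℂ (fun z => (s z).val (-tExp d 0)) z₀ := h.analyticAt_val hz₀ hdom
  have hw0 := IsHolomorphicDisc.val_neg_tExp_eq_zero hfan hf
  have hnz : ¬ ∀ᶠ z in 𝓝 z₀, (s z).val (-tExp d 0) = 0 := fun h0 => by
    obtain ⟨y, hy, hy'⟩ := ((h.eventually_t_ne hfan (openTorus_subset_finitePart hb.1)
      (t_ne_of_openTorus hfan hb.1 0) hz₀).and (nhdsWithin_le_nhds h0)).exists
    refine hy ?_
    rw [hc0, Smoothing.t, Smoothing.val_eq_inv, hy', inv_zero]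
  obtain ⟨n, g, hgan, hg0, hev⟩ := han.exists_eventuallyEq_pow_smul_nonzero_iff.2 hnz
  have hco := infinityExp_isCoordinateSystem hfan hf
  have hJ := det_frame_ne_zero hco (e z₀)
  have hA := infinityExp_det_ne_zero (d := d) (p := p)
  have hzd : ∀ j, zExp p j ∈ (s z₀).dom := fun j => by
    have := infinityExp_mem_dom hfan hf j.castSucc
    rwa [infinityExp, Fin.snoc_castSucc] at this
  have hz0 : ∀ j : Fin d, (s z₀).val (zExp p j) ≠ 0 := fun j =>
    Smoothing.val_ne_zero_of_pairing fun x hx => by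
      rw [cone_eq_infinity hfan hf] at hx
      rw [Set.mem_singleton_iff.1 hx, pairing_infinityRay]
      simp [zExp]
  refine ⟨n, fun z => g z * (1 - K * (s z).val (-tExp d 0)) * (∏ j, (s z).val (zExp p j)) *
    (expMatrix (infinityExp d p) 0).det /
      (Matrix.of fun a b => (e z b : MLattice d p → ℂ) (infinityExp d p a)).det, ?_, ?_, ?_, ?_, ?_⟩
  · have hprod : ContinuousWithinAt (fun z => ∏ j, (s z).val (zExp p j)) disc z₀ :=
      tendsto_finsetProd _ fun j _ => h.continuousWithinAt_val hd (hzd j)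
    exact (((hgan.continuousAt.continuousWithinAt.mul (continuousWithinAt_const.sub
      (continuousWithinAt_const.mul (h.continuousWithinAt_val hd hdom)))).mul hprod).mul
        continuousWithinAt_const).div (continuousWithinAt_jacobian he hd hco.mem_dom) hJ
  · refine div_ne_zero (mul_ne_zero (mul_ne_zero (mul_ne_zero hg0 ?_)
      (Finset.prod_ne_zero_iff.2 fun j _ => hz0 j)) hA) hJ
    rw [hw0, mul_zero, sub_zero]
    exact one_ne_zero
  · filter_upwards [nhdsWithin_le_nhds hev] with z hz _ hzg
    have hti := val_ne_zero_of_openTorus hzg.1 (tExp d 0)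
    have hv := vol_frame_ne_zero hu hfan hzg.1 (e z)
    have hw : (s z).val (-tExp d 0) = ((s z).val (tExp d 0))⁻¹ := (s z).val_neg hti
    have hp : ∏ j, (s z).val (zExp p j) ≠ 0 :=
      Finset.prod_ne_zero_iff.2 fun a _ => val_ne_zero_of_openTorus hzg.1 _
    have hexp : ∀ a i, i ≠ 0 → (infinityExp d p a).2 i = 0 := fun a i hi => by
      refine Fin.lastCases ?_ (fun j => ?_) a <;> simp [infinityExp, zExp, tExp, hi]
    rw [jacobian_eq hfan hzg.1 (e z) (l := 0) hexp, Fin.prod_univ_castSucc]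
    simp only [infinityExp, Fin.snoc_castSucc, Fin.snoc_last]
    simp only [infinityExp] at hA
    rw [← mul_div_assoc, ← mul_assoc, ← mul_assoc, ← mul_assoc, ← smul_eq_mul (_ ^ n), ← hz, hw,
      volRatio]
    change ((s z).val (tExp d 0) - K) / _ = _
    field_simp
  · exact fun hg => absurd (openTorus_subset_finitePart hg.1) hf
  · intro _ hn
    have := hev.self_of_nhds
    rw [hn, pow_zero, one_smul, hw0] at this
    exact hg0 this.symm

theorem exists_localForm (hu : ∀ i, IsUnimodularSimplex (u i))
    (hfan : fan ⊆ compactifiedFan u) (hc : Function.Injective c) (hc0 : c 0 = 0)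
    (hcK : ∀ i, c i ≠ K) (h : IsHolomorphicDisc s L) (he : IsContinuousFrame s e)
    (hb : ∀ z ∈ Metric.sphere (0 : ℂ) 1, s z ∈ goodPart fan c K) {z₀ : ℂ} (hz₀ : z₀ ∈ disc) :
    ∃ n q, IsLocalForm K s e z₀ n q := by
  by_cases hg : s z₀ ∈ goodPart fan c K
  · exact exists_localForm_good hu hfan h he hz₀ hg
  have hball : z₀ ∈ Metric.ball (0 : ℂ) 1 := by
    rw [mem_ball_zero_iff]
    refine lt_of_le_of_ne (mem_closedBall_zero_iff.1 hz₀) fun h1 => hg (hb z₀ ?_)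
    rwa [mem_sphere_zero_iff_norm]
  have hb1 := hb 1 (by simp)
  by_cases hf : s z₀ ∈ finitePart fan c
  · by_cases hK : (s z₀).t = K
    · exact exists_localForm_of_t_eq_K hu hfan hcK h he hb1 hball hf hK
    · obtain ⟨i, hi⟩ : ∃ i, (s z₀).t = c i := by
        by_contra! h1
        exact hg ⟨mem_openTorus hfan hf h1, hK⟩
      exact exists_localForm_of_t_eq hu hfan hc hcK h he hz₀ hf hi
  · exact exists_localForm_infinity hu hfan hc0 h he hb1 hball hf

/-! ### Discs of Maslov index zero off the hyperplanes -/

/-- A disc of Maslov index zero with boundary in a fibre over a regular value off the hyperplanes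
avoids `t = K` and `t = ∞`. -/
theorem finite_and_t_ne_of_maslov (hu : ∀ i, IsUnimodularSimplex (u i))
    (hfan : fan ⊆ compactifiedFan u) (hc : Function.Injective c) (hc0 : c 0 = 0)
    (hcK : ∀ i, c i ≠ K) (hμ : IsMomentMap ω μ) (h : IsHolomorphicDisc s L)
    (hb : ∀ z ∈ Metric.sphere (0 : ℂ) 1, s z ∈ goodPart fan c K) (hM : HasMaslovIndex ω K s 0) :
    ∀ z ∈ disc, s z ∈ finitePart fan c ∧ (s z).t ≠ K := by
  obtain ⟨e, f, φ, he, hφ, hφe, hper⟩ := hM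
  have hloc := fun z₀ (hz₀ : z₀ ∈ disc) => exists_localForm hu hfan hc hc0 hcK h he hb hz₀
  choose! n q hnq using hloc
  have hgood := fun z (hz : z ∈ disc) => eventually_goodPart hfan hc0 h hb hz
  have hzero : ∀ z ∈ disc, n z = 0 := by
    refine orders_eq_zero (G := volRatio K s e) (q := q) (fun z hz => (hnq z hz).continuousWithinAt)
      (fun z hz => (hnq z hz).ne_zero) (fun z hz => ?_) (fun z hz => ?_) hφ
      ((Complex.I ^ (d + 1)) ^ 2) (fun θ => ?_) (by rw [hper]; simp)
    · filter_upwards [(hnq z hz).eventually_eq, hgood z hz, self_mem_nhdsWithin] with w h1 h2 hw hne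
      obtain ⟨h3, h4⟩ := (hnq w hw).of_good (h2 hne)
      exact ⟨h1 hne (h2 hne), h3, h4.symm⟩
    · have := (hnq z (Metric.sphere_subset_closedBall hz)).of_good (hb z hz)
      exact ⟨this.1, this.2.symm⟩
    · set y := Complex.exp (Complex.I * θ)
      have hy := hb y (exp_mul_I_mem_sphere θ)
      set D := (e y).det (fun j => (f θ j : tangent (s y))) with hD
      have hv := vol_frame_ne_zero hu hfan hy.1 (e y)
      have hD0 : D ≠ 0 := by
        intro h0
        have h1 := hφe θ
        rw [← hD, h0, zero_pow two_ne_zero, zero_div] at h1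
        exact Complex.exp_ne_zero _ h1
      have hvol := vol_eq_det_mul (s y) (e y) (fun j => (f θ j : tangent (s y)))
      obtain ⟨r, hr, hr'⟩ := vol_fiber_frame hμ hy.1 hy.2 (f θ) (by
        rw [hvol]; exact mul_ne_zero hv hD0)
      rw [hvol, ← hD] at hr'
      -- By the constant phase of the fibre, D² / |D|² is a constant times the squared phase of
      -- `volRatio`.
      have hDG : D = Complex.I ^ (d + 1) * r * volRatio K s e y := by
        rw [volRatio, ← mul_div_assoc, ← hr', mul_div_cancel_left₀ _ hv]
      have hnorm : ‖D‖ = |r| * ‖volRatio K s e y‖ := by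
        rw [hDG]; simp
      have habs : ((|r| : ℝ) : ℂ) ^ 2 = (r : ℂ) ^ 2 := by
        rw [← Complex.ofReal_pow, sq_abs, Complex.ofReal_pow]
      have hr0 : (r : ℂ) ≠ 0 := by exact_mod_cast hr
      rw [hφe θ, ← hD, hnorm, Complex.ofReal_mul, mul_pow, habs, hDG, mul_pow, mul_pow,
        mul_comm (_ ^ 2) ((r : ℂ) ^ 2), mul_assoc, mul_div_mul_left _ _ (pow_ne_zero 2 hr0),
        mul_div_assoc]
  intro z hz
  by_contra hcon
  -- A point with t = K or t = ∞ would have positive order.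
  refine (hnq z hz).of_bad ?_ (hzero z hz)
  by_cases hf : s z ∈ finitePart fan c
  · exact Or.inr (not_not.1 fun h1 => hcon ⟨hf, h1⟩)
  · exact Or.inl hf

/-- The differential of |t - K|² vanishes where t = K. -/
theorem t_ne_K_of_regular {x : Smoothing fan c}
    (h : Function.Surjective (grossDifferential ω K x)) : x.t ≠ K := by
  intro hK
  obtain ⟨v, hv⟩ := h (0, 1)
  have := congrArg Prod.snd hv
  simp [grossDifferential, hK] at this

/-- Every non-constant disc of Maslov index zero lies over one of the hyperplanes. -/
theorem exists_hyperplane_of_disc (hu : ∀ i, IsUnimodularSimplex (u i))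
    (hfan : fan ⊆ compactifiedFan u) (hc : Function.Injective c) (hc0 : c 0 = 0)
    (hcK : ∀ i, c i ≠ K) (hω : IsKahlerForm ω) (hμ : IsMomentMap ω μ) {r : Base d}
    (hr : r ∉ discriminant ω μ K) (h : IsHolomorphicDisc s (fiber μ K r))
    (hne : ∃ z ∈ disc, ∃ w ∈ disc, s z ≠ s w) (hM : HasMaslovIndex ω K s 0) :
    ∃ i, r ∈ hyperplane d c K i := by
  by_contra! hnot
  -- A boundary point with t = c_l would place `r` on the l-th hyperplane.
  have hb : ∀ z ∈ Metric.sphere (0 : ℂ) 1, s z ∈ goodPart fan c K := by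
    intro z hz
    obtain ⟨hzf, hzr⟩ := h.boundary z hz
    refine ⟨mem_openTorus hfan hzf fun l hl => hnot l ?_, t_ne_K_of_regular (ω := ω) ?_⟩
    · change r.2 = _
      rw [← hzr, gross, hl]
    · by_contra hs
      exact hr ⟨s z, ⟨hzf, hzr⟩, hs⟩
  have hfin := finite_and_t_ne_of_maslov hu hfan hc hc0 hcK hμ h hb hM
  have hdiff : ∀ m, (∀ z ∈ disc, m ∈ (s z).dom) →
      DiffContOnCl ℂ (fun z => (s z).val m) (Metric.ball 0 1) := by
    intro m hm
    refine ⟨fun z hz => (h.holomorphic z hz m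
      (hm z (Metric.ball_subset_closedBall hz))).differentiableWithinAt, ?_⟩
    rw [closure_ball 0 one_ne_zero]
    exact fun z hz => h.continuousWithinAt_val hz (hm z hz)
  -- t - K has no zeros, and its modulus on the circle is √(r.2 + K²).
  have ht : ∀ z ∈ disc, (s z).t = (s 0).t := by
    intro z hz
    have hd := (hdiff (tExp d 0) fun z hz => (hfin z hz).1).sub_const (K : ℂ)
    have := eqOn_closedBall_of_norm_const (ρ := √(r.2 + K ^ 2)) hd
      (fun z hz => sub_ne_zero.2 (hfin z hz).2) (fun z hz => ?_) z hz
    · exact sub_left_injective this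
    · have h1 := congrArg Prod.snd (h.boundary z hz).2
      rw [← h1, gross, sub_add_cancel]
      exact (Real.sqrt_sq (norm_nonneg _)).symm
  have h1d : (1 : ℂ) ∈ disc := by simp [disc]
  have hb1 := hb 1 (by simp)
  have hopen : ∀ z ∈ disc, s z ∈ openTorus fan c := fun z hz =>
    mem_openTorus hfan (hfin z hz).1 fun l => by
      rw [ht z hz, ← ht 1 h1d]
      exact t_ne_of_openTorus hfan hb1.1 l
  have hz : ∀ j : Fin d, ∀ z ∈ disc, (s z).val (zExp p j) = (s 0).val (zExp p j) := by
    intro j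
    refine eqOn_closedBall_of_norm_const
      (hdiff _ fun z hz => mem_dom_of_openTorus (hopen z hz) _)
      (fun z hz => val_ne_zero_of_openTorus (hopen z hz) _)
      (ρ := ‖(s 1).val (zExp p j)‖) fun z hz => ?_
    have hzd : z ∈ disc := Metric.sphere_subset_closedBall hz
    refine norm_val_eq_of_momentMap_eq hfan hω hμ (hopen z hzd) (hopen 1 h1d) ?_ ?_ j
    · rw [ht z hzd, ht 1 h1d]
    · have h1 := congrArg Prod.fst (h.boundary z hz).2
      have h2 := congrArg Prod.fst (h.boundary 1 (by simp)).2
      exact h1.trans h2.symm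
  have h0d : (0 : ℂ) ∈ disc := by simp [disc]
  have hall : ∀ z ∈ disc, s z = s 0 := fun z hzd =>
    openTorus_ext hfan (hopen z hzd) (hopen 0 h0d) (ht z hzd) fun j => hz j z hzd
  obtain ⟨z, hz, w, hw, hzw⟩ := hne
  exact hzw ((hall z hz).trans (hall w hw).symm)

end

/-! ### Moving a point of the open torus -/

/-- The factor by which `χ^m` changes when `t` moves from `τ₀` to `τ`. -/
def shiftFactor (c : Fin (p + 1) → ℂ) (τ₀ τ : ℂ) (m : MLattice d p) : ℂ :=
  ∏ l, ((τ - c l) / (τ₀ - c l)) ^ m.2 l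

theorem shiftFactor_add {τ₀ τ : ℂ} (h₀ : ∀ l, τ₀ ≠ c l) (h : ∀ l, τ ≠ c l) (m m' : MLattice d p) :
    shiftFactor c τ₀ τ (m + m') = shiftFactor c τ₀ τ m * shiftFactor c τ₀ τ m' := by
  rw [shiftFactor, shiftFactor, shiftFactor, ← Finset.prod_mul_distrib]
  exact Finset.prod_congr rfl fun l _ =>
    zpow_add₀ (div_ne_zero (sub_ne_zero.2 (h l)) (sub_ne_zero.2 (h₀ l))) _ _

theorem shiftFactor_tExp (τ₀ τ : ℂ) (i : Fin (p + 1)) :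
    shiftFactor c τ₀ τ (tExp d i) = (τ - c i) / (τ₀ - c i) := by
  rw [shiftFactor, Finset.prod_eq_single i (fun l _ hl => by simp [tExp, hl])
    fun h => absurd (Finset.mem_univ i) h]
  simp [tExp]

/-- The point with the same coordinates on the torus of `ν^⊥` and with `t = τ`. -/
def shiftPoint (hfan : fan ⊆ compactifiedFan u) (hc0 : c 0 = 0) {x : Smoothing fan c}
    (hx : x ∈ openTorus fan c) {τ : ℂ} (h : ∀ l, τ ≠ c l) : Smoothing fan c :=
    ⟨{  cone := x.1.cone
        cone_mem := x.1.cone_mem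
        val := fun m => shiftFactor c x.t τ m * x.1.val m
        val_outside := fun m hm => by simp [x.1.val_outside m hm]
        val_zero := by simp [x.1.val_zero, shiftFactor]
        val_add := fun m hm m' hm' => by
          rw [shiftFactor_add (t_ne_of_openTorus hfan hx) h, x.1.val_add m hm m' hm']
          ring
        val_ne_zero_iff := fun m hm => by
          rw [← x.1.val_ne_zero_iff m hm, mul_ne_zero_iff, and_iff_right]
          exact Finset.prod_ne_zero_iff.2 fun l _ => zpow_ne_zero _ (div_ne_zero
            (sub_ne_zero.2 (h l)) (sub_ne_zero.2 (t_ne_of_openTorus hfan hx l))) },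
      fun i m hm hm' hm'' => by
        have h₀ := t_ne_of_openTorus hfan hx
        have h1 := fun l => x.val_add (m := m) (m' := tExp d l) hm (mem_dom_of_openTorus hx _)
        have h2 := val_tExp hfan (openTorus_subset_finitePart hx)
        change _ * x.val _ = _ * x.val _ - _ * (_ * x.val _)
        rw [shiftFactor_add h₀ h, shiftFactor_add h₀ h, shiftFactor_tExp, shiftFactor_tExp, h1, h1,
          h2, h2]
        have h3 := sub_ne_zero.2 (h₀ i)
        have h4 := sub_ne_zero.2 (h₀ 0)
        rw [hc0] at h4 ⊢
        field_simp
        ring⟩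

open Classical in
/-- The point with the same coordinates on the torus of `ν^⊥` and with `t = τ`, if it is in the open
torus. -/
def shift (hfan : fan ⊆ compactifiedFan u) (hc0 : c 0 = 0) {x : Smoothing fan c}
    (hx : x ∈ openTorus fan c) (τ : ℂ) : Smoothing fan c :=
  -- The default `x` keeps the result in the open torus for every `τ`.
  if h : ∀ l, τ ≠ c l then shiftPoint hfan hc0 hx h else x

theorem shift_mem_openTorus (hfan : fan ⊆ compactifiedFan u) (hc0 : c 0 = 0) {x : Smoothing fan c}
    (hx : x ∈ openTorus fan c) (τ : ℂ) : shift hfan hc0 hx τ ∈ openTorus fan c := by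
  rw [shift]
  split_ifs <;> exact hx

theorem shift_val (hfan : fan ⊆ compactifiedFan u) (hc0 : c 0 = 0) {x : Smoothing fan c}
    (hx : x ∈ openTorus fan c) {τ : ℂ} (h : ∀ l, τ ≠ c l) (m : MLattice d p) :
    (shift hfan hc0 hx τ).val m = shiftFactor c x.t τ m * x.val m := by
  rw [shift, dif_pos h]
  rfl

theorem shift_t (hfan : fan ⊆ compactifiedFan u) (hc0 : c 0 = 0) {x : Smoothing fan c}
    (hx : x ∈ openTorus fan c) {τ : ℂ} (h : ∀ l, τ ≠ c l) : (shift hfan hc0 hx τ).t = τ := by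
  rw [Smoothing.t, shift_val hfan hc0 hx h, shiftFactor_tExp,
    val_tExp hfan (openTorus_subset_finitePart hx),
    div_mul_cancel₀ _ (sub_ne_zero.2 (t_ne_of_openTorus hfan hx 0)), hc0, sub_zero]

theorem shift_self (hfan : fan ⊆ compactifiedFan u) (hc0 : c 0 = 0) {x : Smoothing fan c}
    (hx : x ∈ openTorus fan c) : shift hfan hc0 hx x.t = x := by
  have h := t_ne_of_openTorus hfan hx
  refine openTorus_ext hfan (shift_mem_openTorus hfan hc0 hx _) hx (shift_t hfan hc0 hx h)
    fun j => ?_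
  rw [shift_val hfan hc0 hx h]
  simp [shiftFactor, zExp]

/-- Logarithmic coordinates near a point of the open torus. -/
def logChart (hfan : fan ⊆ compactifiedFan u) (hc0 : c 0 = 0) {x : Smoothing fan c}
    (hx : x ∈ openTorus fan c) (q : (Fin d → ℝ) × ℂ) : Smoothing fan c :=
  complexAct (fun j => (q.1 j : ℂ)) (shift hfan hc0 hx q.2)

theorem logChart_line (hfan : fan ⊆ compactifiedFan u) (hc0 : c 0 = 0) {x : Smoothing fan c}
    (hx : x ∈ openTorus fan c) (a : Fin d → ℝ) (s : ℝ) :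
    logChart hfan hc0 hx (s • a, x.t) = complexAct ((s : ℂ) • fun j => (a j : ℂ)) x := by
  rw [logChart, shift_self]
  congr 1
  ext j
  simp

theorem logChart_self (hfan : fan ⊆ compactifiedFan u) (hc0 : c 0 = 0) {x : Smoothing fan c}
    (hx : x ∈ openTorus fan c) : logChart hfan hc0 hx (0, x.t) = x := by
  rw [logChart, shift_self]
  refine Smoothing.ext_iff'.2 ⟨rfl, funext fun m => ?_⟩
  rw [complexAct_val]
  simp [cweight]

theorem contDiffAt_logChart (hfan : fan ⊆ compactifiedFan u) (hc0 : c 0 = 0) {x : Smoothing fan c}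
    (hx : x ∈ openTorus fan c) (m : MLattice d p) :
    ContDiffAt ℝ 1 (fun q => (logChart hfan hc0 hx q).val m) (0, x.t) := by
  have hne := t_ne_of_openTorus hfan hx
  have hev : ∀ᶠ q : (Fin d → ℝ) × ℂ in 𝓝 (0, x.t), ∀ l, q.2 ≠ c l := eventually_all.2 fun l =>
    (continuousAt_snd (p := ((0 : Fin d → ℝ), x.t))).eventually_ne (hne l)
  have heq : (fun q => (logChart hfan hc0 hx q).val m) =ᶠ[𝓝 (0, x.t)]
      fun q : (Fin d → ℝ) × ℂ => Complex.exp (∑ j, (m.1 j : ℂ) * (q.1 j : ℂ)) *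
        ((∏ l, ((q.2 - c l) / (x.t - c l)) ^ m.2 l) * x.val m) := by
    filter_upwards [hev] with q hq
    rw [logChart, complexAct_val, shift_val hfan hc0 hx hq]
    rfl
  refine ContDiffAt.congr_of_eventuallyEq ?_ heq
  refine ContDiffAt.mul ?_ (ContDiffAt.mul ?_ contDiffAt_const)
  · have hre : ContDiff ℝ 1 (fun s : ℝ => (s : ℂ)) := Complex.ofRealCLM.contDiff
    fun_prop
  · refine contDiffAt_prod fun l _ => ?_
    have h1 : AnalyticAt ℝ (fun q : (Fin d → ℝ) × ℂ => (q.2 - c l) / (x.t - c l)) (0, x.t) := by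
      have h2 : AnalyticAt ℝ (fun q : (Fin d → ℝ) × ℂ => q.2) (0, x.t) := analyticAt_snd
      exact (h2.sub analyticAt_const).div analyticAt_const (sub_ne_zero.2 (hne l))
    exact (h1.zpow (div_ne_zero (sub_ne_zero.2 (hne l)) (sub_ne_zero.2 (hne l)))).contDiffAt

theorem continuousAt_logChart (hfan : fan ⊆ compactifiedFan u) (hc0 : c 0 = 0)
    {x : Smoothing fan c} (hx : x ∈ openTorus fan c) :
    ContinuousAt (logChart hfan hc0 hx) (0, x.t) :=
  Smoothing.tendsto_nhds_iff.2 fun m _ => ⟨Eventually.of_forall fun q =>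
    mem_dom_of_openTorus (x := logChart hfan hc0 hx q) (shift_mem_openTorus hfan hc0 hx q.2) m,
    (contDiffAt_logChart hfan hc0 hx m).continuousAt⟩

/-- Near a point of the open torus, `t` takes all values on the level set of the moment map. -/
theorem eventually_exists_t_eq (hfan : fan ⊆ compactifiedFan u) (hc0 : c 0 = 0)
    (hω : IsKahlerForm ω) (hμ : IsMomentMap ω μ) {x : Smoothing fan c}
    (hx : x ∈ openTorus fan c) :
    ∀ᶠ τ in 𝓝 x.t, ∃ y ∈ openTorus fan c, μ y = μ x ∧ y.t = τ := by
  set ψ := logChart hfan hc0 hx with hψ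
  set q₀ : (Fin d → ℝ) × ℂ := (0, x.t) with hq₀
  have hψ0 : ψ q₀ = x := logChart_self hfan hc0 hx
  obtain ⟨hcd, hder⟩ := momentMap_comp hμ (continuousAt_logChart hfan hc0 hx)
    fun m _ => contDiffAt_logChart hfan hc0 hx m
  change ContDiffAt ℝ 1 (μ ∘ ψ) q₀ at hcd
  set T : (Fin d → ℝ) × ℂ →L[ℝ] (Fin d → ℝ) := fderiv ℝ (μ ∘ ψ) q₀ with hT
  -- In the direction `a` the derivative of ⟨μ, a⟩ is -ω(ξ_a, iξ_a) < 0, so the non-compact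
  -- directions alone make `μ` a local diffeomorphism.
  have hinj : Function.Injective (T.toLinearMap ∘ₗ LinearMap.inl ℝ (Fin d → ℝ) ℂ) := by
    refine (injective_iff_map_eq_zero _).2 fun a ha => ?_
    by_contra hane
    have h1 := hder (a, 0) ((-Complex.I) • generator a (ψ q₀)) (fun m _ => ?_) a
    · have h2 : T (a, 0) = 0 := ha
      change ∑ j, T (a, 0) j * a j = _ at h1
      rw [h2] at h1
      have hI : (-Complex.I) • generator a (ψ q₀) = -(Complex.I • generator a (ψ q₀)) := by
        ext m; simp
      have h3 := hω.pos _ _ (generator_ne_zero (x := ψ q₀) (by rw [hψ0]; exact hx) hane)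
      change _ = ω (ψ q₀) (generator a (ψ q₀)) ((-Complex.I) • generator a (ψ q₀)) at h1
      rw [hI, map_neg] at h1
      simp only [Pi.zero_apply, zero_mul, Finset.sum_const_zero] at h1
      linarith
    · have hline : HasDerivAt (fun s : ℝ => ((s • a, x.t) : (Fin d → ℝ) × ℂ)) (a, 0) 0 := by
        have h4 : HasDerivAt (fun s : ℝ => s • a) ((1 : ℝ) • a) 0 := (hasDerivAt_id 0).smul_const a
        rw [one_smul] at h4
        exact h4.prodMk (hasDerivAt_const _ _)
      have h0 : ((0 : ℝ) • a, x.t) = q₀ := by rw [zero_smul]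
      have hfd : HasFDerivAt (fun q => (ψ q).val m) (fderiv ℝ (fun q => (ψ q).val m) q₀)
          (((0 : ℝ) • a, x.t) : (Fin d → ℝ) × ℂ) := by
        rw [h0]
        exact ((contDiffAt_logChart hfan hc0 hx m).differentiableAt one_ne_zero).hasFDerivAt
      have h5 := hfd.comp_hasDerivAt 0 hline
      have h6 := hasDerivAt_complexAct (fun j => (a j : ℂ)) x m 0
      have h7 : (fun q => (ψ q).val m) ∘ (fun s : ℝ => ((s • a, x.t) : (Fin d → ℝ) × ℂ)) =
          fun s : ℝ => (complexAct ((s : ℂ) • fun j => (a j : ℂ)) x).val m :=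
        funext fun s => by rw [← logChart_line hfan hc0 hx a s]; rfl
      rw [h7] at h5
      have h8 := h5.unique h6
      refine Eq.trans ?_ h8.symm
      have h9 : complexAct (((0 : ℝ) : ℂ) • fun j => (a j : ℂ)) x = x := by
        rw [← logChart_line hfan hc0 hx, h0, ← hψ, hψ0]
      rw [h9, cweight_ofReal, Submodule.coe_smul, Pi.smul_apply, generator_val, smul_eq_mul, hψ0,
        ← mul_assoc, ← mul_assoc, neg_mul, Complex.I_mul_I, neg_neg, one_mul]
  have hsurj := LinearMap.injective_iff_surjective.1 hinj
  -- (μ, t) is a submersion, so it maps neighbourhoods onto neighbourhoods; the slice with `μ` fixed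
  -- then contains every nearby value of `t`.
  have hstrict : HasStrictFDerivAt (fun q => ((μ ∘ ψ) q, q.2))
      (T.prod (ContinuousLinearMap.snd ℝ (Fin d → ℝ) ℂ)) q₀ :=
    (hcd.hasStrictFDerivAt one_ne_zero).prodMk hasStrictFDerivAt_snd
  have hrange : (T.prod (ContinuousLinearMap.snd ℝ (Fin d → ℝ) ℂ)).range = ⊤ := by
    refine LinearMap.range_eq_top.2 fun ⟨b, σ⟩ => ?_
    obtain ⟨a, ha⟩ := hsurj (b - T (0, σ))
    refine ⟨(a, σ), Prod.ext ?_ rfl⟩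
    change T (a, σ) = b
    have h1 : T (a, 0) = b - T (0, σ) := ha
    have h2 : ((a, σ) : (Fin d → ℝ) × ℂ) = (a, 0) + (0, σ) := by simp
    rw [h2, map_add, h1, sub_add_cancel]
  have hmap := hstrict.map_nhds_eq_of_surj hrange
  have hev : ∀ᶠ q : (Fin d → ℝ) × ℂ in 𝓝 q₀, ∀ l, q.2 ≠ c l := eventually_all.2 fun l =>
    (continuousAt_snd (p := q₀)).eventually_ne (t_ne_of_openTorus hfan hx l)
  have himg := image_mem_map (m := fun q => ((μ ∘ ψ) q, q.2)) hev
  rw [hmap] at himg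
  have hslice : Tendsto (fun τ : ℂ => ((μ ∘ ψ) q₀, τ)) (𝓝 x.t) (𝓝 ((μ ∘ ψ) q₀, q₀.2)) :=
    (Continuous.prodMk_right _).tendsto x.t
  filter_upwards [hslice himg] with τ hτ
  obtain ⟨q, hq, hqτ⟩ := hτ
  have h1 : μ (ψ q) = μ (ψ q₀) := congrArg Prod.fst hqτ
  have h2 : q.2 = τ := congrArg Prod.snd hqτ
  refine ⟨ψ q, shift_mem_openTorus hfan hc0 hx q.2, by rw [h1, hψ0], ?_⟩
  rw [hψ, logChart, complexAct_t, shift_t hfan hc0 hx hq, h2]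

/-- A fibre over the `i`-th hyperplane meets `t = c_i`. -/
theorem exists_mem_fiber_t_eq (hfan : fan ⊆ compactifiedFan u) (hc0 : c 0 = 0)
    (hdist : Function.Injective fun i => ‖c i - K‖) (hω : IsKahlerForm ω) (hμ : IsMomentMap ω μ)
    {r : Base d} (hcomp : IsCompact (fiber μ K r)) (hne : (fiber μ K r).Nonempty)
    {i : Fin (p + 1)} (hr : r ∈ hyperplane d c K i) : ∃ x ∈ fiber μ K r, x.t = c i := by
  by_contra! hcon
  set ρ : ℝ := ‖c i - K‖ with hρ
  have hnorm : ∀ x ∈ fiber μ K r, ‖x.t - K‖ = ρ := by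
    rintro x ⟨-, hx⟩
    have h1 := congrArg Prod.snd hx
    rw [show r.2 = ‖c i - K‖ ^ 2 - K ^ 2 from hr, gross] at h1
    exact (sq_eq_sq₀ (norm_nonneg _) (norm_nonneg _)).1 (sub_left_injective h1)
  -- The distances |c_l - K| are distinct, so c_i is the only special value on this circle.
  have hopen : ∀ x ∈ fiber μ K r, x ∈ openTorus fan c := fun x hx =>
    mem_openTorus hfan hx.1 fun l hl => by
      have h1 := hnorm x hx
      rw [hl] at h1
      obtain rfl := hdist h1
      exact hcon x hx hl
  -- `A` is closed by compactness of the fibre and open in the circle by the submersion property;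
  -- connectedness puts c_i in it.
  set A : Set ℂ := Smoothing.t '' fiber μ K r with hA
  have hAc : IsClosed A := (hcomp.image_of_continuousOn fun x hx =>
    (Smoothing.continuousAt_val hx.1).continuousWithinAt).isClosed
  have hnb : ∀ τ ∈ A, ∀ᶠ σ : ℂ in 𝓝 τ, ‖σ - K‖ = ρ → σ ∈ A := by
    rintro _ ⟨x, hx, rfl⟩
    filter_upwards [eventually_exists_t_eq hfan hc0 hω hμ (hopen x hx)] with σ hσ hσρ
    obtain ⟨y, hy, hyμ, rfl⟩ := hσ
    refine ⟨y, ⟨openTorus_subset_finitePart hy, ?_⟩, rfl⟩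
    rw [← hx.2, gross, gross, hyμ, hσρ, hnorm x hx]
  set O : Set ℂ := {τ | ∀ᶠ σ : ℂ in 𝓝 τ, ‖σ - K‖ = ρ → σ ∈ A} with hO
  have hOo : IsOpen O := isOpen_setOfPred_eventually_nhds
  have hpre : IsPreconnected (Metric.sphere (K : ℂ) ρ) :=
    isPreconnected_sphere (by simp [Complex.rank_real_complex]) _ _
  obtain ⟨x, hx⟩ := hne
  obtain ⟨σ, hσ, hσO, hσA⟩ := hpre O Aᶜ hOo hAc.isOpen_compl
    (fun τ _ => (em (τ ∈ A)).imp (hnb τ) id)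
    ⟨x.t, mem_sphere_iff_norm.2 (hnorm x hx), hnb _ ⟨x, hx, rfl⟩⟩
    ⟨c i, mem_sphere_iff_norm.2 rfl, fun ⟨y, hy, hyc⟩ => hcon y hy hyc⟩
  exact hσA (hσO.self_of_nhds (mem_sphere_iff_norm.1 hσ))

/-! ### Regular points -/

theorem generator_eq_sum (ξ : Fin d → ℝ) (x : Smoothing fan c) :
    generator ξ x = ∑ j, ξ j • generator (Pi.single j 1) x := by
  refine Subtype.ext (funext fun m => ?_)
  simp only [Submodule.coe_sum, Finset.sum_apply, generator_val]
  have h : ∀ j, ((ξ j • generator (Pi.single j 1) x : tangent x) : MLattice d p → ℂ) m =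
      Complex.I * ((m.1 j : ℂ) * ξ j) * x.val m := fun j => by
    change ξ j • (generator (Pi.single j 1) x : MLattice d p → ℂ) m = _
    rw [generator_val]
    simp [weight, Pi.single_apply]
    ring
  simp only [h]
  rw [← Finset.sum_mul, ← Finset.mul_sum, weight]
  push_cast
  rfl

/-- Surjectivity gives a vector whose image under dμ is ξ itself; pairing with ξ yields |ξ|² = ω(0,
v) = 0. -/
theorem eq_zero_of_generator_eq_zero {x : Smoothing fan c}
    (h : Function.Surjective (grossDifferential ω K x)) {ξ : Fin d → ℝ}
    (h0 : generator ξ x = 0) : ξ = 0 := by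
  obtain ⟨v, hv⟩ := h (ξ, 0)
  have h1 : ∀ j, ω x (generator (Pi.single j 1) x) v = ξ j := fun j =>
    congrFun (congrArg Prod.fst hv) j
  have h2 : ω x (generator ξ x) v = ∑ j, ξ j * ξ j := by
    rw [generator_eq_sum, map_sum, LinearMap.sum_apply]
    refine Finset.sum_congr rfl fun j _ => ?_
    rw [map_smul, LinearMap.smul_apply, h1, smul_eq_mul]
  rw [h0, map_zero, LinearMap.zero_apply] at h2
  funext j
  have h3 := (Finset.sum_eq_zero_iff_of_nonneg fun j _ => mul_self_nonneg (ξ j)).1 h2.symm j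
    (Finset.mem_univ j)
  exact mul_self_eq_zero.1 h3

theorem weight_sub_eq {g g' : NLattice d p} (h : g.2 = g'.2) (m : MLattice d p) :
    weight m (fun j => ((g'.1 j - g.1 j : ℤ) : ℝ)) = ((pairing m g' - pairing m g : ℤ) : ℝ) := by
  simp [weight, pairing, h, mul_sub, Finset.sum_sub_distrib]

/-- At a regular point the cone has dimension at most one. -/
theorem cone_subsingleton {x : Smoothing fan c}
    (h : Function.Surjective (grossDifferential ω K x)) {g g' : NLattice d p}
    (hg : g ∈ x.1.cone) (hg' : g' ∈ x.1.cone) (h2 : g.2 = g'.2) : g = g' := by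
  -- The direction g' - g lies in ν^⊥ and fixes `x` infinitesimally: a character non-zero at `x`
  -- pairs to zero with both rays.
  have h0 : generator (fun j => ((g'.1 j - g.1 j : ℤ) : ℝ)) x = 0 := by
    refine Subtype.ext (funext fun m => ?_)
    rw [generator_val, weight_sub_eq h2]
    by_cases hm : x.val m = 0
    · rw [hm, mul_zero]; rfl
    · rw [Smoothing.pairing_eq_zero hm g hg, Smoothing.pairing_eq_zero hm g' hg']
      simp
  have h1 := eq_zero_of_generator_eq_zero h h0
  refine Prod.ext (funext fun j => ?_) h2
  have h3 : ((g'.1 j - g.1 j : ℤ) : ℝ) = 0 := congrFun h1 j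
  have h4 : g'.1 j - g.1 j = 0 := by exact_mod_cast h3
  omega

theorem smul_I_val {x : Smoothing fan c} (v : tangent x) (m : MLattice d p) :
    ((Complex.I • v : tangent x) : MLattice d p → ℂ) m =
      Complex.I * (v : MLattice d p → ℂ) m := rfl

/-- If `ξ_a + i ξ_b` is orthogonal to all generators for `ω` and for the metric, it is zero. -/
theorem eq_zero_of_orthogonal (hω : IsKahlerForm ω) (hμ : IsMomentMap ω μ) {x : Smoothing fan c}
    {a b : Fin d → ℝ} (h : ∀ ξ, ω x (generator ξ x) (generator a x + Complex.I • generator b x) = 0)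
    (h' : ∀ ξ, ω x (generator ξ x)
      (Complex.I • (generator a x + Complex.I • generator b x)) = 0) :
    generator a x = 0 ∧ generator b x = 0 := by
  have hI : Complex.I • (generator a x + Complex.I • generator b x) =
      Complex.I • generator a x - generator b x := by
    refine Subtype.ext (funext fun m => ?_)
    change Complex.I * ((generator a x : MLattice d p → ℂ) m +
      Complex.I * (generator b x : MLattice d p → ℂ) m) =
        Complex.I * (generator a x : MLattice d p → ℂ) m - (generator b x : MLattice d p → ℂ) m
    linear_combination (generator b x : MLattice d p → ℂ) m * Complex.I_mul_I
  constructor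
  · by_contra hne
    have h1 := h' a
    rw [hI, map_sub, generator_isotropic hμ, sub_zero] at h1
    exact (hω.pos x _ hne).ne' h1
  · by_contra hne
    have h1 := h b
    rw [map_add, generator_isotropic hμ, zero_add] at h1
    exact (hω.pos x _ hne).ne' h1

/-- The complex linear functional `dt`. -/
def dtLinear (x : Smoothing fan c) : tangent x →ₗ[ℂ] ℂ where
  toFun v := (v : MLattice d p → ℂ) (tExp d 0)
  map_add' _ _ := rfl
  map_smul' _ _ := rfl

theorem sum_smul_generator (ζ : Fin d → ℂ) (x : Smoothing fan c) :
    ∑ j, ζ j • generator (Pi.single j 1) x =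
      generator (fun j => (ζ j).re) x + Complex.I • generator (fun j => (ζ j).im) x := by
  refine Subtype.ext (funext fun m => ?_)
  simp only [Submodule.coe_sum, Finset.sum_apply, Submodule.coe_smul, Pi.smul_apply,
    generator_val, smul_eq_mul, Submodule.coe_add, Pi.add_apply]
  have h : ∀ j, ζ j * (Complex.I * (weight m (Pi.single j 1) : ℝ) * x.val m) =
      Complex.I * ((m.1 j : ℂ) * (ζ j).re) * x.val m +
        Complex.I * (Complex.I * ((m.1 j : ℂ) * (ζ j).im) * x.val m) := fun j => by
    have hw : weight m (Pi.single j 1) = m.1 j := by simp [weight, Pi.single_apply]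
    rw [hw, Complex.ofReal_intCast]
    linear_combination (-(Complex.I * m.1 j * x.val m)) * Complex.re_add_im (ζ j)
  simp only [h]
  rw [Finset.sum_add_distrib, ← Finset.sum_mul, ← Finset.mul_sum, ← Finset.mul_sum,
    ← Finset.sum_mul, ← Finset.mul_sum, weight, weight]
  push_cast
  rfl

theorem orthogonal_of_mem_ker {x : Smoothing fan c} {w : tangent x}
    (hw : w ∈ LinearMap.ker (grossDifferential ω K x)) (ξ : Fin d → ℝ) :
    ω x (generator ξ x) w = 0 := by
  rw [generator_eq_sum, map_sum, LinearMap.sum_apply]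
  refine Finset.sum_eq_zero fun j _ => ?_
  rw [map_smul, LinearMap.smul_apply, (mem_ker_grossDifferential.1 hw).1 j, smul_zero]

/-- The kernel of the differential at a regular point is totally real. -/
theorem ker_totallyReal (hω : IsKahlerForm ω) (hμ : IsMomentMap ω μ) {x : Smoothing fan c}
    (h : Function.Surjective (grossDifferential ω K x))
    (hfin : Module.finrank ℂ (tangent x) = d + 1) {w : tangent x}
    (hw : w ∈ LinearMap.ker (grossDifferential ω K x))
    (hIw : Complex.I • w ∈ LinearMap.ker (grossDifferential ω K x)) : w = 0 := by
  have : FiniteDimensional ℂ (tangent x) := FiniteDimensional.of_finrank_pos (by omega)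
  have hinj : ∀ ξ : Fin d → ℝ, generator ξ x = 0 → ξ = 0 := fun ξ =>
    eq_zero_of_generator_eq_zero h
  -- The conditions on w and iw kill the real and the imaginary part of conj(t - K) dt(w).
  have hdt : dtLinear x w = 0 := by
    have h1 := (mem_ker_grossDifferential.1 hw).2
    have h2 := (mem_ker_grossDifferential.1 hIw).2
    rw [smul_I_val, mul_left_comm, Complex.I_mul_re, neg_eq_zero] at h2
    have h3 : (starRingEnd ℂ) (x.t - K) * (w : MLattice d p → ℂ) (tExp d 0) = 0 :=
      Complex.ext h1 h2
    refine (mul_eq_zero.1 h3).resolve_left ?_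
    exact (map_ne_zero _).2 (sub_ne_zero.2 (t_ne_K_of_regular h))
  have hli : LinearIndependent ℂ fun j : Fin d => generator (Pi.single j 1) x := by
    rw [Fintype.linearIndependent_iff]
    intro ζ hζ
    rw [sum_smul_generator] at hζ
    obtain ⟨ha, hb⟩ := eq_zero_of_orthogonal hω hμ (x := x) (a := fun j => (ζ j).re)
      (b := fun j => (ζ j).im) (fun ξ => by rw [hζ, map_zero])
      (fun ξ => by rw [hζ, smul_zero, map_zero])
    exact fun j => Complex.ext (congrFun (hinj _ ha) j) (congrFun (hinj _ hb) j)
  -- The complexified generators fill the kernel of dt by dimension, so w = ξ_a + iξ_b, to which the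
  -- orthogonality argument applies.
  have hspan : Submodule.span ℂ (Set.range fun j : Fin d => generator (Pi.single j 1) x) =
      LinearMap.ker (dtLinear x) := by
    refine Submodule.eq_of_le_of_finrank_eq ?_ ?_
    · rw [Submodule.span_le]
      rintro _ ⟨j, rfl⟩
      exact generator_tExp _ x 0
    · rw [finrank_span_eq_card hli, Fintype.card_fin]
      have h1 := LinearMap.finrank_range_add_finrank_ker (dtLinear x)
      have h2 : LinearMap.range (dtLinear x) = ⊤ := by
        rw [LinearMap.range_eq_top]
        refine LinearMap.surjective fun h0 => ?_
        obtain ⟨v, hv⟩ := h (0, 1)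
        have h3 := congrArg Prod.snd hv
        have h4 : (v : MLattice d p → ℂ) (tExp d 0) = 0 := LinearMap.congr_fun h0 v
        simp [grossDifferential, h4] at h3
      rw [h2, finrank_top, Module.finrank_self, hfin] at h1
      omega
  have hmem : w ∈ Submodule.span ℂ (Set.range fun j : Fin d => generator (Pi.single j 1) x) := by
    rw [hspan]; exact hdt
  obtain ⟨ζ, hζ⟩ := (Submodule.mem_span_range_iff_exists_fun ℂ).1 hmem
  rw [sum_smul_generator] at hζ
  obtain ⟨ha, hb⟩ := eq_zero_of_orthogonal hω hμ (x := x) (a := fun j => (ζ j).re)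
    (b := fun j => (ζ j).im) (fun ξ => by rw [hζ]; exact orthogonal_of_mem_ker hw ξ)
    (fun ξ => by rw [hζ]; exact orthogonal_of_mem_ker hIw ξ)
  rw [← hζ, ha, hb, smul_zero, add_zero]

theorem finrank_ker {x : Smoothing fan c} (h : Function.Surjective (grossDifferential ω K x))
    (hfin : Module.finrank ℂ (tangent x) = d + 1) :
    Module.finrank ℝ (LinearMap.ker (grossDifferential ω K x)) = d + 1 := by
  have : FiniteDimensional ℂ (tangent x) := FiniteDimensional.of_finrank_pos (by omega)
  have : FiniteDimensional ℝ (tangent x) := FiniteDimensional.trans ℝ ℂ (tangent x)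
  have h1 := LinearMap.finrank_range_add_finrank_ker (grossDifferential ω K x)
  rw [LinearMap.range_eq_top.2 h, finrank_top, ← Module.finrank_mul_finrank ℝ ℂ (tangent x), hfin,
    Complex.finrank_real_complex] at h1
  simp only [Base, Module.finrank_prod, Module.finrank_fintype_fun_eq_card, Fintype.card_fin,
    Module.finrank_self] at h1
  omega

/-- A real basis of a totally real subspace is independent over the complex numbers. -/
theorem linearIndependent_of_totallyReal {ι V : Type*} [Fintype ι] [AddCommGroup V] [Module ℂ V]
    [Module ℝ V] [IsScalarTower ℝ ℂ V] {N : Submodule ℝ V}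
    (hN : ∀ w ∈ N, Complex.I • w ∈ N → w = 0) {f : ι → N} (hf : LinearIndependent ℝ f) :
    LinearIndependent ℂ fun j => (f j : V) := by
  rw [Fintype.linearIndependent_iff]
  intro s hs
  obtain ⟨A, hA⟩ : ∃ A : N, A = ∑ j, (s j).re • f j := ⟨_, rfl⟩
  obtain ⟨B, hB⟩ : ∃ B : N, B = ∑ j, (s j).im • f j := ⟨_, rfl⟩
  have hAB : (A : V) + Complex.I • (B : V) = 0 := by
    rw [← hs, hA, hB, Submodule.coe_sum, Submodule.coe_sum, Finset.smul_sum,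
      ← Finset.sum_add_distrib]
    refine Finset.sum_congr rfl fun j _ => ?_
    rw [Submodule.coe_smul, Submodule.coe_smul, ← algebraMap_smul ℂ (s j).re (f j : V),
      ← algebraMap_smul ℂ (s j).im (f j : V), smul_smul, ← add_smul]
    congr 1
    simpa [mul_comm] using Complex.re_add_im (s j)
  have hB0 : (B : V) = 0 := hN _ B.2 (by
    rw [eq_neg_of_add_eq_zero_right hAB]
    exact neg_mem A.2)
  have hA0 : (A : V) = 0 := by simpa [hB0] using hAB
  have h1 := Fintype.linearIndependent_iff.1 hf _ (hA.symm.trans (Subtype.ext hA0))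
  have h2 := Fintype.linearIndependent_iff.1 hf _ (hB.symm.trans (Subtype.ext hB0))
  exact fun j => Complex.ext (h1 j) (h2 j)

/-- A real frame of the tangent space of a regular fibre is a complex frame. -/
theorem det_ker_frame_ne_zero (hω : IsKahlerForm ω) (hμ : IsMomentMap ω μ) {x : Smoothing fan c}
    (h : Function.Surjective (grossDifferential ω K x))
    (e : Module.Basis (Fin (d + 1)) ℂ (tangent x))
    (f : Module.Basis (Fin (d + 1)) ℝ (LinearMap.ker (grossDifferential ω K x))) :
    e.det (fun j => (f j : tangent x)) ≠ 0 := by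
  have hfin : Module.finrank ℂ (tangent x) = d + 1 := by
    rw [Module.finrank_eq_card_basis e, Fintype.card_fin]
  have hli : LinearIndependent ℂ (fun j => (f j : tangent x)) :=
    linearIndependent_of_totallyReal (fun w hw hIw => ker_totallyReal hω hμ h hfin hw hIw)
      f.linearIndependent
  have : FiniteDimensional ℂ (tangent x) := FiniteDimensional.of_finrank_pos (by omega)
  have hspan := hli.span_eq_top_of_card_eq_finrank' (by rw [hfin, Fintype.card_fin])
  exact (e.is_basis_iff_det.1 ⟨hli, hspan⟩).ne_zero

/-! ### Transport along the torus action -/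

theorem phase_mul_mem_tangent {x y : Smoothing fan c} {ξ : Fin d → ℝ} (hdom : y.dom = x.dom)
    (hval : ∀ m, y.val m = phase ξ m * x.val m) (v : tangent x) :
    (fun m => phase ξ m * (v : MLattice d p → ℂ) m) ∈ tangent y := by
  refine ⟨fun m hm => ?_, fun m hm m' hm' => ?_, fun i m hm h' h'' => ?_⟩
  · dsimp only
    rw [v.2.1 m (hdom ▸ hm), mul_zero]
  · rw [hdom] at hm hm'
    dsimp only
    rw [tangent_add v hm hm', hval, hval]
    simp only [phase, weight_add, Complex.ofReal_add, mul_add, Complex.exp_add]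
    ring
  · rw [hdom] at hm h' h''
    dsimp only
    rw [tangent_relation v hm h' h'']
    simp only [phase, weight_add_tExp]
    ring

theorem phase_neg_mul (ξ : Fin d → ℝ) (m : MLattice d p) (a : ℂ) :
    phase (-ξ) m * (phase ξ m * a) = a := by
  rw [← mul_assoc, phase, phase, ← Complex.exp_add]
  simp [weight]

theorem phase_mul_neg (ξ : Fin d → ℝ) (m : MLattice d p) (a : ℂ) :
    phase ξ m * (phase (-ξ) m * a) = a := by
  simpa using phase_neg_mul (-ξ) m a

/-- The differential of the action of a torus element. -/
def phaseEquiv (ξ : Fin d → ℝ) (x : Smoothing fan c) : tangent x ≃ₗ[ℝ] tangent (torusAct ξ x) where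
  toFun v := ⟨_, phase_mul_mem_tangent (torusAct_dom ξ x) (torusAct_val ξ x) v⟩
  invFun v := ⟨fun m => phase (-ξ) m * (v : MLattice d p → ℂ) m,
    phase_mul_mem_tangent (x := torusAct ξ x) (y := x) (torusAct_dom ξ x).symm
      (fun m => by rw [torusAct_val, phase_neg_mul]) v⟩
  map_add' v w := Subtype.ext (funext fun m => mul_add _ _ _)
  map_smul' a v := Subtype.ext (funext fun m => by
    change phase ξ m * (a • (v : MLattice d p → ℂ) m) = a • (phase ξ m * (v : MLattice d p → ℂ) m)
    exact mul_smul_comm _ _ _)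
  left_inv v := Subtype.ext (funext fun m => phase_neg_mul _ _ _)
  right_inv v := Subtype.ext (funext fun m => phase_mul_neg _ _ _)

theorem grossDifferential_phaseEquiv (hinv : IsTorusInvariant ω) (ξ : Fin d → ℝ)
    (x : Smoothing fan c) (v : tangent x) :
    grossDifferential ω K (torusAct ξ x) (phaseEquiv ξ x v) = grossDifferential ω K x v := by
  refine Prod.ext (funext fun j => ?_) ?_
  · refine hinv ξ x _ _ _ _ (fun m => ?_) fun m => rfl
    rw [generator_val, generator_val, torusAct_val]
    ring
  · change 2 * ((starRingEnd ℂ) ((torusAct ξ x).t - K) * (phase ξ (tExp d 0) * _)).re =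
      2 * ((starRingEnd ℂ) (x.t - K) * _).re
    rw [torusAct_t]
    simp [phase, weight, tExp]

/-- One real frame at `x` is carried to frames along its whole torus orbit. The equation `hy` allows
`y` to be a boundary value of a disc. -/
theorem exists_ker_basis (hinv : IsTorusInvariant ω) {ξ : Fin d → ℝ} {x y : Smoothing fan c}
    (hy : y = torusAct ξ x)
    (f : Module.Basis (Fin (d + 1)) ℝ (LinearMap.ker (grossDifferential ω K x))) :
    ∃ f' : Module.Basis (Fin (d + 1)) ℝ (LinearMap.ker (grossDifferential ω K y)),
      ∀ j m, ((f' j : tangent y) : MLattice d p → ℂ) m =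
        phase ξ m * ((f j : tangent x) : MLattice d p → ℂ) m := by
  subst hy
  have hmap : (LinearMap.ker (grossDifferential ω K x)).map (phaseEquiv ξ x).toLinearMap =
      LinearMap.ker (grossDifferential ω K (torusAct ξ x)) := by
    ext w
    constructor
    · rintro ⟨v, hv, rfl⟩
      exact (grossDifferential_phaseEquiv hinv ξ x v).trans hv
    · intro hw
      refine ⟨(phaseEquiv ξ x).symm w, ?_, (phaseEquiv ξ x).apply_symm_apply w⟩
      have := grossDifferential_phaseEquiv (K := K) hinv ξ x ((phaseEquiv ξ x).symm w)
      rw [(phaseEquiv ξ x).apply_symm_apply] at this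
      exact this.symm.trans hw
  exact ⟨f.map ((phaseEquiv ξ x).ofSubmodules _ _ hmap), fun j m => rfl⟩

/-! ### Two-dimensional faces -/

theorem finite_coneGenerators : (coneGenerators u).Finite := by
  have : coneGenerators u = ⋃ i, (fun v => ((v, Pi.single i 1) : NLattice d p)) ''
      insert 0 (Set.range (u i)) := by
    ext g
    simp only [coneGenerators, Set.mem_ofPred_eq, Set.mem_iUnion, Set.mem_image, eq_comm]
  rw [this]
  exact Set.finite_iUnion fun i => ((Set.finite_range _).insert _).image _

/-- Any two vertices of `R_i` span a face. -/
theorem pair_mem_affineFan {i : Fin (p + 1)} (B : AdaptedBasis d p i)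
    (hB : ∀ v ∈ insert 0 (Set.range (u i)), ∃ a, B.gen a = (v, Pi.single i 1))
    {a₀ b₀ : Fin (d + 1)} (ha : B.gen a₀ ∈ coneGenerators u) (hb : B.gen b₀ ∈ coneGenerators u) :
    {B.gen a₀, B.gen b₀} ∈ affineFan u := by
  set S : Finset (Fin (d + 1)) := Finset.univ \ {a₀, b₀} with hS
  have hgen : ∀ b, pairing (∑ a ∈ S, B.exp a) (B.gen b) = if b ∈ S then 1 else 0 := fun b => by
    rw [pairing_sum]
    simp only [B.pairing_exp, Finset.sum_ite_eq']
  obtain ⟨N, hN⟩ := ((finite_coneGenerators (u := u)).image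
    (pairing (∑ a ∈ S, B.exp a))).bddBelow
  have hN' : ∀ g ∈ coneGenerators u, N ≤ pairing (∑ a ∈ S, B.exp a) g := fun g hg =>
    hN ⟨g, hg, rfl⟩
  -- The first sum vanishes on exactly the two chosen vertices among the `gen b`. On generators over
  -- the other `e_j` it is at least `N`, and the factor `1 - N` lifts it to at least 1.
  set m : MLattice d p := ∑ a ∈ S, B.exp a + (1 - N) • ∑ l ∈ Finset.univ.erase i, tExp d l with hm
  have hm' : ∀ g, pairing m g = pairing (∑ a ∈ S, B.exp a) g +
      (1 - N) * ∑ l ∈ Finset.univ.erase i, g.2 l := fun g => by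
    rw [hm, pairing_add, pairing_smul, pairing_sum (Finset.univ.erase i)]
    simp only [pairing_tExp]
  have hmi : ∀ b, pairing m (B.gen b) = if b ∈ S then 1 else 0 := fun b => by
    rw [hm', hgen, Finset.sum_eq_zero fun l hl => B.gen_snd b l (Finset.ne_of_mem_erase hl),
      mul_zero, add_zero]
  have hmo : ∀ j ≠ i, ∀ v : Fin d → ℤ, ((v, Pi.single j 1) : NLattice d p) ∈ coneGenerators u →
      0 < pairing m (v, Pi.single j 1) := fun j hj v hv => by
    rw [hm', Finset.sum_eq_single_of_mem j (by simp [hj]) fun l _ hl => by simp [hl]]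
    have := hN' _ hv
    simp only [Pi.single_eq_same, mul_one]
    omega
  refine ⟨m, ?_, ?_⟩
  · rintro g hg
    obtain ⟨j, v, hv, rfl⟩ := hg
    by_cases hj : j = i
    · subst hj
      obtain ⟨b, hb⟩ := hB v hv
      rw [← hb, hmi]
      split_ifs <;> simp
    · exact (hmo j hj v ⟨j, v, hv, rfl⟩).le
  · ext g
    constructor
    · rintro (rfl | rfl)
      · exact ⟨ha, by rw [hmi]; simp [hS]⟩
      · exact ⟨hb, by rw [hmi]; simp [hS]⟩
    · rintro ⟨⟨j, v, hv, rfl⟩, h0⟩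
      by_cases hj : j = i
      · subst hj
        obtain ⟨b, hb⟩ := hB v hv
        rw [← hb, hmi] at h0
        have : b ∉ S := fun h => by simp [h] at h0
        have : b = a₀ ∨ b = b₀ := by simpa [hS, -not_or, or_iff_not_imp_left] using this
        rw [← hb]
        rcases this with rfl | rfl <;> simp
      · exact absurd h0 (hmo j hj v ⟨j, v, hv, rfl⟩).ne'

/-! ### The discs over the hyperplanes -/

/-- A point `x` of the orbit of the ray generated by `g`, and a two-dimensional face that contains
`g`. -/
structure IsRayPoint (x : Smoothing fan c) (g g' : NLattice d p) : Prop where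
  cone_eq : x.1.cone = {g}
  face_mem : {g, g'} ∈ fan
  snd_eq : g.2 = g'.2
  tExp_mem : ∀ l, tExp d l ∈ x.dom
  val_tExp : ∀ l, x.val (tExp d l) = x.t - c l

open Classical in
/-- The cone of the point with parameter `z` of the disc in the closure of the orbit of `g`. -/
def discCone (g g' : NLattice d p) (z : ℂ) : Set (NLattice d p) := if z = 0 then {g, g'} else {g}

namespace IsRayPoint

variable {x : Smoothing fan c} {g g' : NLattice d p}

theorem mem_dom (h : IsRayPoint x g g') {z : ℂ} {m : MLattice d p}
    (hm : m ∈ dualMonoid (discCone g g' z)) : m ∈ x.dom := by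
  intro l hl
  rw [h.cone_eq] at hl
  rw [hl]
  refine hm g ?_
  unfold discCone
  split_ifs <;> simp

theorem pairing_nonneg {z : ℂ} {m : MLattice d p}
    (hm : m ∈ dualMonoid (discCone g g' z)) : z ≠ 0 ∨ 0 ≤ pairing m g' := by
  by_cases hz : z = 0
  · exact Or.inr (hm g' (by simp [discCone, hz]))
  · exact Or.inl hz

theorem tExp_mem_discCone (h : IsRayPoint x g g') (z : ℂ) (l : Fin (p + 1)) :
    tExp d l ∈ dualMonoid (discCone g g' z) := by
  have h1 : 0 ≤ pairing (tExp d l) g := h.tExp_mem l g (by rw [h.cone_eq]; rfl)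
  have h2 : 0 ≤ pairing (tExp d l) g' := by
    rw [pairing_tExp, ← h.snd_eq, ← pairing_tExp]; exact h1
  intro g₁ hg₁
  unfold discCone at hg₁
  split_ifs at hg₁
  · rcases hg₁ with rfl | rfl
    · exact h1
    · exact h2
  · rw [hg₁]; exact h1

/-- If t_l is non-zero, its exponent pairs to zero with `g`, hence with `g'`, which has the same
height. So every t_l is constant along the disc. -/
theorem zpow_mul_val_tExp (h : IsRayPoint x g g') (z : ℂ) (l : Fin (p + 1)) :
    z ^ pairing (tExp d l) g' * x.val (tExp d l) = x.val (tExp d l) := by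
  by_cases h0 : x.val (tExp d l) = 0
  · rw [h0, mul_zero]
  · have := Smoothing.pairing_eq_zero h0 g (by rw [h.cone_eq]; rfl)
    rw [pairing_tExp, ← h.snd_eq, ← pairing_tExp, this, zpow_zero, one_mul]

open Classical in
/-- The points of the disc. -/
def toricPoint (h : IsRayPoint x g g') (z : ℂ) : ToricPoint fan where
  cone := discCone g g' z
  cone_mem := by
    unfold discCone
    split_ifs
    · exact h.face_mem
    · rw [← h.cone_eq]; exact x.1.cone_mem
  -- The one-parameter subgroup of `g'` applied to `x`, continued to z = 0.
  val m := if m ∈ dualMonoid (discCone g g' z) then z ^ pairing m g' * x.val m else 0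
  val_outside m hm := if_neg hm
  val_zero := by
    rw [if_pos (zero_mem_dualMonoid _), pairing_zero, zpow_zero, x.val_zero, one_mul]
  val_add m hm m' hm' := by
    rw [if_pos hm, if_pos hm', if_pos (add_mem_dualMonoid hm hm'), pairing_add,
      x.val_add (h.mem_dom hm) (h.mem_dom hm'), zpow_add']
    · ring
    · rcases pairing_nonneg hm with hz | hn
      · exact Or.inl hz
      · rcases pairing_nonneg hm' with hz | hn'
        · exact Or.inl hz
        · right; omega
  val_ne_zero_iff m hm := by
    rw [if_pos hm, mul_ne_zero_iff, x.val_ne_zero_iff (h.mem_dom hm), h.cone_eq]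
    by_cases hz : z = 0
    · have : (z ^ pairing m g' ≠ 0) ↔ pairing m g' = 0 := by
        rw [hz, zero_zpow_eq]; simp
      rw [this]
      simp [discCone, hz, and_comm]
    · simp [discCone, hz, zpow_ne_zero]

open Classical in
theorem toricPoint_val (h : IsRayPoint x g g') {z : ℂ} {m : MLattice d p}
    (hm : m ∈ dualMonoid (discCone g g' z)) :
    (h.toricPoint z).val m = z ^ pairing m g' * x.val m := if_pos hm

/-- The disc in the closure of the orbit of `g`. -/
def toDisc (h : IsRayPoint x g g') (z : ℂ) : Smoothing fan c :=
  ⟨h.toricPoint z, fun i m hm _ _ => by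
    have h1 := h.tExp_mem_discCone z i
    have h2 := h.tExp_mem_discCone z 0
    rw [(h.toricPoint z).val_add m hm _ h1, (h.toricPoint z).val_add m hm _ h2,
      h.toricPoint_val h1, h.toricPoint_val h2, h.zpow_mul_val_tExp, h.zpow_mul_val_tExp,
      h.val_tExp i]
    change _ = _ * x.t - _
    ring⟩

theorem toDisc_cone (h : IsRayPoint x g g') (z : ℂ) : (h.toDisc z).1.cone = discCone g g' z := rfl

theorem toDisc_val (h : IsRayPoint x g g') {z : ℂ} {m : MLattice d p}
    (hm : m ∈ (h.toDisc z).dom) : (h.toDisc z).val m = z ^ pairing m g' * x.val m :=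
  h.toricPoint_val hm

theorem toDisc_mem_finitePart (h : IsRayPoint x g g') (z : ℂ) : h.toDisc z ∈ finitePart fan c :=
  h.tExp_mem_discCone z 0

theorem eventually_mem_dom (h : IsRayPoint x g g') {z : ℂ} {m : MLattice d p}
    (hm : m ∈ (h.toDisc z).dom) : ∀ᶠ w in 𝓝 z, m ∈ (h.toDisc w).dom := by
  by_cases hz : z = 0
  · refine Eventually.of_forall fun w g₁ hg₁ => hm g₁ ?_
    rw [toDisc_cone, discCone] at hg₁ ⊢
    rw [if_pos hz]
    split_ifs at hg₁
    · exact hg₁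
    · exact Or.inl hg₁
  · filter_upwards [isOpen_ne.mem_nhds hz] with w hw g₁ hg₁
    refine hm g₁ ?_
    rw [toDisc_cone, discCone, if_neg hw] at hg₁
    rw [toDisc_cone, discCone, if_neg hz]
    exact hg₁

theorem differentiableAt_toDisc (h : IsRayPoint x g g') {z : ℂ} {m : MLattice d p}
    (hm : m ∈ (h.toDisc z).dom) : DifferentiableAt ℂ (fun w => (h.toDisc w).val m) z := by
  have h1 : DifferentiableAt ℂ (fun w : ℂ => w ^ pairing m g' * x.val m) z :=
    (differentiableAt_zpow.2 (pairing_nonneg hm)).mul_const _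
  refine h1.congr_of_eventuallyEq ?_
  filter_upwards [h.eventually_mem_dom hm] with w hw using h.toDisc_val hw

theorem continuous_toDisc (h : IsRayPoint x g g') : Continuous h.toDisc :=
  continuous_iff_continuousAt.2 fun _ => Smoothing.tendsto_nhds_iff.2 fun _ hm =>
    ⟨h.eventually_mem_dom hm, (h.differentiableAt_toDisc hm).continuousAt⟩

theorem toDisc_zero_ne (h : IsRayPoint x g g') (hne : g ≠ g') : h.toDisc 0 ≠ h.toDisc 1 := by
  intro h0
  have h1 := (Smoothing.ext_iff'.1 h0).1
  rw [toDisc_cone, toDisc_cone, discCone, discCone, if_pos rfl, if_neg one_ne_zero] at h1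
  have h2 : g' ∈ ({g} : Set (NLattice d p)) := h1 ▸ Or.inr rfl
  exact hne (Set.mem_singleton_iff.1 h2).symm

/-- The rotation of the torus that rotates the disc. -/
def rotation (g g' : NLattice d p) (θ : ℝ) : Fin d → ℝ :=
  θ • fun j => ((g'.1 j - g.1 j : ℤ) : ℝ)

theorem weight_rotation (h2 : g.2 = g'.2) (θ : ℝ) (m : MLattice d p) :
    weight m (rotation g g' θ) = θ * (pairing m g' - pairing m g : ℤ) := by
  rw [← weight_sub_eq h2]
  simp [weight, rotation, Finset.mul_sum, mul_left_comm]

/-- Characters non-zero at `x` pair to zero with `g`, so on them `g'` acts like g' - g ∈ ν^⊥. The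
boundary is therefore an orbit of the compact torus and stays in the fibre. -/
theorem toDisc_exp (h : IsRayPoint x g g') (θ : ℝ) :
    h.toDisc (Complex.exp (Complex.I * θ)) = torusAct (rotation g g' θ) x := by
  have hcone : (h.toDisc (Complex.exp (Complex.I * θ))).1.cone = x.1.cone := by
    rw [toDisc_cone, discCone, if_neg (Complex.exp_ne_zero _), h.cone_eq]
  have hdom : (h.toDisc (Complex.exp (Complex.I * θ))).dom = x.dom := by
    rw [Smoothing.dom, ToricPoint.dom, hcone]; rfl
  refine Smoothing.ext_iff'.2 ⟨hcone, funext fun m => ?_⟩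
  rw [torusAct_val]
  by_cases hm : x.val m = 0
  · rw [hm, mul_zero]
    by_cases hd : m ∈ x.dom
    · rw [h.toDisc_val (hdom ▸ hd), hm, mul_zero]
    · exact Smoothing.val_outside _ (hdom ▸ hd)
  · rw [h.toDisc_val (hdom ▸ Smoothing.mem_dom_of_val_ne_zero hm), phase, weight_rotation h.snd_eq,
      Smoothing.pairing_eq_zero hm g (by rw [h.cone_eq]; rfl), sub_zero, ← Complex.exp_int_mul]
    congr 2
    push_cast
    ring

theorem isHolomorphicDisc_toDisc (h : IsRayPoint x g g') (hμ : IsMomentMap ω μ) {r : Base d}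
    (hx : x ∈ fiber μ K r) : IsHolomorphicDisc h.toDisc (fiber μ K r) where
  continuousOn := h.continuous_toDisc.continuousOn
  holomorphic _ _ _ hm := h.differentiableAt_toDisc hm
  boundary z hz := by
    obtain ⟨θ, rfl⟩ : ∃ θ : ℝ, z = Complex.exp (Complex.I * θ) := by
      refine ⟨z.arg, ?_⟩
      have := Complex.norm_mul_exp_arg_mul_I z
      rw [mem_sphere_zero_iff_norm.1 hz, Complex.ofReal_one, one_mul] at this
      rw [mul_comm, this]
    refine ⟨h.toDisc_mem_finitePart _, ?_⟩
    rw [h.toDisc_exp, gross, hμ.invariant, torusAct_t]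
    exact hx.2

end IsRayPoint

/-! ### The Maslov index of the ray discs -/

theorem AdaptedBasis.continuousAt_partialVal {i : Fin (p + 1)} (B : AdaptedBasis d p i)
    {x : Smoothing fan c} (hxB : x.1.cone ⊆ Set.range B.gen) (hi : tExp d i ∈ x.dom)
    (a : Fin (d + 1)) {m : MLattice d p} (hm : m ∈ x.dom) :
    ContinuousAt (fun y : Smoothing fan c => B.partialVal a y m) x := by
  unfold AdaptedBasis.partialVal
  have hz : ∀ (n : ℤ) (m : MLattice d p), (n ≠ 0 → m ∈ x.dom) →
      ContinuousAt (fun y : Smoothing fan c => (n : ℂ) * y.val m) x := by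
    intro n m h
    by_cases hn : n = 0
    · simp only [hn, Int.cast_zero, zero_mul]
      exact continuousAt_const
    · exact continuousAt_const.mul (Smoothing.continuousAt_val (h hn))
  refine (hz _ _ fun h => B.sub_exp_mem_dom hxB hm h).add
    ((hz _ _ fun h => B.sub_exp_mem_dom hxB hi ?_).mul ?_)
  · rwa [pairing_tExp]
  · exact tendsto_finsetSum _ fun l hl =>
      hz _ _ fun _ => B.sub_tExp_mem_dom hxB (Finset.ne_of_mem_erase hl) hm

theorem AdaptedBasis.frame_det {i : Fin (p + 1)} (B : AdaptedBasis d p i)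
    (hfan : fan ⊆ compactifiedFan u) {x : Smoothing fan c} (hx : x ∈ finitePart fan c)
    (hxB : x.1.cone ⊆ Set.range B.gen) (f : Fin (d + 1) → tangent x) :
    (B.frame hfan hx hxB).det f =
      (Matrix.of fun a j => (f j : MLattice d p → ℂ) (B.exp a)).det := by
  rw [Module.Basis.det_apply]
  congr 1

theorem exists_exp_eq_sq_div {D : ℂ} (hD : D ≠ 0) :
    ∃ φ : ℝ, Complex.exp (Complex.I * φ) = D ^ 2 / (‖D‖ : ℂ) ^ 2 := by
  refine ⟨(D ^ 2 / (‖D‖ : ℂ) ^ 2).arg, ?_⟩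
  have h1 := Complex.norm_mul_exp_arg_mul_I (D ^ 2 / (‖D‖ : ℂ) ^ 2)
  have h2 : ‖D ^ 2 / (‖D‖ : ℂ) ^ 2‖ = 1 := by
    rw [norm_div, norm_pow, norm_pow, Complex.norm_real, norm_norm]
    exact div_self (pow_ne_zero 2 (norm_ne_zero_iff.2 hD))
  rw [h2, Complex.ofReal_one, one_mul] at h1
  rw [mul_comm, h1]

theorem nonempty_basis_of_finrank_eq {V : Type*} [AddCommGroup V] [Module ℝ V] (N : Submodule ℝ V)
    {n : ℕ} (h : Module.finrank ℝ N = n + 1) : Nonempty (Module.Basis (Fin (n + 1)) ℝ N) :=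
  have : FiniteDimensional ℝ N := FiniteDimensional.of_finrank_pos (by omega)
  ⟨Module.finBasisOfFinrankEq ℝ N h⟩

/-- The disc in the closure of the orbit of a ray has Maslov index zero. -/
theorem IsRayPoint.hasMaslovIndex_zero {i : Fin (p + 1)} (B : AdaptedBasis d p i)
    (hfan : fan ⊆ compactifiedFan u) (hω : IsKahlerForm ω) (hinv : IsTorusInvariant ω)
    (hμ : IsMomentMap ω μ) {x : Smoothing fan c}
    (hsurj : Function.Surjective (grossDifferential ω K x)) {a₀ b₀ : Fin (d + 1)}
    (h : IsRayPoint x (B.gen a₀) (B.gen b₀)) : HasMaslovIndex ω K h.toDisc 0 := by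
  have hx : x ∈ finitePart fan c := h.tExp_mem 0
  have hxB : x.1.cone ⊆ Set.range B.gen := by
    rw [h.cone_eq, Set.singleton_subset_iff]
    exact ⟨a₀, rfl⟩
  have hzB : ∀ z, (h.toDisc z).1.cone ⊆ Set.range B.gen := fun z g hg => by
    rw [toDisc_cone, discCone] at hg
    split_ifs at hg
    · rcases hg with rfl | rfl
      exacts [⟨_, rfl⟩, ⟨_, rfl⟩]
    · rw [hg]; exact ⟨_, rfl⟩
  have hfin : Module.finrank ℂ (tangent x) = d + 1 := by
    rw [Module.finrank_eq_card_basis (B.frame hfan hx hxB), Fintype.card_fin]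
  obtain ⟨f₀⟩ := nonempty_basis_of_finrank_eq _ (finrank_ker hsurj hfin)
  choose f hf using fun θ => exists_ker_basis hinv (h.toDisc_exp θ) f₀
  have hD : ∀ θ : ℝ, (B.frame hfan (h.toDisc_mem_finitePart (Complex.exp (Complex.I * θ)))
      (hzB _)).det (fun j => (f θ j : tangent (h.toDisc (Complex.exp (Complex.I * θ))))) =
        (B.frame hfan hx hxB).det (fun j => (f₀ j : tangent x)) := by
    intro θ
    -- The rotation has weight 1 on `exp b₀`, -1 on `exp a₀` and 0 on the other coordinates, so the
    -- determinant of the rotated frame does not change.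
    have hone : ∏ a, phase (rotation (B.gen a₀) (B.gen b₀) θ) (B.exp a) = 1 := by
      simp only [phase]
      rw [← Complex.exp_sum, ← Finset.mul_sum, ← Complex.ofReal_sum]
      simp only [weight_rotation h.snd_eq, B.pairing_exp]
      rw [← Finset.mul_sum, ← Int.cast_sum, Finset.sum_sub_distrib]
      simp
    rw [B.frame_det, B.frame_det]
    simp only [hf]
    exact (Matrix.det_mul_column _ _).trans (by rw [hone, one_mul]; rfl)
  obtain ⟨φ, hφ⟩ := exists_exp_eq_sq_div
    (det_ker_frame_ne_zero hω hμ hsurj (B.frame hfan hx hxB) f₀)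
  refine ⟨fun z => B.frame hfan (h.toDisc_mem_finitePart z) (hzB z), f, fun _ => φ, ?_,
    continuous_const, fun θ => ?_, by simp⟩
  · intro z _ m hm j
    refine ContinuousAt.continuousWithinAt ?_
    have h1 : ContinuousAt (fun w => B.partialVal j (h.toDisc w) m) z :=
      ContinuousAt.comp (f := h.toDisc)
        (B.continuousAt_partialVal (hzB z) (h.tExp_mem_discCone z i) j hm)
        h.continuous_toDisc.continuousAt
    refine h1.congr ?_
    filter_upwards [h.eventually_mem_dom hm] with w hw
    exact (B.frame_apply hfan _ _ j hw).symm
  · rw [hφ, hD]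

/-- Regular fibres over the hyperplanes bound non-constant discs of Maslov index zero. -/
theorem exists_disc_of_mem_hyperplane (hk : ∀ i, 1 ≤ k i) (hu : ∀ i, IsUnimodularSimplex (u i))
    (hfan : fan ⊆ compactifiedFan u) (hfan' : affineFan u ⊆ fan) (hc0 : c 0 = 0)
    (hdist : Function.Injective fun i => ‖c i - K‖) (hω : IsKahlerForm ω)
    (hinv : IsTorusInvariant ω) (hμ : IsMomentMap ω μ) {r : Base d}
    (hcomp : IsCompact (fiber μ K r)) (hr : r ∈ regularBase ω μ K) {i : Fin (p + 1)}
    (hi : r ∈ hyperplane d c K i) : ∃ s : ℂ → Smoothing fan c, IsHolomorphicDisc s (fiber μ K r) ∧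
      (∃ z ∈ disc, ∃ w ∈ disc, s z ≠ s w) ∧ HasMaslovIndex ω K s 0 := by
  have hc : Function.Injective c := fun a b hab => hdist (by simp only [hab])
  obtain ⟨⟨y, hy, hyr⟩, hreg⟩ := hr
  obtain ⟨x, hx, hxt⟩ := exists_mem_fiber_t_eq hfan hc0 hdist hω hμ hcomp ⟨y, hy, hyr⟩ hi
  have hsurj : Function.Surjective (grossDifferential ω K x) := by
    by_contra hns
    exact hreg ⟨x, hx, hns⟩
  obtain ⟨B, hB⟩ := exists_adaptedBasis i (hu i)
  obtain ⟨g, hg⟩ := cone_nonempty hfan hxt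
  obtain ⟨v, hv, rfl⟩ := eq_of_mem_cone hfan hc hx.1 hxt hg
  have hcone : x.1.cone = {(v, Pi.single i 1)} := by
    refine Set.eq_singleton_iff_unique_mem.2 ⟨hg, fun g' hg' => ?_⟩
    obtain ⟨v', -, rfl⟩ := eq_of_mem_cone hfan hc hx.1 hxt hg'
    exact cone_subsingleton hsurj hg' hg rfl
  -- A second vertex exists because k_i ≥ 1 and the u^i_j are non-zero.
  obtain ⟨v', hv', hne⟩ : ∃ v' ∈ insert 0 (Set.range (u i)), v ≠ v' := by
    by_cases h0 : v = 0
    · refine ⟨u i ⟨0, hk i⟩, Or.inr ⟨_, rfl⟩, fun h1 => ?_⟩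
      refine (hu i).1.ne_zero ⟨0, hk i⟩ ?_
      rw [← h1, h0]
      simp only [Pi.zero_apply, Int.cast_zero]
      rfl
    · exact ⟨0, Or.inl rfl, h0⟩
  obtain ⟨a, ha⟩ := hB v hv
  obtain ⟨b, hb⟩ := hB v' hv'
  have hray : IsRayPoint x (B.gen a) (B.gen b) :=
    { cone_eq := by rw [ha, hcone]
      face_mem := hfan' (pair_mem_affineFan B hB (by rw [ha]; exact ⟨i, v, hv, rfl⟩)
        (by rw [hb]; exact ⟨i, v', hv', rfl⟩))
      snd_eq := by rw [ha, hb]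
      tExp_mem := tExp_mem_dom hfan hx.1
      val_tExp := val_tExp hfan hx.1 }
  refine ⟨hray.toDisc, hray.isHolomorphicDisc_toDisc hμ hx,
    ⟨0, by simp [disc], 1, by simp [disc], hray.toDisc_zero_ne fun h => ?_⟩,
    hray.hasMaslovIndex_zero B hfan hω hinv hμ hsurj⟩
  rw [ha, hb] at h
  exact hne (congrArg Prod.fst h)

/-! ### The wall -/

/-- Bounding the fan on both sides treats the two varieties together: the upper bound limits the
strata that a disc can meet, the lower bound supplies the faces from which discs are built. -/
theorem wall_eq (hk : ∀ i, 1 ≤ k i) (hu : ∀ i, IsUnimodularSimplex (u i))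
    (hfan : fan ⊆ compactifiedFan u) (hfan' : affineFan u ⊆ fan) (hc0 : c 0 = 0)
    (hcK : ∀ i, c i ≠ K) (hdist : Function.Injective fun i => ‖c i - K‖) (hω : IsKahlerForm ω)
    (hinv : IsTorusInvariant ω) (hμ : IsMomentMap ω μ) (hcomp : ∀ r, IsCompact (fiber μ K r)) :
    wall ω μ K = (⋃ i, hyperplane d c K i) ∩ regularBase ω μ K := by
  ext r
  constructor
  · rintro ⟨hr, s, hs, hne, hM⟩
    exact ⟨Set.mem_iUnion.2 (exists_hyperplane_of_disc hu hfan
      (fun a b hab => hdist (by simp only [hab])) hc0 hcK hω hμ hr.2 hs hne hM), hr⟩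
  · rintro ⟨hi, hr⟩
    obtain ⟨i, hi⟩ := Set.mem_iUnion.1 hi
    exact ⟨hr, exists_disc_of_mem_hyperplane hk hu hfan hfan' hc0 hdist hω hinv hμ (hcomp r) hr hi⟩

theorem disjoint_hyperplane (hdist : Function.Injective fun i => ‖c i - K‖) :
    Pairwise fun i j => Disjoint (hyperplane d c K i) (hyperplane d c K j) := by
  refine fun i j hij => Set.disjoint_left.2 fun r hi hj => hij (hdist ?_)
  have h : ‖c i - K‖ ^ 2 - K ^ 2 = ‖c j - K‖ ^ 2 - K ^ 2 := Eq.trans (Eq.symm hi) hj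
  exact (sq_eq_sq₀ (norm_nonneg _) (norm_nonneg _)).1 (sub_left_injective h)

end GrossFibration

end

open GrossFibration in
theorem proposition4p5 {d p : ℕ} (k : Fin (p + 1) → ℕ) (hk : ∀ i, 1 ≤ k i)
    (u : ∀ i, Fin (k i) → Fin d → ℤ) (hu : ∀ i, IsUnimodularSimplex (u i))
    (c : Fin (p + 1) → ℂ) (hc₀ : c 0 = 0) (K : ℝ) (hK : 0 < K)
    (hcK : ∀ i, c i ≠ K) (hdist : Function.Injective fun i => ‖c i - K‖) :
    (∀ (ω : BilinField (affineFan u) c) (μ : Smoothing (affineFan u) c → Fin d → ℝ),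
      IsKahlerForm ω → IsTorusInvariant ω → IsMomentMap ω μ → (∀ r, IsCompact (fiber μ K r)) →
        wall ω μ K = (⋃ i, hyperplane d c K i) ∩ regularBase ω μ K) ∧
    (∀ (ω : BilinField (compactifiedFan u) c)
      (μ : Smoothing (compactifiedFan u) c → Fin d → ℝ),
      IsKahlerForm ω → IsTorusInvariant ω → IsMomentMap ω μ → (∀ r, IsCompact (fiber μ K r)) →
        wall ω μ K = (⋃ i, hyperplane d c K i) ∩ regularBase ω μ K) ∧
    Pairwise fun i j => Disjoint (hyperplane d c K i) (hyperplane d c K j) := by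
  exact ⟨fun ω μ hω hinv hμ hcomp => wall_eq hk hu (Set.subset_insert _ _) subset_rfl hc₀ hcK hdist
      hω hinv hμ hcomp,
    fun ω μ hω hinv hμ hcomp => wall_eq hk hu subset_rfl (Set.subset_insert _ _) hc₀ hcK hdist
      hω hinv hμ hcomp,
    disjoint_hyperplane hdist⟩
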